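/- Let $G$ be a toroidal map, i.e. a finite connected graph (loops and multiple edges allowed) embedded on the torus so that all faces are topological disks. Assume that $G$ is weakly $3$-connected, i.e. that its periodic representation in the plane (the lift of $G$ to the universal cover) is $3$-connected: it has no loops, no multiple edges, at least four vertices, and it stays connected after the deletion of any at most two vertices. Cycles are simple (loops and cycles formed by two distinct edges are allowed) and oriented, and a cycle is non-contractible if it is not homotopic to a point on the torus. Let $\Gamma$ be a non-contractible cycle of $G$. Then $G$ has a tambourine parallel to $\Gamma$: there are cycles $\Gamma_1,\Gamma_2$ of $G$, both freely homotopic to $\Gamma$ as oriented curves (possibly sharing vertices and edges, possibly equal), which delimit a connected region $T$ formed by the faces to the right of $\Gamma_1$ and to the left of $\Gamma_2$ (if $\Gamma_1=\Gamma_2$, then $T$ is the torus cut along this cycle), such that the dual edges of the edges of $T\setminus\{\Gamma_1,\Gamma_2\}$ are exactly the edges of a non-contractible cycle of the dual map $G^*$ that, suitably oriented, is freely homotopic to $\Gamma_1$ and to $\Gamma_2$. -/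

import Mathlib

/-- A map on an oriented surface, as a combinatorial map (rotation system). `D` is the set of darts
(oriented edges). `σ` sends a dart to the next one, counterclockwise, around its origin, and `α`
reverses a dart. Vertices, edges and faces are the orbits of `σ`, `α` and `φ = σ⁻¹ * α`. -/
structure CombMap (D : Type*) where
  σ : Equiv.Perm D
  α : Equiv.Perm D
  α_invol : ∀ d, α (α d) = d
  α_ne : ∀ d, α d ≠ d

namespace CombMap

/-- Words in the two letters `rot` (acting as `σ`) and `flip` (acting as `α`). A word describes a
curve on the surface issued from a given dart; words are read from right to left, so that `v * w`
is the curve `w` followed by the curve `v`. -/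
abbrev Word := FreeGroup Bool

/-- The letter that turns around the origin of a dart. -/
def rot : Word := FreeGroup.of true

/-- The letter that passes from a dart to its reverse. -/
def flip : Word := FreeGroup.of false

/-- The word that turns around the face on the left of a dart. -/
def faceRot : Word := rot⁻¹ * flip

variable {D : Type*} (M : CombMap D)

/-- The face permutation: `φ d` is the dart after `d` on the contour of the face on the left of
`d`. -/
def φ : Equiv.Perm D := M.σ⁻¹ * M.α

/-- The vertices. -/
def Vertex : Type _ := Quotient (Equiv.Perm.SameCycle.setoid M.σ)

/-- The edges. -/
def Edge : Type _ := Quotient (Equiv.Perm.SameCycle.setoid M.α)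

/-- The faces. -/
def Face : Type _ := Quotient (Equiv.Perm.SameCycle.setoid M.φ)

/-- The origin of a dart. -/
def origin (d : D) : M.Vertex := Quotient.mk (Equiv.Perm.SameCycle.setoid M.σ) d

/-- The face on the left of a dart; the face on its right is `M.leftFace (M.α d)`. -/
def leftFace (d : D) : M.Face := Quotient.mk (Equiv.Perm.SameCycle.setoid M.φ) d

/-- The dual map. Its vertices are the faces of `M`; the dart `d` of the dual crosses the dart `d`
of `M` from the face on the left to the face on the right. -/
def dual : CombMap D where
  σ := M.φ
  α := M.α
  α_invol := M.α_invol
  α_ne := M.α_ne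

/-- The end of the curve given by a word, as a function of its starting dart. -/
def act : Word →* Equiv.Perm D := FreeGroup.lift (fun b => if b then M.σ else M.α)

theorem act_rot : M.act rot = M.σ := by simp [act, rot]

theorem act_flip : M.act flip = M.α := by simp [act, flip]

theorem act_faceRot : M.act faceRot = M.φ := by
  rw [faceRot, map_mul, map_inv, act_rot, act_flip, φ]

/-- The null-homotopic closed curves based at the dart `d`: the products of curves that go from `d`
to some dart along `w`, turn there a whole number of times around a vertex, an edge or a face, and
come back along `w`. -/
def nullLoops (d : D) : Subgroup Word :=
  Subgroup.closure {x | ∃ w r : Word,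
    (r ∈ Subgroup.zpowers rot ∨ r ∈ Subgroup.zpowers flip ∨ r ∈ Subgroup.zpowers faceRot) ∧
    M.act r (M.act w d) = M.act w d ∧ x = w⁻¹ * r * w}

theorem act_of_mem_nullLoops {d : D} {x : Word} (hx : x ∈ M.nullLoops d) : M.act x d = d := by
  induction hx using Subgroup.closure_induction with
  | mem x hx =>
    obtain ⟨w, r, -, h, rfl⟩ := hx
    rw [map_mul, map_mul, Equiv.Perm.mul_apply, Equiv.Perm.mul_apply, h, map_inv,
      Equiv.Perm.inv_eq_iff_eq]
  | one => simp
  | mul x y _ _ hx hy => rw [map_mul, Equiv.Perm.mul_apply, hy, hx]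
  | inv x _ hx => rw [map_inv, Equiv.Perm.inv_eq_iff_eq, hx]

/-- The universal cover of a (connected) map: its darts are the homotopy classes of curves issued
from the base dart `d₀`. For a toroidal map this is the periodic representation in the plane. -/
def universalCover (d₀ : D) : CombMap (Word ⧸ M.nullLoops d₀) where
  σ := MulAction.toPerm rot
  α := MulAction.toPerm flip
  α_invol x := by
    induction x using QuotientGroup.induction_on with
    | H w =>
      simp only [MulAction.toPerm_apply, MulAction.Quotient.smul_coe, smul_eq_mul]
      refine QuotientGroup.eq.2 (Subgroup.subset_closure ⟨w, flip ^ (-2 : ℤ), ?_, ?_, ?_⟩)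
      · exact Or.inr (Or.inl ⟨-2, rfl⟩)
      · have h : M.α ^ (2 : ℤ) = 1 := by
          ext d
          rw [zpow_two, Equiv.Perm.mul_apply, M.α_invol, Equiv.Perm.one_apply]
        rw [map_zpow, act_flip, zpow_neg, h]
        simp
      · group
  α_ne x := by
    induction x using QuotientGroup.induction_on with
    | H w =>
      simp only [MulAction.toPerm_apply, MulAction.Quotient.smul_coe, smul_eq_mul]
      intro h
      have h2 := M.act_of_mem_nullLoops (QuotientGroup.eq.1 h)
      rw [mul_inv_rev, map_mul, map_mul, Equiv.Perm.mul_apply, Equiv.Perm.mul_apply, map_inv,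
        Equiv.Perm.inv_eq_iff_eq, map_inv, act_flip, Equiv.Perm.inv_eq_iff_eq] at h2
      exact M.α_ne _ h2.symm

/-- The underlying simple graph of a map. -/
def graph : SimpleGraph M.Vertex where
  Adj u v := u ≠ v ∧ ∃ d, M.origin d = u ∧ M.origin (M.α d) = v
  symm := ⟨by
    rintro u v ⟨h, d, hu, hv⟩
    exact ⟨h.symm, M.α d, hv, by rw [M.α_invol, hu]⟩⟩
  loopless := ⟨fun _ h => h.1 rfl⟩

/-- A (possibly infinite) map is 3-connected: no loops, no multiple edges, at least four vertices,
and the deletion of at most two vertices never disconnects the graph. -/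
structure ThreeConnected : Prop where
  no_loop : ∀ d, M.origin (M.α d) ≠ M.origin d
  no_multiple : ∀ d d', M.origin d = M.origin d' → M.origin (M.α d) = M.origin (M.α d') → d = d'
  four_le : 4 ≤ ENat.card M.Vertex
  connected : ∀ u v : M.Vertex, (M.graph.induce {x | x ≠ u ∧ x ≠ v}).Connected

/-- A toroidal map: a finite connected map of Euler characteristic `0`. -/
structure IsToroidal : Prop where
  finite : Finite D
  nonempty : Nonempty D
  connected : ∀ d d' : D, ∃ w : Word, M.act w d = d'
  euler : (Nat.card M.Vertex : ℤ) - Nat.card M.Edge + Nat.card M.Face = 0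

/-- Weak 3-connectedness: the universal cover is 3-connected (the base dart does not matter, as the
map is connected). -/
def WeaklyThreeConnected : Prop := ∀ d₀ : D, (M.universalCover d₀).ThreeConnected

/-- An oriented (simple) cycle of the map, of length `n + 1`; loops and cycles of length two (made
of two distinct edges) are allowed. -/
structure Cycle where
  n : ℕ
  dart : Fin (n + 1) → D
  next : ∀ i, M.σ.SameCycle (M.α (dart i)) (dart (i + 1))
  simple : ∀ i j, M.σ.SameCycle (dart i) (dart j) → i = j
  reduced : ∀ i j, M.α (dart i) ≠ dart j

/-- A closed curve on the surface. -/
structure ClosedCurve where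
  base : D
  word : Word
  closed : M.act word base = base

variable {M}

/-- The closed curve is homotopic to a point. -/
def ClosedCurve.Contractible (γ : M.ClosedCurve) : Prop := γ.word ∈ M.nullLoops γ.base

/-- Free homotopy of closed (oriented) curves. -/
def ClosedCurve.Homotopic (γ γ' : M.ClosedCurve) : Prop :=
  ∃ g : Word, M.act g γ.base = γ'.base ∧ g * γ.word * g⁻¹ * γ'.word⁻¹ ∈ M.nullLoops γ'.base

namespace Cycle

/-- The dart `d` is a dart of the oriented cycle. -/
def HasDart (c : M.Cycle) (d : D) : Prop := ∃ i, c.dart i = d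

/-- The edge that carries `d` is an edge of the cycle. -/
def HasEdge (c : M.Cycle) (d : D) : Prop := c.HasDart d ∨ c.HasDart (M.α d)

/-- The product of the words `R ^ kᵢ * flip`, where `kᵢ` is a number of turns that leads from the
reverse of the `i`-th dart to the next dart of the cycle. -/
noncomputable def word (c : M.Cycle) (R : Word) : Word :=
  ((List.ofFn fun i => R ^ (c.next i).choose * flip).reverse).prod

theorem act_word {N : CombMap D} (c : M.Cycle) (R : Word) (hσ : N.act R = M.σ) (hα : N.α = M.α) :
    N.act (c.word R) (c.dart 0) = c.dart 0 := by
  have key : ∀ m : ℕ, m ≤ c.n + 1 →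
      N.act ((((List.ofFn fun i => R ^ (c.next i).choose * flip).take m).reverse).prod) (c.dart 0)
        = c.dart (Fin.ofNat (c.n + 1) m) := by
    intro m
    induction m with
    | zero => simp
    | succ m ih =>
      intro hm
      have hm1 : m < c.n + 1 := hm
      have e : ((⟨m, hm1⟩ : Fin (c.n + 1))) = (Fin.ofNat (c.n + 1) m) := by
        ext
        simp [Nat.mod_eq_of_lt hm1]
      rw [List.take_add_one, List.getElem?_eq_getElem (by simpa using hm1), List.reverse_append,
        List.prod_append, map_mul, Equiv.Perm.mul_apply, ih (by omega)]
      simp only [Option.toList_some, List.reverse_singleton, List.prod_singleton, List.getElem_ofFn,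
        map_mul, map_zpow, hσ, act_flip, hα, Equiv.Perm.mul_apply, e]
      rw [(c.next (Fin.ofNat (c.n + 1) m)).choose_spec]
      congr 1
      ext
      simp [Fin.val_add]
  have h := key (c.n + 1) le_rfl
  rw [List.take_of_length_le (by simp)] at h
  rw [word, h]
  congr 1
  ext
  simp

/-- The closed curve that follows a cycle of the map. -/
noncomputable def curve (c : M.Cycle) : M.ClosedCurve where
  base := c.dart 0
  word := c.word rot
  closed := c.act_word rot M.act_rot rfl

/-- The closed curve, on the surface of `M`, that follows a cycle of the dual map: it crosses an
edge, turns inside the face that it enters up to the next edge of the dual cycle, and so on. -/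
noncomputable def dualCurve (c : M.dual.Cycle) : M.ClosedCurve where
  base := c.dart 0
  word := c.word faceRot
  closed := c.act_word faceRot M.act_faceRot rfl

end Cycle

/-- The dart `d` lies strictly inside the region made of the faces in `T` and cut along the cycles
`Γ₁` and `Γ₂`: both its sides are in `T` and its edge is on neither cycle. -/
def Inside (Γ₁ Γ₂ : M.Cycle) (T : Set M.Face) (d : D) : Prop :=
  M.leftFace d ∈ T ∧ M.leftFace (M.α d) ∈ T ∧ ¬ Γ₁.HasEdge d ∧ ¬ Γ₂.HasEdge d

/-- The oriented cycles `Γ₁` and `Γ₂` delimit the region made of the faces in `T`, on the right of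
`Γ₁` and on the left of `Γ₂`. The cycles may share vertices and edges, and may even be equal (then
`T` is the whole surface cut along the cycle). A side of an edge of `Γ₁` or `Γ₂` belongs to the
region exactly if it is the right side of `Γ₁` or the left side of `Γ₂`; the region extends through
all the other edges, and it is connected through its inside edges. -/
structure Delimits (Γ₁ Γ₂ : M.Cycle) (T : Set M.Face) : Prop where
  boundary : ∀ d, Γ₁.HasEdge d ∨ Γ₂.HasEdge d →
    (M.leftFace d ∈ T ↔ Γ₁.HasDart (M.α d) ∨ Γ₂.HasDart d)
  extends_through : ∀ d, ¬ Γ₁.HasEdge d → ¬ Γ₂.HasEdge d →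
    M.leftFace d ∈ T → M.leftFace (M.α d) ∈ T
  connected : ∀ f ∈ T, ∀ g ∈ T, Relation.ReflTransGen
    (fun f g => ∃ d, Inside Γ₁ Γ₂ T d ∧ M.leftFace d = f ∧ M.leftFace (M.α d) = g) f g

/-- A tambourine: a pair of parallel (homotopic, with their orientations) non-contractible oriented
cycles, delimiting a region `T`, such that the duals of the edges inside `T` are exactly the edges
of a non-contractible cycle of the dual map that is homotopic to both cycles. -/
def IsTambourine (Γ₁ Γ₂ : M.Cycle) : Prop :=
  ¬ Γ₁.curve.Contractible ∧ ¬ Γ₂.curve.Contractible ∧ Γ₁.curve.Homotopic Γ₂.curve ∧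
  ∃ T : Set M.Face, Delimits Γ₁ Γ₂ T ∧
    ∃ Δ : M.dual.Cycle, (∀ d, Δ.HasEdge d ↔ Inside Γ₁ Γ₂ T d) ∧
      ¬ (Cycle.dualCurve Δ).Contractible ∧
      (Cycle.dualCurve Δ).Homotopic Γ₁.curve ∧ (Cycle.dualCurve Δ).Homotopic Γ₂.curve

end CombMap

/-! Curves are measured by voltages: group-valued functions on the letters of words, whose holonomy
is a discrete line integral and, when flat, depends only on the homotopy class. Merging all faces by
deleting edges and gauging a voltage away along a spanning tree leaves, by Euler's formula, two
edges that interleave on a single contour. So the fundamental group of the torus is generated by two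
commuting elements (`IsToroidal.exists_gauge`, `IsToroidal.exists_abelian_voltage`). Hence a cycle
that bounds is contractible, cutting along `Γ` does not disconnect, and some closed dual curve
crosses `Γ` once. The crossing number with `Γ` and the cocycle `F` of that dual curve together
detect null-homotopy (`IsToroidal.mem_nullLoops_iff`), so every homotopy in the conclusion becomes
an equality of two pairs of integers.

The torus is then unrolled to the infinite annulus with darts `D × ℤ`, where the level counts the
crossings with `Γ`. There finite closed chains separate faces, and finite cocycles separate vertices
(`annulus_planar`). Between two consecutive lifts of `Γ` lies a finite strip. It is shrunk from both
sides, absorbing faces that touch only one boundary and filling holes, until every face along one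
boundary touches the other (`Strip.exists_tight`).

In a tight strip, a closed chain made of boundary edges of `U` and of inside edges that avoid the
boundary of `V` has the same value all along the boundary of `U` (`Tight.exists_const`). Therefore
such inside paths from a given dart reach the boundary of `U` at one vertex only, even in the
universal cover. A vertex strictly inside the strip would be cut off by at most two vertices of the
universal cover, and an inside edge with both ends on one boundary would be a loop there. Weak
3-connectedness excludes both (`mixed_or_mixed`, `not_mixed_α_of_mixed`), so all inside edges join
the two boundaries, and by planarity they form a dual cycle (`Thin.exists_dual_cycle`). The strip
occupies a single level and its boundary vertices have distinct images, so the two boundaries and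
the dual cycle project to cycles of the torus and of its dual; they have the same two integers as
`Γ`. -/

namespace CombMap

/-! ### Voltages, holonomy, and its invariance under homotopy. -/

section Holonomy

variable {D : Type*} (M : CombMap D) {G : Type*} [AddGroup G]

/-- The lift of a permutation of `D` to `D × G` with translation part `v`. -/
def stepPerm (π : Equiv.Perm D) (v : D → G) : Equiv.Perm (D × G) where
  toFun x := (π x.1, v x.1 + x.2)
  invFun x := (π.symm x.1, -v (π.symm x.1) + x.2)
  left_inv x := by simp
  right_inv x := by simp

@[simp] theorem stepPerm_apply (π : Equiv.Perm D) (v : D → G) (x : D × G) :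
    stepPerm π v x = (π x.1, v x.1 + x.2) := rfl

theorem stepPerm_inv_apply (π : Equiv.Perm D) (v : D → G) (x : D × G) :
    (stepPerm π v)⁻¹ x = (π⁻¹ x.1, -v (π⁻¹ x.1) + x.2) := rfl

/-- The action of words on `D × G` given by a voltage `v`. -/
def liftAct (v : Bool → D → G) : Word →* Equiv.Perm (D × G) :=
  FreeGroup.lift fun b => stepPerm (if b then M.σ else M.α) (v b)

/-- The holonomy of a voltage along a word issued from a dart. -/
def hol (v : Bool → D → G) (w : Word) (d : D) : G := (M.liftAct v w (d, 0)).2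

theorem liftAct_apply (v : Bool → D → G) (w : Word) :
    ∀ d g, M.liftAct v w (d, g) = (M.act w d, M.hol v w d + g) := by
  induction w using FreeGroup.induction_on with
  | C1 => intro d g; simp [hol]
  | of b => intro d g; simp [hol, liftAct, act]
  | inv_of b ih =>
    have key : ∀ d g, M.liftAct v (FreeGroup.of b)⁻¹ (d, g) =
        (M.act (FreeGroup.of b)⁻¹ d,
          -M.hol v (FreeGroup.of b) (M.act (FreeGroup.of b)⁻¹ d) + g) := by
      intro d g
      rw [map_inv, Equiv.Perm.inv_eq_iff_eq, ih, ← Equiv.Perm.mul_apply, ← map_mul]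
      simp
    intro d g
    have h : M.hol v (FreeGroup.of b)⁻¹ d =
        -M.hol v (FreeGroup.of b) (M.act (FreeGroup.of b)⁻¹ d) := by
      rw [hol, key, add_zero]
    rw [key, h]
  | mul x y hx hy =>
    intro d g
    have h : M.hol v (x * y) d = M.hol v x (M.act y d) + M.hol v y d := by
      rw [hol, map_mul, Equiv.Perm.mul_apply, hy, hx, add_zero]
    rw [map_mul, Equiv.Perm.mul_apply, hy, hx, h, map_mul, Equiv.Perm.mul_apply, add_assoc]

variable (v : Bool → D → G)

@[simp] theorem hol_one (d : D) : M.hol v 1 d = 0 := by simp [hol]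

theorem hol_mul (x y : Word) (d : D) :
    M.hol v (x * y) d = M.hol v x (M.act y d) + M.hol v y d := by
  rw [hol, map_mul, Equiv.Perm.mul_apply, liftAct_apply, liftAct_apply]
  simp

theorem hol_inv (x : Word) (d : D) : M.hol v x⁻¹ d = -M.hol v x (M.act x⁻¹ d) := by
  have h := M.hol_mul v x x⁻¹ d
  rw [mul_inv_cancel, hol_one] at h
  exact (neg_eq_of_add_eq_zero_right h.symm).symm

@[simp] theorem hol_rot (d : D) : M.hol v rot d = v true d := by
  simp [hol, liftAct, rot]

@[simp] theorem hol_flip (d : D) : M.hol v flip d = v false d := by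
  simp [hol, liftAct, flip]

theorem act_inv_apply_self (x : Word) (d : D) : M.act x⁻¹ (M.act x d) = d := by
  rw [← Equiv.Perm.mul_apply, ← map_mul]; simp

theorem act_apply_inv_self (x : Word) (d : D) : M.act x (M.act x⁻¹ d) = d := by
  rw [← Equiv.Perm.mul_apply, ← map_mul]; simp

theorem σ_φ (d : D) : M.σ (M.φ d) = M.α d := by simp [φ]

theorem φ_eq (d : D) : M.φ d = M.σ⁻¹ (M.α d) := rfl

theorem φ_α_σ (d : D) : M.φ (M.α (M.σ d)) = d := by simp [φ, M.α_invol]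

theorem hol_faceRot (d : D) : M.hol v faceRot d = -v true (M.φ d) + v false d := by
  rw [faceRot, hol_mul, hol_inv, hol_flip, hol_rot, act_flip, map_inv, act_rot]
  rfl

/-- A potential that accounts for the holonomy of `R` accounts for the holonomy of its powers. -/
theorem potential_zpow {R : Word} {s : D → G}
    (h : ∀ d, s (M.act R d) = M.hol v R d + s d) (k : ℤ) (d : D) :
    s (M.act (R ^ k) d) = M.hol v (R ^ k) d + s d := by
  let H : Subgroup Word :=
    { carrier := {w | ∀ d, s (M.act w d) = M.hol v w d + s d}
      one_mem' := by intro d; simp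
      mul_mem' := by
        intro a b ha hb d
        rw [map_mul, Equiv.Perm.mul_apply, ha, hb, hol_mul, add_assoc]
      inv_mem' := by
        intro a ha d
        have := ha (M.act a⁻¹ d)
        rw [act_apply_inv_self] at this
        rw [hol_inv, this, neg_add_cancel_left] }
  exact (H.zpow_mem (x := R) h k) d

/-- A voltage is flat if it has no holonomy around vertices, edges and faces. -/
structure Flat (v : Bool → D → G) : Prop where
  rot : ∃ s : D → G, ∀ d, s (M.σ d) = v true d + s d
  flip : ∀ d, v false (M.α d) + v false d = 0
  face : ∃ t : D → G, ∀ d, t (M.φ d) = -v true (M.φ d) + v false d + t d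

variable {M v}

theorem hol_zpow_eq_zero_of_potential {R : Word} {s : D → G}
    (h : ∀ d, s (M.act R d) = M.hol v R d + s d) {k : ℤ} {d : D} (hk : M.act (R ^ k) d = d) :
    M.hol v (R ^ k) d = 0 := by
  have := M.potential_zpow v h k d
  rw [hk] at this
  exact right_eq_add.1 this

theorem act_flip_sq (d : D) : M.act (CombMap.flip ^ (2 : ℤ)) d = d := by
  rw [map_zpow, act_flip, zpow_two, Equiv.Perm.mul_apply, M.α_invol]

/-- For `rot` and `faceRot` the potential given by flatness returns to its value. For `flip`, only
even powers fix a dart, because `α` has no fixed point, and `flip ^ 2` has zero holonomy. -/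
theorem Flat.hol_local (hv : M.Flat v) {r : Word}
    (hr : r ∈ Subgroup.zpowers CombMap.rot ∨ r ∈ Subgroup.zpowers CombMap.flip ∨
      r ∈ Subgroup.zpowers faceRot) {d : D} (h : M.act r d = d) : M.hol v r d = 0 := by
  rcases hr with ⟨k, rfl⟩ | ⟨k, rfl⟩ | ⟨k, rfl⟩
  · obtain ⟨s, hs⟩ := hv.rot
    exact hol_zpow_eq_zero_of_potential (s := s) (fun d => by rw [act_rot, hol_rot, hs]) h
  · have h2 : ∀ d, M.hol v (CombMap.flip ^ (2 : ℤ)) d = 0 := by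
      intro d
      rw [zpow_two, hol_mul, act_flip, hol_flip, hol_flip, hv.flip]
    have h3 : ∀ (m : ℤ) d, M.act ((CombMap.flip ^ (2 : ℤ)) ^ m) d = d := by
      intro m d
      have : M.act (CombMap.flip ^ (2 : ℤ)) = 1 := by
        ext d
        rw [act_flip_sq, Equiv.Perm.one_apply]
      rw [map_zpow, this]
      simp
    have h4 : ∀ (m : ℤ) d, M.hol v ((CombMap.flip ^ (2 : ℤ)) ^ m) d = 0 := fun m d =>
      hol_zpow_eq_zero_of_potential (s := fun _ => 0) (fun d => by rw [h2, add_zero]) (h3 m d)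
    obtain ⟨m, rfl | rfl⟩ := Int.even_or_odd' k
    · simp only [zpow_mul]
      exact h4 m d
    · exfalso
      simp only [zpow_add, zpow_mul, zpow_one] at h
      rw [map_mul, Equiv.Perm.mul_apply, h3, act_flip] at h
      exact M.α_ne d h
  · obtain ⟨s, hs⟩ := hv.face
    exact hol_zpow_eq_zero_of_potential (s := s)
      (fun d => by rw [act_faceRot, hol_faceRot, hs]) h

/-- On loops at `d` holonomy is additive, and the conjugating word `w` of a generator contributes
twice with opposite signs. Flat voltages are thus homotopy invariants. -/
theorem Flat.hol_eq_zero (hv : M.Flat v) {d : D} {x : Word} (hx : x ∈ M.nullLoops d) :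
    M.hol v x d = 0 := by
  have hact : ∀ y, y ∈ M.nullLoops d → M.act y d = d := fun y => M.act_of_mem_nullLoops
  induction hx using Subgroup.closure_induction with
  | mem x hx =>
    obtain ⟨w, r, hr, h, rfl⟩ := hx
    rw [hol_mul, hol_mul, hol_inv, h, act_inv_apply_self, hv.hol_local hr h]
    simp
  | one => simp
  | mul x y hx hy ihx ihy => rw [hol_mul, hact y hy, ihx, ihy, add_zero]
  | inv x hx ih => rw [hol_inv, hact _ (inv_mem hx), ih, neg_zero]

/-- Change of base dart along `p`: the generators at the two darts correspond, with `w` replaced by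
`w * p`. -/
theorem conj_mem_nullLoops_iff (x p : Word) (d : D) :
    p⁻¹ * x * p ∈ M.nullLoops d ↔ x ∈ M.nullLoops (M.act p d) := by
  have key : ∀ (x p : Word) (d : D), x ∈ M.nullLoops (M.act p d) →
      p⁻¹ * x * p ∈ M.nullLoops d := by
    intro x p d hx
    induction hx using Subgroup.closure_induction with
    | mem x hx =>
      obtain ⟨w, r, hr, h, rfl⟩ := hx
      refine Subgroup.subset_closure ⟨w * p, r, hr, ?_, by group⟩
      rw [map_mul, Equiv.Perm.mul_apply, h]
    | one => simp [one_mem]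
    | mul x y _ _ ihx ihy =>
      have := mul_mem ihx ihy
      convert this using 1
      group
    | inv x _ ih =>
      have := inv_mem ih
      convert this using 1
      group
  refine ⟨fun h => ?_, key x p d⟩
  have := key (p⁻¹ * x * p) p⁻¹ (M.act p d) (by rwa [act_inv_apply_self])
  convert this using 1
  group

theorem local_mem_nullLoops {r : Word}
    (hr : r ∈ Subgroup.zpowers CombMap.rot ∨ r ∈ Subgroup.zpowers CombMap.flip ∨
      r ∈ Subgroup.zpowers faceRot) {d : D} (h : M.act r d = d) : r ∈ M.nullLoops d :=
  Subgroup.subset_closure ⟨1, r, hr, by simpa using h, by group⟩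

/-- A lift of a permutation that closes up over the cycles of the permutation has a potential. -/
theorem exists_potential_of_closed {π : Equiv.Perm D} {ρ : D → G}
    (h : ∀ (k : ℤ) d, (π ^ k) d = d → (stepPerm π ρ ^ k) (d, 0) = (d, 0)) :
    ∃ s : D → G, ∀ d, s (π d) = ρ d + s d := by
  have tr : ∀ (k : ℤ) d g, (stepPerm π ρ ^ k) (d, g) =
      ((π ^ k) d, ((stepPerm π ρ ^ k) (d, 0)).2 + g) := by
    intro k
    induction k with
    | zero => intro d g; simp
    | succ n ih =>
      intro d g
      rw [add_comm, zpow_add, zpow_add, Equiv.Perm.mul_apply, Equiv.Perm.mul_apply, ih d g,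
        Equiv.Perm.mul_apply]
      have := congrArg Prod.fst (ih d 0)
      simp only at this
      simp only [zpow_one, stepPerm_apply, add_assoc, this]
    | pred n ih =>
      intro d g
      have e : (-(n : ℤ) - 1) = -1 + -(n : ℤ) := by ring
      rw [e, zpow_add, zpow_add, Equiv.Perm.mul_apply, Equiv.Perm.mul_apply, ih d g,
        Equiv.Perm.mul_apply]
      have := congrArg Prod.fst (ih d 0)
      simp only at this
      simp only [zpow_neg_one, stepPerm_inv_apply, add_assoc, this]
  classical
  -- A base point on each cycle of `π`. The potential at `d` is the translation accumulated from
  -- there, and the hypothesis makes it independent of the exponent used.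
  let q : D → D := fun d => (Quotient.mk (Equiv.Perm.SameCycle.setoid π) d).out
  have hq : ∀ d, π.SameCycle (q d) d := fun d =>
    Quotient.exact (s := Equiv.Perm.SameCycle.setoid π)
      (Quotient.out_eq (Quotient.mk (Equiv.Perm.SameCycle.setoid π) d))
  have hqπ : ∀ d, q (π d) = q d := by
    intro d
    have : (Quotient.mk (Equiv.Perm.SameCycle.setoid π) (π d)) =
        Quotient.mk (Equiv.Perm.SameCycle.setoid π) d :=
      Quotient.sound (s := Equiv.Perm.SameCycle.setoid π)
        (Equiv.Perm.sameCycle_apply_left.2 (Equiv.Perm.SameCycle.refl π d))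
    simp only [q, this]
  choose k hk using hq
  refine ⟨fun d => ((stepPerm π ρ ^ k d) (q d, 0)).2, fun d => ?_⟩
  have hc : (π ^ (-k (π d) + (1 + k d))) (q d) = q d := by
    rw [zpow_add, zpow_add, Equiv.Perm.mul_apply, Equiv.Perm.mul_apply, hk, zpow_neg,
      Equiv.Perm.inv_eq_iff_eq, zpow_one, ← hqπ d, hk]
  have h1 := h _ _ hc
  rw [zpow_add, zpow_add, Equiv.Perm.mul_apply, Equiv.Perm.mul_apply, zpow_neg,
    Equiv.Perm.inv_eq_iff_eq, tr (k d), hk, zpow_one, stepPerm_apply] at h1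
  have h2 := congrArg Prod.snd h1
  simp only [] at h2
  simp only [hqπ]
  rw [← h2, add_zero]

end Holonomy

end CombMap

namespace CombMap

/-! ### Counting the cycles of a permutation. -/

section Perm

variable {D : Type*}

/-- The number of cycles of a permutation, fixed points included. -/
noncomputable def numCycles (ψ : Equiv.Perm D) : ℕ :=
  Nat.card (Quotient (Equiv.Perm.SameCycle.setoid ψ))

theorem numCycles_eq_one [Nonempty D] {ψ : Equiv.Perm D} (h : ∀ c c', ψ.SameCycle c c') :
    numCycles ψ = 1 := by
  rw [numCycles, Nat.card_eq_one_iff_unique]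
  constructor
  · constructor
    intro p q
    induction p using Quotient.inductionOn with | h c =>
    induction q using Quotient.inductionOn with | h c' =>
    exact Quotient.sound (s := Equiv.Perm.SameCycle.setoid ψ) (h c c')
  · exact ⟨Quotient.mk _ (Classical.arbitrary D)⟩

theorem numCycles_inv (ψ : Equiv.Perm D) : numCycles ψ⁻¹ = numCycles ψ := by
  have : Equiv.Perm.SameCycle.setoid ψ⁻¹ = Equiv.Perm.SameCycle.setoid ψ := by
    ext a b
    exact Equiv.Perm.sameCycle_inv
  rw [numCycles, numCycles, this]

variable [Finite D]

theorem mem_of_sameCycle {ψ : Equiv.Perm D} {P : D → Prop}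
    (h : ∀ c, P c → P (ψ c)) {c c' : D} (hc : ψ.SameCycle c c') (hP : P c) : P c' := by
  obtain ⟨k, -, rfl⟩ := hc.exists_pow_eq'
  clear hc
  induction k with
  | zero => simpa
  | succ k ih =>
    rw [pow_succ', Equiv.Perm.mul_apply]
    exact h _ ih

/-- The product sends `y` to `ψ x`, then follows the old cycle of `x` back to `x`, which never meets
`y`. -/
theorem sameCycle_mul_swap_left [DecidableEq D] {ψ : Equiv.Perm D} {x y : D}
    (h : ¬ ψ.SameCycle x y) : (ψ * Equiv.swap x y).SameCycle x y := by
  set ψ' := ψ * Equiv.swap x y with hψ'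
  have hy : ψ' y = ψ x := by simp [hψ']
  have key : ∀ k : ℕ, ψ'.SameCycle (ψ x) ((ψ ^ (k + 1)) x) := by
    intro k
    induction k with
    | zero => exact .refl _ _
    | succ k ih =>
      rw [pow_succ', Equiv.Perm.mul_apply]
      have hcy : (ψ ^ (k + 1)) x ≠ y := fun e => h ⟨(k + 1 : ℕ), by rw [zpow_natCast, e]⟩
      by_cases hcx : (ψ ^ (k + 1)) x = x
      · rw [hcx]
      · have : ψ' ((ψ ^ (k + 1)) x) = ψ ((ψ ^ (k + 1)) x) := by
          rw [hψ', Equiv.Perm.mul_apply, Equiv.swap_apply_of_ne_of_ne hcx hcy]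
        rw [← this]
        exact Equiv.Perm.sameCycle_apply_right.2 ih
  obtain ⟨k, hk0, -, hk⟩ := (Equiv.Perm.SameCycle.refl ψ x).exists_pow_eq''
  obtain ⟨m, rfl⟩ : ∃ m, k = m + 1 := ⟨k - 1, by omega⟩
  have h1 := key m
  rw [hk, ← hy] at h1
  exact (Equiv.Perm.sameCycle_apply_left.1 h1).symm

theorem SameCycle.mul_swap [DecidableEq D] {ψ : Equiv.Perm D} {x y : D}
    (h : ¬ ψ.SameCycle x y) {c c' : D} (hc : ψ.SameCycle c c') :
    (ψ * Equiv.swap x y).SameCycle c c' := by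
  have hxy := sameCycle_mul_swap_left h
  refine mem_of_sameCycle (P := fun z => (ψ * Equiv.swap x y).SameCycle c z) ?_ hc
    (Equiv.Perm.SameCycle.refl _ _)
  intro z hz
  refine hz.trans ?_
  by_cases hzx : z = x
  · have : (ψ * Equiv.swap x y) y = ψ z := by simp [hzx]
    rw [← this, Equiv.Perm.sameCycle_apply_right, hzx]
    exact hxy
  · by_cases hzy : z = y
    · have : (ψ * Equiv.swap x y) x = ψ z := by simp [hzy]
      rw [← this, Equiv.Perm.sameCycle_apply_right, hzy]
      exact hxy.symm
    · have : (ψ * Equiv.swap x y) z = ψ z := by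
        rw [Equiv.Perm.mul_apply, Equiv.swap_apply_of_ne_of_ne hzx hzy]
      rw [← this, Equiv.Perm.sameCycle_apply_right]

theorem sameCycle_mul_swap_cases [DecidableEq D] {ψ : Equiv.Perm D} {x y : D}
    {c c' : D} (hc : (ψ * Equiv.swap x y).SameCycle c c') :
    ψ.SameCycle c c' ∨
      ((ψ.SameCycle x c ∨ ψ.SameCycle y c) ∧ (ψ.SameCycle x c' ∨ ψ.SameCycle y c')) := by
  refine mem_of_sameCycle (P := fun z => ψ.SameCycle c z ∨
      ((ψ.SameCycle x c ∨ ψ.SameCycle y c) ∧ (ψ.SameCycle x z ∨ ψ.SameCycle y z))) ?_ hc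
    (Or.inl (Equiv.Perm.SameCycle.refl _ _))
  intro z hz
  by_cases hzx : z = x
  · have : (ψ * Equiv.swap x y) z = ψ y := by simp [hzx]
    rw [this]
    subst hzx
    refine Or.inr ⟨?_, Or.inr (Equiv.Perm.sameCycle_apply_right.2 (.refl _ _))⟩
    rcases hz with hz | hz
    · exact Or.inl hz.symm
    · exact hz.1
  · by_cases hzy : z = y
    · have : (ψ * Equiv.swap x y) z = ψ x := by simp [hzy]
      rw [this]
      subst hzy
      refine Or.inr ⟨?_, Or.inl (Equiv.Perm.sameCycle_apply_right.2 (.refl _ _))⟩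
      rcases hz with hz | hz
      · exact Or.inr hz.symm
      · exact hz.1
    · have : (ψ * Equiv.swap x y) z = ψ z := by
        rw [Equiv.Perm.mul_apply, Equiv.swap_apply_of_ne_of_ne hzx hzy]
      rw [this]
      simpa only [Equiv.Perm.sameCycle_apply_right] using hz

/-- Multiplication by a transposition of two points of different cycles merges these cycles. -/
theorem numCycles_mul_swap [DecidableEq D] {ψ : Equiv.Perm D} {x y : D}
    (h : ¬ ψ.SameCycle x y) : numCycles (ψ * Equiv.swap x y) + 1 = numCycles ψ := by
  classical
  have : Fintype D := Fintype.ofFinite D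
  let ψ' := ψ * Equiv.swap x y
  let Q := Quotient (Equiv.Perm.SameCycle.setoid ψ)
  let Q' := Quotient (Equiv.Perm.SameCycle.setoid ψ')
  let qy : Q := Quotient.mk _ y
  let F : Q → Q' := Quotient.map' (s₁ := Equiv.Perm.SameCycle.setoid ψ)
    (s₂ := Equiv.Perm.SameCycle.setoid ψ') id (fun c c' hc => SameCycle.mul_swap h hc)
  -- The classes of `x` and `y` are the only ones that get identified, so the natural map becomes
  -- bijective once the class of `y` is dropped.
  have hF : Function.Bijective (fun q : {q : Q // q ≠ qy} => F q.1) := by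
    constructor
    · rintro ⟨p, hp⟩ ⟨q, hq⟩ hpq
      induction p using Quotient.inductionOn with | h c =>
      induction q using Quotient.inductionOn with | h c' =>
      have h1 : ψ'.SameCycle c c' :=
        Quotient.exact (s := Equiv.Perm.SameCycle.setoid ψ') hpq
      have hc : ¬ ψ.SameCycle y c := fun e =>
        hp (Quotient.sound (s := Equiv.Perm.SameCycle.setoid ψ) e.symm)
      have hc' : ¬ ψ.SameCycle y c' := fun e =>
        hq (Quotient.sound (s := Equiv.Perm.SameCycle.setoid ψ) e.symm)
      refine Subtype.ext (Quotient.sound (s := Equiv.Perm.SameCycle.setoid ψ) ?_)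
      rcases sameCycle_mul_swap_cases h1 with h2 | ⟨h2 | h2, h3 | h3⟩
      · exact h2
      · exact h2.symm.trans h3
      · exact absurd h3 hc'
      · exact absurd h2 hc
      · exact absurd h2 hc
    · intro q
      induction q using Quotient.inductionOn with | h c =>
      by_cases hc : ψ.SameCycle y c
      · refine ⟨⟨Quotient.mk _ x, fun e => h (Quotient.exact
          (s := Equiv.Perm.SameCycle.setoid ψ) e)⟩, ?_⟩
        exact Quotient.sound (s := Equiv.Perm.SameCycle.setoid ψ')
          ((sameCycle_mul_swap_left h).trans (SameCycle.mul_swap h hc))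
      · exact ⟨⟨Quotient.mk _ c, fun e => hc (Quotient.exact
          (s := Equiv.Perm.SameCycle.setoid ψ) e).symm⟩, rfl⟩
  have h1 : Nat.card {q : Q // q ≠ qy} = Nat.card Q' := Nat.card_eq_of_bijective _ hF
  have h2 : Nat.card {q : Q // q ≠ qy} + 1 = Nat.card Q := by
    have : Fintype Q := Fintype.ofFinite Q
    rw [Nat.card_eq_fintype_card, Nat.card_eq_fintype_card, Fintype.card_subtype_compl]
    have : 0 < Fintype.card Q := Fintype.card_pos_iff.2 ⟨qy⟩
    simp
    omega
  change Nat.card Q' + 1 = Nat.card Q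
  omega

theorem two_mul_numCycles_of_involutive {ψ : Equiv.Perm D} (h : ∀ d, ψ (ψ d) = d)
    (h' : ∀ d, ψ d ≠ d) : 2 * numCycles ψ = Nat.card D := by
  classical
  have : Fintype D := Fintype.ofFinite D
  have : Fintype (Quotient (Equiv.Perm.SameCycle.setoid ψ)) := Fintype.ofFinite _
  rw [numCycles, Nat.card_eq_fintype_card, Nat.card_eq_fintype_card, ← Finset.card_univ (α := D),
    Finset.card_eq_sum_card_fiberwise (f := Quotient.mk (Equiv.Perm.SameCycle.setoid ψ))
      (t := Finset.univ) (fun _ _ => Finset.mem_coe.2 (Finset.mem_univ _))]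
  rw [Finset.sum_congr rfl (g := fun _ => 2)]
  · simp [mul_comm]
  · intro q _
    induction q using Quotient.inductionOn with | h c =>
    have : (Finset.univ.filter fun a => Quotient.mk (Equiv.Perm.SameCycle.setoid ψ) a =
        Quotient.mk (Equiv.Perm.SameCycle.setoid ψ) c) = {c, ψ c} := by
      ext a
      simp only [Finset.mem_filter, Finset.mem_univ, true_and, Finset.mem_insert,
        Finset.mem_singleton]
      constructor
      · intro e
        have e1 : ψ.SameCycle c a :=
          (Quotient.exact (s := Equiv.Perm.SameCycle.setoid ψ) e).symm
        refine mem_of_sameCycle (P := fun z => z = c ∨ z = ψ c) ?_ e1 (Or.inl rfl)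
        rintro z (rfl | rfl)
        · exact Or.inr rfl
        · exact Or.inl (h _)
      · rintro (rfl | rfl)
        · rfl
        · exact Quotient.sound (s := Equiv.Perm.SameCycle.setoid ψ)
            (Equiv.Perm.sameCycle_apply_left.2 (.refl _ _))
    rw [this, Finset.card_pair (h' c).symm]

end Perm

end CombMap

namespace CombMap

/-! ### Reduction to one face, and spanning trees. -/

section Abelian

variable {D : Type*} (M : CombMap D)

/-- `β` is the restriction of the edge involution to a set of edges. -/
def IsEdgeSet (β : Equiv.Perm D) : Prop := ∀ d, β d = M.α d ∨ β d = d

/-- The contours of the faces of the ribbon graph that is made of the vertices of `M` and the edges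
of `β`. -/
def contour (β : Equiv.Perm D) : Equiv.Perm D := M.σ⁻¹ * β

variable {M}

namespace IsEdgeSet

variable {β : Equiv.Perm D} (hβ : M.IsEdgeSet β)
include hβ

theorem apply_α_of_eq {d : D} (h : β d = M.α d) : β (M.α d) = d := by
  rcases hβ (M.α d) with h1 | h1
  · rw [h1, M.α_invol]
  · rw [← h] at h1
    exact absurd (h ▸ β.injective h1) (M.α_ne d)

theorem apply_α_of_fixed {d : D} (h : β d = d) : β (M.α d) = M.α d := by
  rcases hβ (M.α d) with h1 | h1
  · rw [M.α_invol] at h1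
    exact absurd (β.injective (h1.trans h.symm)) (M.α_ne d)
  · exact h1

theorem apply_apply (d : D) : β (β d) = d := by
  rcases hβ d with h | h
  · rw [h, hβ.apply_α_of_eq h]
  · rw [h, h]

variable [DecidableEq D]

theorem delete {d : D} (h : β d = M.α d) : M.IsEdgeSet (β * Equiv.swap d (M.α d)) := by
  intro c
  by_cases h1 : c = d
  · right; simp [h1, hβ.apply_α_of_eq h]
  · by_cases h2 : c = M.α d
    · right; simp [h2, h]
    · rw [Equiv.Perm.mul_apply, Equiv.swap_apply_of_ne_of_ne h1 h2]
      exact hβ c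

theorem add {d : D} (h : β d = d) : M.IsEdgeSet (β * Equiv.swap d (M.α d)) := by
  intro c
  by_cases h1 : c = d
  · left; simp [h1, hβ.apply_α_of_fixed h]
  · by_cases h2 : c = M.α d
    · left; simp [h2, h, M.α_invol]
    · rw [Equiv.Perm.mul_apply, Equiv.swap_apply_of_ne_of_ne h1 h2]
      exact hβ c

variable [Fintype D]

theorem support_delete {d : D} (h : β d = M.α d) :
    (β * Equiv.swap d (M.α d)).support.card + 2 = β.support.card := by
  have h0 := M.α_ne d
  have h1 := hβ.apply_α_of_eq h
  have : β.support = insert d (insert (M.α d) (β * Equiv.swap d (M.α d)).support) := by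
    ext c
    simp only [Finset.mem_insert, Equiv.Perm.mem_support]
    by_cases hc : c = d
    · simp [hc, h, h0]
    · by_cases hc' : c = M.α d
      · simp [hc', h1, h0.symm]
      · rw [Equiv.Perm.mul_apply, Equiv.swap_apply_of_ne_of_ne hc hc']
        simp [hc, hc']
  rw [this, Finset.card_insert_of_notMem, Finset.card_insert_of_notMem]
  · simp [Equiv.Perm.mem_support, h]
  · simp [Equiv.Perm.mem_support, h1, h0.symm]

theorem support_add {d : D} (h : β d = d) :
    (β * Equiv.swap d (M.α d)).support.card = β.support.card + 2 := by
  have h1 := (hβ.add h).support_delete (d := d) (by simp [hβ.apply_α_of_fixed h])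
  rw [mul_assoc, Equiv.swap_mul_self, mul_one] at h1
  exact h1.symm

end IsEdgeSet

/-- Removing or adding an edge multiplies the contour permutation by a transposition, so
`numCycles_mul_swap` governs the number of contours. -/
theorem contour_mul (β τ : Equiv.Perm D) : M.contour (β * τ) = M.contour β * τ :=
  (mul_assoc _ _ _).symm

/-- A contour is closed under `β` by hypothesis, and then under `σ`, because `contour β` sends `β (σ
d)` to `d`. -/
theorem sameCycle_contour_all {β : Equiv.Perm D} (hβ : M.IsEdgeSet β)
    (htr : ∀ P : Set D, (∀ d ∈ P, M.σ d ∈ P) → (∀ d ∈ P, β d ∈ P) → ∀ x ∈ P, ∀ y, y ∈ P)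
    (h : ∀ d, β d = M.α d → (M.contour β).SameCycle d (M.α d)) (x y : D) :
    (M.contour β).SameCycle x y := by
  have h1 : ∀ d, (M.contour β).SameCycle d (β d) := by
    intro d
    rcases hβ d with h2 | h2
    · rw [h2]; exact h d h2
    · rw [h2]
  refine htr {z | (M.contour β).SameCycle x z} ?_ (fun d hd => hd.trans (h1 d)) x (.refl _ _) y
  intro d hd
  refine hd.trans ?_
  have : M.contour β (β (M.σ d)) = d := by
    rw [contour, Equiv.Perm.mul_apply, hβ.apply_apply]
    simp
  have h3 : (M.contour β).SameCycle (β (M.σ d)) d := ⟨1, by rw [zpow_one, this]⟩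
  exact h3.symm.trans (h1 _).symm

variable (M) in
/-- Every flat voltage has a potential along the contours of `β`, and is generated by its values on
the edges of `β`. -/
def Carries [DecidableEq D] (G : Type*) [AddGroup G] (β : Equiv.Perm D) : Prop :=
  ∀ f : D → G, (∀ d, f (M.α d) = -f d) → (∃ t : D → G, ∀ d, t (M.φ d) = f d + t d) →
    (∃ s : D → G, ∀ c, s (M.contour β c) = (if β c = c then 0 else f c) + s c) ∧
      ∀ d, f d ∈ AddSubgroup.closure (f '' {c | β c ≠ c})

variable [Fintype D] [DecidableEq D]

/-- The sides of `d` lie on different contours, so the potential can be shifted on one of them to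
fit the other. The merged contour leads from `d` to `α d` along remaining edges, while the potential
changes by `-f (α d)`. Hence the value on the deleted edge is generated by the others. -/
theorem Carries.delete {G : Type*} [AddGroup G] {β : Equiv.Perm D} (hβ : M.IsEdgeSet β)
    (hc : M.Carries G β) {d : D} (hd : β d = M.α d)
    (h : ¬ (M.contour β).SameCycle d (M.α d)) : M.Carries G (β * Equiv.swap d (M.α d)) := by
  intro f hf ht
  obtain ⟨⟨s, hs⟩, hgen⟩ := hc f hf ht
  set ψ := M.contour β with hψ
  set β' := β * Equiv.swap d (M.α d) with hβ'
  have h0 := M.α_ne d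
  have hd1 := hβ.apply_α_of_eq hd
  have e1 : β' d = d := by simp [hβ', hd1]
  have e2 : β' (M.α d) = M.α d := by simp [hβ', hd]
  have e3 : ∀ c, c ≠ d → c ≠ M.α d → β' c = β c := fun c h1 h2 => by
    rw [hβ', Equiv.Perm.mul_apply, Equiv.swap_apply_of_ne_of_ne h1 h2]
  have p1 : M.contour β' d = ψ (M.α d) := by simp [hβ', contour_mul, hψ]
  have p2 : M.contour β' (M.α d) = ψ d := by simp [hβ', contour_mul, hψ]
  have p3 : ∀ c, c ≠ d → c ≠ M.α d → M.contour β' c = ψ c := fun c h1 h2 => by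
    rw [hβ', contour_mul, Equiv.Perm.mul_apply, Equiv.swap_apply_of_ne_of_ne h1 h2]
  classical
  -- The shift for which `s' (M.α d) = f d + s' d`.
  let k : G := -s d + f (M.α d) + s (M.α d)
  let s' : D → G := fun c => if ψ.SameCycle d c then s c + k else s c
  have hs' : ∀ c, s' (M.contour β' c) = (if β' c = c then 0 else f c) + s' c := by
    intro c
    by_cases c1 : c = d
    · subst c1
      have : ¬ ψ.SameCycle c (ψ (M.α c)) := by
        rwa [Equiv.Perm.sameCycle_apply_right]
      simp only [s', p1, e1, this, if_false, if_true, Equiv.Perm.SameCycle.refl, hs, hd1]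
      rw [if_neg h0.symm]
      simp [k, add_assoc]
    · by_cases c2 : c = M.α d
      · subst c2
        have : ψ.SameCycle d (ψ d) := by rw [Equiv.Perm.sameCycle_apply_right]
        simp only [s', p2, e2, this, h, if_false, if_true, hs, hd]
        rw [if_neg h0]
        simp [k, hf, add_assoc]
      · simp only [s', p3 c c1 c2, e3 c c1 c2, Equiv.Perm.sameCycle_apply_right, hs]
        split_ifs <;> simp [add_assoc]
  refine ⟨⟨s', hs'⟩, ?_⟩
  let K := AddSubgroup.closure (f '' {c | β' c ≠ c})
  have hK : f (M.α d) ∈ K := by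
    have h1 : (M.contour β').SameCycle d (M.α d) := by
      rw [hβ', contour_mul]
      exact sameCycle_mul_swap_left h
    have h2 : s' (M.α d) - s' d ∈ K := by
      refine mem_of_sameCycle (P := fun z => s' z - s' d ∈ K) ?_ h1 (by simp [K.zero_mem])
      intro c hc
      rw [hs', add_sub_assoc]
      refine K.add_mem ?_ hc
      split_ifs with hcc
      · exact K.zero_mem
      · exact AddSubgroup.subset_closure ⟨c, hcc, rfl⟩
    have h3 : s' (M.α d) - s' d = -f (M.α d) := by
      simp only [s', h, if_false, Equiv.Perm.SameCycle.refl, if_true, k]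
      simp [sub_eq_add_neg, add_assoc]
    rw [h3] at h2
    simpa using K.neg_mem h2
  intro c
  refine (AddSubgroup.closure_le K).2 ?_ (hgen c)
  rintro _ ⟨z, hz, rfl⟩
  by_cases c1 : z = d
  · have := K.neg_mem hK
    rw [hf, neg_neg] at this
    rwa [c1]
  · by_cases c2 : z = M.α d
    · rwa [c2]
    · exact AddSubgroup.subset_closure ⟨z, by rw [Set.mem_ofPred_eq, e3 z c1 c2]; exact hz, rfl⟩

/-- A connected map has a spanning unicellular submap that carries all flat voltages. -/
theorem exists_unicellular (G : Type*) [AddGroup G] (n : ℕ) : ∀ β : Equiv.Perm D,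
    β.support.card ≤ n → M.IsEdgeSet β →
    (∀ P : Set D, (∀ d ∈ P, M.σ d ∈ P) → (∀ d ∈ P, β d ∈ P) → ∀ x ∈ P, ∀ y, y ∈ P) →
    M.Carries G β →
    ∃ β' : Equiv.Perm D, M.IsEdgeSet β' ∧ (∀ x y, (M.contour β').SameCycle x y) ∧
      M.Carries G β' ∧
      (β'.support.card : ℤ) - 2 * numCycles (M.contour β') =
        β.support.card - 2 * numCycles (M.contour β) := by
  induction n with
  | zero =>
    intro β hn hβ htr hc
    refine ⟨β, hβ, sameCycle_contour_all hβ htr fun d hd => ?_, hc, rfl⟩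
    have : d ∈ β.support := by rw [Equiv.Perm.mem_support, hd]; exact M.α_ne d
    rw [Finset.card_eq_zero.1 (Nat.le_zero.1 hn)] at this
    simp at this
  | succ n ih =>
    intro β hn hβ htr hc
    -- If no edge separates two contours, there is only one contour. Otherwise deleting such an edge
    -- removes two darts and one contour, which preserves the quantity in the last clause.
    by_cases h : ∀ d, β d = M.α d → (M.contour β).SameCycle d (M.α d)
    · exact ⟨β, hβ, sameCycle_contour_all hβ htr h, hc, rfl⟩
    · push Not at h
      obtain ⟨d, hd, h⟩ := h
      have h1 := hβ.support_delete hd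
      have h2 := numCycles_mul_swap h
      -- Connectedness survives the deletion, because the merged contour still leads from `d` to `α
      -- d`.
      have hmerge : (M.contour (β * Equiv.swap d (M.α d))).SameCycle d (M.α d) := by
        rw [contour_mul]
        exact sameCycle_mul_swap_left h
      rw [← contour_mul] at h2
      obtain ⟨β', g1, g2, g3, g4⟩ := ih (β * Equiv.swap d (M.α d)) (by omega) (hβ.delete hd) (by
        intro P hσ hP
        refine htr P hσ ?_
        have hσ' : ∀ c ∈ P, M.σ⁻¹ c ∈ P := by
          intro c hc
          refine mem_of_sameCycle (ψ := M.σ) (P := (· ∈ P)) hσ (c := c) ⟨-1, by simp⟩ hc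
        have hψ : ∀ c ∈ P, M.contour (β * Equiv.swap d (M.α d)) c ∈ P := fun c hc => by
          rw [contour, Equiv.Perm.mul_apply]
          exact hσ' _ (hP c hc)
        intro c hc
        by_cases c1 : c = d
        · subst c1
          rw [hd]
          exact mem_of_sameCycle (P := (· ∈ P)) hψ hmerge hc
        · by_cases c2 : c = M.α d
          · subst c2
            rw [hβ.apply_α_of_eq hd]
            exact mem_of_sameCycle (P := (· ∈ P)) hψ hmerge.symm hc
          · have := hP c hc
            rwa [Equiv.Perm.mul_apply, Equiv.swap_apply_of_ne_of_ne c1 c2] at this) (hc.delete hβ hd h)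
      exact ⟨β', g1, g2, g3, by rw [g4]; push_cast [← h1, ← h2]; ring⟩

/-- A unicellular submap has a spanning tree, along which voltages can be gauged away. -/
theorem exists_spanning_tree {G : Type*} [AddGroup G] {β : Equiv.Perm D} (hβ : M.IsEdgeSet β)
    (hcyc : ∀ x y, (M.contour β).SameCycle x y) {f : D → G} (hf : ∀ d, f (M.α d) = -f d) (n : ℕ) :
    ∀ (γ : Equiv.Perm D) (g : D → G), β.support.card ≤ γ.support.card + n → M.IsEdgeSet γ →
    (∀ d, γ d ≠ d → β d ≠ d) → (∀ d, (M.contour γ).SameCycle d (γ d)) →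
    (∀ d, g (M.σ d) = g d) → (∀ d, γ d ≠ d → g (M.α d) = f d + g d) →
    ∃ (γ' : Equiv.Perm D) (g' : D → G), M.IsEdgeSet γ' ∧
      (∀ d, γ' d ≠ d → β d ≠ d) ∧ (∀ x y, (M.contour γ').SameCycle x y) ∧
      (∀ d, g' (M.σ d) = g' d) ∧ (∀ d, γ' d ≠ d → g' (M.α d) = f d + g' d) ∧
      γ'.support.card + 2 * numCycles (M.contour γ') =
        γ.support.card + 2 * numCycles (M.contour γ) := by
  have hσβ : ∀ P : Set D, (∀ d ∈ P, M.σ d ∈ P) → (∀ d ∈ P, β d ∈ P) → ∀ x ∈ P, ∀ y, y ∈ P := by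
    intro P hσ hP x hx y
    refine mem_of_sameCycle (P := (· ∈ P)) ?_ (hcyc x y) hx
    intro c hc
    rw [contour, Equiv.Perm.mul_apply]
    exact mem_of_sameCycle (ψ := M.σ) (P := (· ∈ P)) hσ (c := β c) ⟨-1, by simp⟩ (hP c hc)
  induction n with
  | zero =>
    intro γ g hn hγ hγβ hcomp hg hgf
    have hsub : γ.support ⊆ β.support := fun d hd => by
      rw [Equiv.Perm.mem_support] at hd ⊢
      exact hγβ d hd
    have heq := Finset.eq_of_subset_of_card_le hsub hn
    have : γ = β := by
      ext d
      by_cases hd : γ d = d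
      · have : d ∉ β.support := by rw [← heq]; simpa using hd
        rw [hd, Equiv.Perm.notMem_support.1 this]
      · rw [(hγ d).resolve_right hd, (hβ d).resolve_right (hγβ d hd)]
    subst this
    exact ⟨γ, g, hγ, hγβ, hcyc, hg, hgf, rfl⟩
  | succ n ih =>
    intro γ g hn hγ hγβ hcomp hg hgf
    have hσγ : ∀ d, (M.contour γ).SameCycle d (M.σ d) := by
      intro d
      have : M.contour γ (γ (M.σ d)) = d := by
        rw [contour, Equiv.Perm.mul_apply, hγ.apply_apply]
        simp
      have h3 : (M.contour γ).SameCycle (γ (M.σ d)) d := ⟨1, by rw [zpow_one, this]⟩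
      exact h3.symm.trans (hcomp _).symm
    -- Throughout, the contours of the forest `γ` are its components. An edge of `β` between two of
    -- them may be added: two darts more, one contour less.
    by_cases h : ∀ d, β d = M.α d → (M.contour γ).SameCycle d (M.α d)
    · refine ⟨γ, g, hγ, hγβ, ?_, hg, hgf, rfl⟩
      intro x y
      refine hσβ {z | (M.contour γ).SameCycle x z} (fun d hd => hd.trans (hσγ d)) ?_ x
        (.refl _ _) y
      intro d hd
      rcases hβ d with h1 | h1
      · rw [h1]; exact hd.trans (h d h1)
      · rwa [h1]
    · push Not at h
      obtain ⟨d, hd, h⟩ := h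
      have hγd : γ d = d := by
        rcases hγ d with h1 | h1
        · exact absurd (h1 ▸ hcomp d) h
        · exact h1
      have h0 := M.α_ne d
      have hγd' := hγ.apply_α_of_fixed hγd
      set ψ := M.contour γ with hψ
      classical
      -- The gauge is shifted on the component of `α d` so that `f` is gauged away on the added edge
      -- as well.
      let k : G := -g (M.α d) + f d + g d
      let g' : D → G := fun c => if ψ.SameCycle (M.α d) c then g c + k else g c
      have h' : ¬ ψ.SameCycle (M.α d) d := fun e => h e.symm
      have hgd : g' (M.α d) = f d + g' d := by
        simp only [g', Equiv.Perm.SameCycle.refl, if_true, h', if_false, k]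
        simp [add_assoc]
      have hsup := hγ.support_add hγd
      have hnum := numCycles_mul_swap h
      rw [← contour_mul] at hnum
      have e3 : ∀ c, c ≠ d → c ≠ M.α d → (γ * Equiv.swap d (M.α d)) c = γ c :=
        fun c h1 h2 => by rw [Equiv.Perm.mul_apply, Equiv.swap_apply_of_ne_of_ne h1 h2]
      obtain ⟨γ', g'', k1, k2, k3, k4, k5, k6⟩ := ih (γ * Equiv.swap d (M.α d)) g' (by omega)
        (hγ.add hγd) (by
          intro c hc
          by_cases c1 : c = d
          · rw [c1, hd]; exact h0
          · by_cases c2 : c = M.α d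
            · rw [c2, hβ.apply_α_of_eq hd]; exact h0.symm
            · rw [e3 c c1 c2] at hc
              exact hγβ c hc) (by
          intro c
          rw [contour_mul]
          by_cases c1 : c = d
          · subst c1
            simp only [Equiv.Perm.mul_apply, Equiv.swap_apply_left, hγd']
            exact sameCycle_mul_swap_left h
          · by_cases c2 : c = M.α d
            · subst c2
              simp only [Equiv.Perm.mul_apply, Equiv.swap_apply_right, hγd]
              exact (sameCycle_mul_swap_left h).symm
            · rw [e3 c c1 c2]
              exact SameCycle.mul_swap h (hcomp c)) (by
          intro c
          have : ψ.SameCycle (M.α d) (M.σ c) ↔ ψ.SameCycle (M.α d) c :=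
            ⟨fun e => e.trans (hσγ c).symm, fun e => e.trans (hσγ c)⟩
          simp only [g', this, hg]) (by
          intro c hc
          by_cases c1 : c = d
          · rw [c1, hgd]
          · by_cases c2 : c = M.α d
            · rw [c2, M.α_invol, hgd, hf, neg_add_cancel_left]
            · rw [e3 c c1 c2] at hc
              have hc' := (hγ c).resolve_right hc
              have : ψ.SameCycle (M.α d) (M.α c) ↔ ψ.SameCycle (M.α d) c := by
                rw [← hc']
                exact ⟨fun e => e.trans (hcomp c).symm, fun e => e.trans (hcomp c)⟩
              simp only [g', this, hgf c hc]
              split_ifs <;> simp [add_assoc])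
      exact ⟨γ', g'', k1, k2, k3, k4, k5, by rw [k6, hsup, ← hnum]; ring⟩

end Abelian

end CombMap

namespace CombMap

/-! ### Two interleaving handles commute. -/

section Abelian

variable {D : Type*} {G : Type*} [AddGroup G]

/-- `r x` is the first visit to `Z` on the forward orbit of `x`, with `x` itself counted. Functions
that change only at steps leaving `Z` agree at `x` and `r x`. -/
theorem exists_firstReturn {D G : Type*} {ψ : Equiv.Perm D} {Z : Set D} (h : ∀ x, ∃ k : ℕ, (ψ ^ k) x ∈ Z) :
    ∃ r : D → D, (∀ x, r x ∈ Z) ∧ (∀ x ∈ Z, r x = x) ∧ (∀ x ∉ Z, r (ψ x) = r x) ∧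
      ∀ s : D → G, (∀ x ∉ Z, s (ψ x) = s x) → ∀ x, s (r x) = s x := by
  classical
  refine ⟨fun x => (ψ ^ Nat.find (h x)) x, fun x => Nat.find_spec (h x), ?_, ?_, ?_⟩
  · intro x hx
    have : Nat.find (h x) = 0 := (Nat.find_eq_zero (h x)).2 (by simpa)
    simp [this]
  · intro x hx
    have h1 : ∃ n, (ψ ^ (n + 1)) x ∈ Z := by
      obtain ⟨k, hk⟩ := h (ψ x)
      exact ⟨k, by rwa [pow_succ, Equiv.Perm.mul_apply]⟩
    have h2 := Nat.find_comp_succ (h x) h1 (by simpa)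
    have h3 : Nat.find h1 = Nat.find (h (ψ x)) := by
      congr 1
    simp only [h2, h3]
    rw [pow_succ, Equiv.Perm.mul_apply]
  · intro s hs x
    have : ∀ k ≤ Nat.find (h x), s ((ψ ^ k) x) = s x := by
      intro k
      induction k with
      | zero => simp
      | succ k ih =>
        intro hk
        rw [pow_succ', Equiv.Perm.mul_apply, hs _ (Nat.find_min (h x) hk), ih (by omega)]
    exact this _ le_rfl

/-- Two handles that interleave commute. -/
theorem add_comm_of_firstReturn {Z : Set D} {a a' b b' : D} {n : D → D} {s : D → G} {x y : G}
    (hZ : Z = {a, a', b, b'}) (hab : a ≠ b) (hab' : a ≠ b') (haa' : a ≠ a') (ha'b : a' ≠ b)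
    (hn : ∀ z, n z ∈ Z) (hinv : ∀ W : Set D, W ⊆ Z → W.Nonempty → (∀ z ∈ W, n z ∈ W) → Z ⊆ W)
    (e3 : n b ≠ b') (e4 : n b' ≠ b)
    (e1' : n a' ≠ a)
    (hsa : s (n a) = x + s a) (hsa' : s (n a') = -x + s a') (hsb : s (n b) = y + s b)
    (hsb' : s (n b') = -y + s b') (hnab : n a = b) : x + y = y + x := by
  have hfix : ∀ z ∈ Z, n z ≠ z := by
    intro z hz e
    have := hinv {z} (by simpa) ⟨z, rfl⟩ (by simp [e])
    rw [hZ] at this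
    have h1 := this (show a ∈ _ by simp)
    have h2 := this (show b ∈ _ by simp)
    exact hab (h1.trans h2.symm)
  have two : ∀ z w, z ∈ Z → w ∈ Z → n z = w → n w = z → ∀ u ∈ Z, u = z ∨ u = w := by
    intro z w hz hw h1 h2 u hu
    have := hinv {z, w} (by rintro _ (rfl | rfl) <;> assumption) ⟨z, by simp⟩ (by
      rintro _ (rfl | rfl)
      · simp [h1]
      · simp [h2])
    exact this hu
  have ma : a ∈ Z := by simp [hZ]
  have ma' : a' ∈ Z := by simp [hZ]
  have mb : b ∈ Z := by simp [hZ]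
  have mb' : b' ∈ Z := by simp [hZ]
  -- The return map has no proper invariant subset, so it is a 4-cycle, and the excluded successors
  -- leave only the order `a, b, a', b'`. Going round it once with the potential `s` gives a trivial
  -- commutator.
  have c1 : n b = a' := by
    have h1 := hn b
    rw [hZ] at h1
    rcases h1 with h1 | h1 | h1 | h1
    · rcases two a b ma mb hnab h1 a' ma' with h2 | h2
      · exact absurd h2.symm haa'
      · exact absurd h2 ha'b
    · exact h1
    · exact absurd h1 (hfix b mb)
    · exact absurd h1 e3
  have c2 : n a' = b' := by
    have h1 := hn a'
    rw [hZ] at h1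
    rcases h1 with h1 | h1 | h1 | h1
    · exact absurd h1 e1'
    · exact absurd h1 (hfix a' ma')
    · rcases two a' b ma' mb h1 c1 a ma with h2 | h2
      · exact absurd h2 haa'
      · exact absurd h2 hab
    · exact h1
  have c3 : n b' = a := by
    have h1 := hn b'
    rw [hZ] at h1
    rcases h1 with h1 | h1 | h1 | h1
    · exact h1
    · rcases two a' b' ma' mb' c2 h1 a ma with h2 | h2
      · exact absurd h2 haa'
      · exact absurd h2 hab'
    · exact absurd h1 e4
    · exact absurd h1 (hfix b' mb')
  rw [hnab] at hsa
  rw [c1, hsa] at hsb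
  rw [c2, hsb] at hsa'
  rw [c3, hsa'] at hsb'
  have : -y + (-x + (y + x)) = 0 := by
    have h := hsb'
    rw [← add_assoc y, ← add_assoc (-x), ← add_assoc (-y)] at h
    exact (right_eq_add.1 h)
  have h2 := congrArg (fun z => x + (y + z)) this
  simpa using h2.symm

variable {M : CombMap D}

/-- A set that is closed under rotations and reversals contains all darts. -/
theorem IsToroidal.mem_of_closed (hM : M.IsToroidal) {P : Set D} (hσ : ∀ d ∈ P, M.σ d ∈ P)
    (hα : ∀ d ∈ P, M.α d ∈ P) {x : D} (hx : x ∈ P) (y : D) : y ∈ P := by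
  have := hM.finite
  obtain ⟨w, rfl⟩ := hM.connected x y
  have hσ' : ∀ c ∈ P, M.σ⁻¹ c ∈ P := fun c hc =>
    mem_of_sameCycle (ψ := M.σ) (P := (· ∈ P)) hσ (c := c) ⟨-1, by simp⟩ hc
  have hα' : ∀ c ∈ P, M.α⁻¹ c ∈ P := fun c hc =>
    mem_of_sameCycle (ψ := M.α) (P := (· ∈ P)) hα (c := c) ⟨-1, by simp⟩ hc
  induction w using FreeGroup.induction_on generalizing x with
  | C1 => simpa
  | of b => cases b <;> simp [act, hσ _ hx, hα _ hx]
  | inv_of b _ =>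
    cases b
    · simpa [act] using hα' _ hx
    · simpa [act] using hσ' _ hx
  | mul u v hu hv =>
    rw [map_mul, Equiv.Perm.mul_apply]
    exact hu (hv hx)

/-- In a toroidal map, every voltage without holonomy around the faces can be gauged to a voltage
generated by two commuting elements. -/
theorem IsToroidal.exists_gauge (hM : M.IsToroidal) {f : D → G} (hf : ∀ d, f (M.α d) = -f d)
    (ht : ∃ t : D → G, ∀ d, t (M.φ d) = f d + t d) :
    ∃ (g : D → G) (x y : G), (∀ d, g (M.σ d) = g d) ∧ x + y = y + x ∧
      ∀ d, -g (M.α d) + f d + g d ∈ AddSubgroup.closure {x, y} := by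
  classical
  have := hM.finite
  have := hM.nonempty
  have : Fintype D := Fintype.ofFinite D
  have hα : M.IsEdgeSet M.α := fun d => Or.inl rfl
  have hsupα : M.α.support.card = Nat.card D := by
    rw [Nat.card_eq_fintype_card, ← Finset.card_univ]
    congr 1
    ext d
    simp [M.α_ne]
  have hE := two_mul_numCycles_of_involutive M.α_invol M.α_ne
  have hφ : M.contour M.α = M.φ := rfl
  have heuler : (numCycles M.σ : ℤ) - numCycles M.α + numCycles M.φ = 0 := hM.euler
  obtain ⟨β, hβ, hcyc, hcar, hcount⟩ := exists_unicellular G _ M.α le_rfl hα (by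
    intro P hσ hα x hx y
    exact hM.mem_of_closed hσ hα hx y) (by
    intro f hf ht
    refine ⟨?_, fun d => AddSubgroup.subset_closure ⟨d, M.α_ne d, rfl⟩⟩
    obtain ⟨t, ht⟩ := ht
    exact ⟨t, fun c => by rw [if_neg (M.α_ne c)]; exact ht c⟩)
  obtain ⟨γ, g, hγ, hγβ, hγcyc, hg, hgf, hγcount⟩ :=
    exists_spanning_tree hβ hcyc hf β.support.card 1 0 (by simp) (fun d => Or.inr rfl)
      (by simp) (fun d => .refl _ _) (by simp) (by simp)
  rw [hφ, hsupα, numCycles_eq_one hcyc] at hcount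
  rw [numCycles_eq_one hγcyc, contour, mul_one, mul_one, numCycles_inv, Equiv.Perm.support_one] at hγcount
  simp only [Finset.card_empty] at hγcount
  -- With `V - E + F = 0`: `β` moves `2E - 2F + 2` darts and the tree moves `2V - 2`, so exactly two
  -- edges lie outside the tree.
  have hcard : β.support.card = γ.support.card + 4 := by omega
  have hsub : γ.support ⊆ β.support := fun d hd => by
    rw [Equiv.Perm.mem_support] at hd ⊢
    exact hγβ d hd
  set Zf := β.support \ γ.support with hZf
  have hZcard : Zf.card = 4 := by
    rw [hZf, Finset.card_sdiff_of_subset hsub]; omega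
  have hmem : ∀ z, z ∈ Zf ↔ β z ≠ z ∧ γ z = z := by
    intro z
    simp [hZf]
  have hβα : ∀ z, β z ≠ z → β z = M.α z := fun z hz => (hβ z).resolve_right hz
  have hαZ : ∀ z ∈ Zf, M.α z ∈ Zf := by
    intro z hz
    rw [hmem] at hz ⊢
    refine ⟨?_, hγ.apply_α_of_fixed hz.2⟩
    rw [hβ.apply_α_of_eq (hβα z hz.1)]
    exact (M.α_ne z).symm
  obtain ⟨a, ha⟩ : Zf.Nonempty := Finset.card_pos.1 (by omega)
  have hb' : (Zf \ {a, M.α a}).Nonempty := by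
    rw [← Finset.card_pos, Finset.card_sdiff_of_subset (by
      intro z hz
      rcases Finset.mem_insert.1 hz with rfl | hz
      · exact ha
      · rw [Finset.mem_singleton.1 hz]; exact hαZ a ha), hZcard,
      Finset.card_pair (M.α_ne a).symm]
    norm_num
  obtain ⟨b, hb⟩ := hb'
  simp only [Finset.mem_sdiff, Finset.mem_insert, Finset.mem_singleton, not_or] at hb
  obtain ⟨hb, hba, hba'⟩ := hb
  have d1 : a ≠ M.α b := fun e => hba' (by rw [e, M.α_invol])
  have d2 : M.α a ≠ M.α b := fun e => hba (M.α.injective e).symm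
  have hZ : (Zf : Set D) = {a, M.α a, b, M.α b} := by
    have : ({a, M.α a, b, M.α b} : Finset D) = Zf := by
      refine Finset.eq_of_subset_of_card_le ?_ ?_
      · intro z hz
        simp only [Finset.mem_insert, Finset.mem_singleton] at hz
        rcases hz with rfl | rfl | rfl | rfl
        exacts [ha, hαZ _ ha, hb, hαZ _ hb]
      · rw [hZcard, Finset.card_insert_of_notMem, Finset.card_insert_of_notMem,
          Finset.card_pair (M.α_ne b).symm]
        · simp [Ne.symm hba', d2]
        · simp [(M.α_ne a).symm, Ne.symm hba, d1]
    rw [← this]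
    simp
  -- the gauged voltage
  set f' : D → G := fun d => -g (M.α d) + f d + g d with hf'
  have hf'α : ∀ d, f' (M.α d) = -f' d := by
    intro d
    simp only [hf', M.α_invol, hf, neg_add_rev, neg_neg, add_assoc]
  obtain ⟨t, ht⟩ := ht
  have hσg : ∀ d, g (M.σ⁻¹ d) = g d := fun d => by
    have := hg (M.σ⁻¹ d)
    rw [← Equiv.Perm.mul_apply, mul_inv_cancel, Equiv.Perm.one_apply] at this
    exact this.symm
  obtain ⟨⟨s, hs⟩, hgen⟩ := hcar f' hf'α ⟨fun d => -g d + t d, fun d => by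
    simp only [ht, hf', add_assoc, add_neg_cancel_left]
    rw [φ_eq, hσg]⟩
  have hf'γ : ∀ d, γ d ≠ d → f' d = 0 := fun d hd => by
    simp only [hf', hgf d hd, neg_add_rev, add_assoc]
    simp
  have hsZ : ∀ z ∉ (Zf : Set D), s (M.contour β z) = s z := by
    intro z hz
    rw [Finset.mem_coe, hmem] at hz
    rw [hs]
    split_ifs with h1
    · rw [zero_add]
    · rw [hf'γ z (fun h2 => hz ⟨h1, h2⟩), zero_add]
  have hψZ : ∀ z ∉ (Zf : Set D), M.contour γ z = M.contour β z := by
    intro z hz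
    rw [Finset.mem_coe, hmem] at hz
    rw [contour, contour, Equiv.Perm.mul_apply, Equiv.Perm.mul_apply]
    congr 1
    by_cases h1 : γ z = z
    · rw [h1]; by_contra h2; exact hz ⟨Ne.symm h2, h1⟩
    · rw [(hγ z).resolve_right h1, hβα z (hγβ z h1)]
  have hψZ' : ∀ z ∈ (Zf : Set D), M.contour γ z = M.contour β (M.α z) := by
    intro z hz
    have hz' := (hmem z).1 hz
    rw [contour, contour, Equiv.Perm.mul_apply, Equiv.Perm.mul_apply, hz'.2,
      hβ.apply_α_of_eq (hβα z hz'.1)]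
  obtain ⟨r, hrZ, hrid, hrψ, hrs⟩ := exists_firstReturn (G := G) (ψ := M.contour β)
    (Z := (Zf : Set D)) (fun x => by
      obtain ⟨k, -, hk⟩ := (hcyc x a).exists_pow_eq'
      exact ⟨k, by rw [hk]; exact ha⟩)
  have hinv : ∀ W : Set D, W ⊆ Zf → W.Nonempty → (∀ z ∈ W, r (M.contour β z) ∈ W) →
      (Zf : Set D) ⊆ W := by
    rintro W hW ⟨w, hw⟩ h z hz
    have := mem_of_sameCycle (P := fun u => r u ∈ W) (c := w) (c' := z) ?_ (hcyc w z)
      (by rwa [hrid w (hW hw)])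
    · rwa [hrid z hz] at this
    · intro c hc
      by_cases hcZ : c ∈ (Zf : Set D)
      · rw [hrid c hcZ] at hc
        exact h c hc
      · rwa [hrψ c hcZ]
  -- The contour of the tree leaves `α z` as the contour of `β` leaves `z`. If the latter returned
  -- at `α z`, the former would meet no other dart of `Zf`, although it is the only contour of the
  -- tree.
  have hne : ∀ z ∈ (Zf : Set D), r (M.contour β z) ≠ M.α z := by
    intro z hz e
    have key : ∀ u ∈ (Zf : Set D), u = M.α z := by
      intro u hu
      have := mem_of_sameCycle (P := fun c => r c = M.α z) (c := M.α z) (c' := u) ?_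
        (hγcyc _ _) (hrid _ (hαZ z hz))
      · rwa [hrid u hu] at this
      · intro c hc
        by_cases hcZ : c ∈ (Zf : Set D)
        · rw [hrid c hcZ] at hc
          rw [hψZ' c hcZ, hc, M.α_invol, e]
        · rwa [hψZ c hcZ, hrψ c hcZ]
    exact hba ((key b hb).trans (key a ha).symm)
  have hsn : ∀ z ∈ (Zf : Set D), s (r (M.contour β z)) = f' z + s z := by
    intro z hz
    rw [hrs s hsZ, hs, if_neg ((hmem z).1 hz).1]
  refine ⟨g, f' a, f' b, hg, ?_, ?_⟩
  · have hna := hrZ (M.contour β a)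
    have ka := hsn a ha
    have ka' := hsn _ (hαZ a ha)
    have kb := hsn b hb
    have kb' := hsn _ (hαZ b hb)
    have na' := hne _ (hαZ a ha)
    have nb' := hne _ (hαZ b hb)
    rw [hf'α] at ka' kb'
    rw [M.α_invol] at na' nb'
    have h1 := hinv {a} (by simpa using ha) ⟨a, rfl⟩
    rw [hZ] at hna
    rcases hna with h2 | h2 | h2 | h2
    · exfalso
      have := h1 (by simp [h2])
      exact hba (this hb)
    · exact absurd h2 (hne a ha)
    · exact add_comm_of_firstReturn (n := fun z => r (M.contour β z)) (s := s) hZ (Ne.symm hba) d1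
        (M.α_ne a).symm (Ne.symm hba') (fun z => hrZ _) hinv
        (hne b hb) nb' na' ka ka' kb kb' h2
    -- The other cyclic order is the same with `b` and its reverse exchanged, so the second element
    -- is `-f' b`.
    · have hZ' : (Zf : Set D) = {a, M.α a, M.α b, b} := by
        rw [hZ, Set.pair_comm b]
      have := add_comm_of_firstReturn (n := fun z => r (M.contour β z)) (s := s) (y := -f' b) hZ' d1
        (Ne.symm hba)
        (M.α_ne a).symm d2 (fun z => hrZ _) hinv
        nb' (hne b hb) na' ka ka' kb' (by rw [kb, neg_neg]) h2
      have h3 := congrArg (fun u => f' b + u + f' b) this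
      simpa [add_assoc] using h3.symm
  · intro d
    refine (AddSubgroup.closure_le _).2 ?_ (hgen d)
    rintro _ ⟨z, hz, rfl⟩
    by_cases hz' : γ z = z
    · have : z ∈ (Zf : Set D) := (hmem z).2 ⟨hz, hz'⟩
      rw [hZ] at this
      have ma : f' a ∈ AddSubgroup.closure {f' a, f' b} := AddSubgroup.subset_closure (by simp)
      have mb : f' b ∈ AddSubgroup.closure {f' a, f' b} := AddSubgroup.subset_closure (by simp)
      rcases this with rfl | rfl | rfl | rfl
      · exact ma
      · rw [hf'α]; exact neg_mem ma
      · exact mb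
      · rw [hf'α]; exact neg_mem mb
    · rw [hf'γ z hz']
      exact zero_mem _

end Abelian

end CombMap

namespace CombMap

/-! ### The fundamental group as a holonomy group. -/

section Hurewicz

variable {D : Type*} {M : CombMap D} {G : Type*} [AddGroup G]

/-- A cocycle that extends the voltage `v` to words is its holonomy. -/
theorem hol_unique {v : Bool → D → G} {h : Word → D → G}
    (hmul : ∀ x y d, h (x * y) d = h x (M.act y d) + h y d)
    (hof : ∀ b d, h (FreeGroup.of b) d = v b d) (w : Word) (d : D) : M.hol v w d = h w d := by
  have h1 : ∀ d, h 1 d = 0 := fun d => by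
    have := hmul 1 1 d
    rw [mul_one, map_one, Equiv.Perm.one_apply] at this
    exact right_eq_add.1 this
  have hb : ∀ b d, M.hol v (FreeGroup.of b) d = h (FreeGroup.of b) d := fun b d => by
    rw [hof]
    cases b
    · exact M.hol_flip v d
    · exact M.hol_rot v d
  induction w using FreeGroup.induction_on generalizing d with
  | C1 => rw [h1, hol_one]
  | of b => exact hb b d
  | inv_of b _ =>
    have := hmul (FreeGroup.of b) (FreeGroup.of b)⁻¹ d
    rw [mul_inv_cancel, h1] at this
    rw [hol_inv, hb, neg_eq_of_add_eq_zero_right this.symm]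
  | mul x y hx hy => rw [hol_mul, hmul, hx, hy]

/-- The voltage that is trivial on rotations around vertices. -/
def primalVoltage (f : D → G) : Bool → D → G := fun b d => if b then 0 else f d

@[simp] theorem primalVoltage_true (f : D → G) (d : D) : primalVoltage f true d = 0 := rfl

@[simp] theorem primalVoltage_false (f : D → G) (d : D) : primalVoltage f false d = f d := rfl

theorem primalVoltage_flat {f : D → G} (hf : ∀ d, f (M.α d) = -f d)
    (ht : ∃ t : D → G, ∀ d, t (M.φ d) = f d + t d) : M.Flat (primalVoltage f) where
  rot := ⟨0, by simp⟩
  flip d := by simp [hf]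
  face := by simpa using ht

/-- A voltage whose holonomy vanishes on the powers of a word that close up has a potential. -/
theorem exists_potential_of_hol {v : Bool → D → G} (R : Word)
    (h : ∀ (k : ℤ) d, M.act (R ^ k) d = d → M.hol v (R ^ k) d = 0) :
    ∃ s : D → G, ∀ d, s (M.act R d) = M.hol v R d + s d := by
  refine exists_potential_of_closed fun k d hk => ?_
  have e : stepPerm (M.act R) (M.hol v R) = M.liftAct v R := by
    ext x
    · rw [show x = (x.1, x.2) from rfl, liftAct_apply]; rfl
    · rw [show x = (x.1, x.2) from rfl, liftAct_apply]; rfl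
  rw [← map_zpow] at hk
  rw [e, ← map_zpow, liftAct_apply, hk, h k d hk, zero_add]

theorem hol_gauge {v v' : Bool → D → G} {g : D → G}
    (h : ∀ b d, v' b d = -g (M.act (FreeGroup.of b) d) + v b d + g d) (w : Word) (d : D) :
    M.hol v' w d = -g (M.act w d) + M.hol v w d + g d := by
  refine hol_unique (h := fun w d => -g (M.act w d) + M.hol v w d + g d) ?_ ?_ w d
  · intro x y d
    rw [hol_mul, map_mul, Equiv.Perm.mul_apply]
    simp [add_assoc]
  · intro b d
    rw [h]
    cases b
    · exact congrArg (fun z => _ + z + _) (M.hol_flip v d)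
    · exact congrArg (fun z => _ + z + _) (M.hol_rot v d)

theorem hol_map {H : Type*} [AddGroup H] (F : G →+ H) {v : Bool → D → G} {v' : Bool → D → H}
    (h : ∀ b d, v' b d = F (v b d)) (w : Word) (d : D) : M.hol v' w d = F (M.hol v w d) := by
  refine hol_unique (h := fun w d => F (M.hol v w d)) ?_ ?_ w d
  · intro x y d
    rw [hol_mul, map_add]
  · intro b d
    rw [h]
    cases b
    · exact congrArg F (M.hol_flip v d)
    · exact congrArg F (M.hol_rot v d)

variable (M) in
/-- The words that describe closed curves based at a dart. -/
def loops (d : D) : Subgroup Word where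
  carrier := {w | M.act w d = d}
  one_mem' := by simp
  mul_mem' {a b} ha hb := by
    rw [Set.mem_ofPred_eq] at *
    rw [map_mul, Equiv.Perm.mul_apply, hb, ha]
  inv_mem' {a} ha := by
    rw [Set.mem_ofPred_eq] at *
    rw [map_inv, Equiv.Perm.inv_eq_iff_eq, ha]

theorem mem_loops {d : D} {w : Word} : w ∈ M.loops d ↔ M.act w d = d := Iff.rfl

instance nullLoops_normal (d : D) : ((M.nullLoops d).subgroupOf (M.loops d)).Normal where
  conj_mem := by
    rintro ⟨n, hn'⟩ hn ⟨g, hg⟩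
    rw [Subgroup.mem_subgroupOf] at hn ⊢
    have h := (conj_mem_nullLoops_iff n g⁻¹ d).2 (by
      rw [map_inv, Equiv.Perm.inv_eq_iff_eq.2 (mem_loops.1 hg).symm]
      exact hn)
    simpa using h

/-- The universal voltage. -/
theorem exists_universal_voltage (hconn : ∀ d d' : D, ∃ w : Word, M.act w d = d') (d₀ : D) :
    ∃ (G : Type) (_ : AddGroup G) (v : Bool → D → G),
      (∀ d w, M.act w d = d → (M.hol v w d = 0 ↔ w ∈ M.nullLoops d)) ∧
      ∀ a, ∃ w, M.act w d₀ = d₀ ∧ M.hol v w d₀ = a := by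
  choose p hp using hconn d₀
  have hp' : ∀ d, M.act (p d)⁻¹ d = d₀ := fun d => by
    rw [map_inv, Equiv.Perm.inv_eq_iff_eq, hp]
  -- A curve is closed up by the chosen paths from `d₀` and taken modulo null-homotopic loops.
  let h : Word → D → Additive (M.loops d₀ ⧸ (M.nullLoops d₀).subgroupOf (M.loops d₀)) :=
    fun w d => Additive.ofMul (QuotientGroup.mk ⟨(p (M.act w d))⁻¹ * w * p d, by
      rw [mem_loops, map_mul, map_mul, Equiv.Perm.mul_apply, Equiv.Perm.mul_apply, hp, hp']⟩)
  have hh : ∀ w d, M.hol (fun b d => h (FreeGroup.of b) d) w d = h w d := by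
    intro w d
    refine hol_unique (h := h) ?_ (fun _ _ => rfl) w d
    intro x y d
    simp only [h]
    rw [← ofMul_mul, ← QuotientGroup.mk_mul]
    congr 2
    ext1
    simp [map_mul, Equiv.Perm.mul_apply, mul_assoc]
  have hz : ∀ d w, M.act w d = d → (h w d = 0 ↔ w ∈ M.nullLoops d) := by
    intro d w hw
    have : w ∈ M.nullLoops d ↔ (p d)⁻¹ * w * p d ∈ M.nullLoops d₀ := by
      rw [conj_mem_nullLoops_iff, hp]
    rw [this, ← ofMul_one, Additive.ofMul.injective.eq_iff, QuotientGroup.eq_one_iff,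
      Subgroup.mem_subgroupOf]
    simp only [hw]
  refine ⟨_, inferInstance, fun b d => h (FreeGroup.of b) d, fun d w hw => ?_, fun a => ?_⟩
  · rw [hh, hz d w hw]
  · induction a using Additive.rec with | ofMul a =>
    induction a using QuotientGroup.induction_on with | H z =>
    refine ⟨p d₀ * z.1 * (p d₀)⁻¹, ?_, ?_⟩
    · rw [map_mul, map_mul, Equiv.Perm.mul_apply, Equiv.Perm.mul_apply, hp', mem_loops.1 z.2, hp]
    · rw [hh]
      simp only [h]
      congr 2
      ext1
      have : M.act (p d₀ * z.1 * (p d₀)⁻¹) d₀ = d₀ := by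
        rw [map_mul, map_mul, Equiv.Perm.mul_apply, Equiv.Perm.mul_apply, hp', mem_loops.1 z.2, hp]
      change (p (M.act (p d₀ * z.1 * (p d₀)⁻¹) d₀))⁻¹ * (p d₀ * z.1 * (p d₀)⁻¹) * p d₀ = z.1
      rw [this]
      group

/-- The fundamental group of a toroidal map is abelian and generated by two elements: it is the
holonomy group of a voltage in such a group. -/
theorem IsToroidal.exists_abelian_voltage (hM : M.IsToroidal) (d₀ : D) :
    ∃ (A : Type) (_ : AddCommGroup A) (f : D → A), (∀ d, f (M.α d) = -f d) ∧
      (∃ t : D → A, ∀ d, t (M.φ d) = f d + t d) ∧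
      (∀ d w, M.act w d = d → (M.hol (primalVoltage f) w d = 0 ↔ w ∈ M.nullLoops d)) ∧
      ∃ wx wy, M.act wx d₀ = d₀ ∧ M.act wy d₀ = d₀ ∧
        ∀ a, ∃ i j : ℤ, a = i • M.hol (primalVoltage f) wx d₀ +
          j • M.hol (primalVoltage f) wy d₀ := by
  obtain ⟨G, _, v, hv, hsurj⟩ := exists_universal_voltage hM.connected d₀
  have hloc : ∀ (R : Word), R ∈ ({CombMap.rot, faceRot} : Set Word) → ∀ (k : ℤ) d,
      M.act (R ^ k) d = d → R ^ k ∈ M.nullLoops d := by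
    rintro R (rfl | rfl) k d h
    · exact local_mem_nullLoops (Or.inl ⟨k, rfl⟩) h
    · exact local_mem_nullLoops (Or.inr (Or.inr ⟨k, rfl⟩)) h
  obtain ⟨s, hs⟩ := exists_potential_of_hol (M := M) (v := v) CombMap.rot
    (fun k d h => (hv d _ h).2 (hloc _ (by simp) k d h))
  rw [act_rot] at hs
  simp only [hol_rot] at hs
  -- Gauging by a potential around the vertices concentrates the voltage on the edges.
  let f : D → G := fun d => -s (M.α d) + v false d + s d
  have hol1 : ∀ w d, M.hol (primalVoltage f) w d = -s (M.act w d) + M.hol v w d + s d := by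
    refine hol_gauge fun b d => ?_
    cases b
    · simp only [primalVoltage_false, f]
      rw [← act_flip]; rfl
    · change 0 = -s (M.act CombMap.rot d) + v true d + s d
      rw [act_rot, hs, neg_add_rev, add_assoc, add_assoc, neg_add_cancel_left, neg_add_cancel]
  have hz1 : ∀ d w, M.act w d = d →
      (M.hol (primalVoltage f) w d = 0 ↔ w ∈ M.nullLoops d) := by
    intro d w hw
    rw [hol1, hw, ← hv d w hw, add_assoc, neg_add_eq_zero]
    exact ⟨fun h => by simpa using h, fun h => by simp [h]⟩
  have hanti : ∀ {H : Type} [AddGroup H] {F : D → H},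
      (∀ d w, M.act w d = d → w ∈ M.nullLoops d → M.hol (primalVoltage F) w d = 0) →
      ∀ d, F (M.α d) = -F d := by
    intro H _ F hF d
    have h1 := hF d (CombMap.flip ^ (2 : ℤ)) (act_flip_sq d)
      (local_mem_nullLoops (Or.inr (Or.inl ⟨2, rfl⟩)) (act_flip_sq d))
    rw [zpow_two, hol_mul, act_flip, hol_flip, hol_flip] at h1
    exact eq_neg_of_add_eq_zero_left h1
  have hpot : ∀ {H : Type} [AddGroup H] {F : D → H},
      (∀ d w, M.act w d = d → w ∈ M.nullLoops d → M.hol (primalVoltage F) w d = 0) →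
      ∃ t : D → H, ∀ d, t (M.φ d) = F d + t d := by
    intro H _ F hF
    obtain ⟨t, ht⟩ := exists_potential_of_hol (M := M) (v := primalVoltage F) faceRot
      (fun k d h => hF d _ h (hloc _ (by simp) k d h))
    refine ⟨t, fun d => ?_⟩
    rw [← act_faceRot, ht, hol_faceRot]
    simp
  obtain ⟨g, x, y, hg, hxy, hgf⟩ := hM.exists_gauge
    (hanti fun d w h1 h2 => (hz1 d w h1).2 h2) (hpot fun d w h1 h2 => (hz1 d w h1).2 h2)
  let K := AddSubgroup.closure {x, y}
  have hK : IsAddCommutative K := AddSubgroup.isAddCommutative_closure (by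
    rintro a (rfl | rfl) b (rfl | rfl)
    exacts [rfl, hxy, hxy.symm, rfl])
  let instK : AddCommGroup K := { K.toAddGroup with add_comm := hK.is_comm.comm }
  let f' : D → K := fun d => ⟨-g (M.α d) + f d + g d, hgf d⟩
  have hol2 : ∀ w d, ((M.hol (primalVoltage f') w d : K) : G) =
      -g (M.act w d) + M.hol (primalVoltage f) w d + g d := by
    intro w d
    rw [← AddSubgroup.coe_subtype, ← hol_map (M := M) K.subtype (v' := fun b d =>
      K.subtype (primalVoltage f' b d)) (fun _ _ => rfl)]
    refine hol_gauge (fun b d => ?_) w d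
    cases b
    · have e : M.act (FreeGroup.of false) d = M.α d := by
        rw [show FreeGroup.of false = CombMap.flip from rfl, act_flip]
      rw [e]
      rfl
    · change 0 = -g (M.act CombMap.rot d) + 0 + g d
      rw [act_rot, hg]; simp
  have hz2 : ∀ d w, M.act w d = d →
      (M.hol (primalVoltage f') w d = 0 ↔ w ∈ M.nullLoops d) := by
    intro d w hw
    rw [← hz1 d w hw, ← ZeroMemClass.coe_eq_zero, hol2, hw, add_assoc, neg_add_eq_zero]
    exact ⟨fun h => by simpa using h, fun h => by simp [h]⟩
  -- The two gauges `g` and `s` conjugate the holonomy at `d₀`, so a preimage of the conjugated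
  -- element is taken.
  have hsurj2 : ∀ a : K, ∃ w, M.act w d₀ = d₀ ∧ M.hol (primalVoltage f') w d₀ = a := by
    intro a
    obtain ⟨w, hw, ha⟩ := hsurj (s d₀ + (g d₀ + a - g d₀) - s d₀)
    refine ⟨w, hw, ?_⟩
    ext1
    rw [hol2, hol1, hw, ha]
    simp [sub_eq_add_neg, add_assoc]
  obtain ⟨wx, hwx, hx⟩ := hsurj2 ⟨x, AddSubgroup.subset_closure (by simp)⟩
  obtain ⟨wy, hwy, hy⟩ := hsurj2 ⟨y, AddSubgroup.subset_closure (by simp)⟩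
  refine ⟨K, instK, f', hanti fun d w h1 h2 => (hz2 d w h1).2 h2,
    hpot fun d w h1 h2 => (hz2 d w h1).2 h2, hz2, wx, wy, hwx, hwy, ?_⟩
  rw [hx, hy]
  rintro ⟨a, ha⟩
  induction ha using AddSubgroup.closure_induction with
  | mem a ha =>
    rcases ha with rfl | rfl
    · exact ⟨1, 0, by simp⟩
    · exact ⟨0, 1, by simp⟩
  | zero => exact ⟨0, 0, by ext1; simp⟩
  | add a b ha hb iha ihb =>
    obtain ⟨i, j, h1⟩ := iha
    obtain ⟨i', j', h2⟩ := ihb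
    refine ⟨i + i', j + j', ?_⟩
    have : (⟨a + b, K.add_mem ha hb⟩ : K) = ⟨a, ha⟩ + ⟨b, hb⟩ := rfl
    rw [this, h1, h2, add_smul, add_smul]
    abel
  | neg a ha iha =>
    obtain ⟨i, j, h1⟩ := iha
    refine ⟨-i, -j, ?_⟩
    have : (⟨-a, K.neg_mem ha⟩ : K) = -⟨a, ha⟩ := rfl
    rw [this, h1, neg_smul, neg_smul]
    abel

end Hurewicz

end CombMap

namespace CombMap

/-! ### Closed chains, cocycles and the voltages they define. -/

section Coboundaries

variable {E : Type*}

/-- The integer functions that sum to zero over the (finite) cycles of `π`. -/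
def coboundaries (π : Equiv.Perm E) : AddSubgroup (E → ℤ) where
  carrier := {z | ∃ t : E → ℤ, ∀ e, z e = t (π e) - t e}
  zero_mem' := ⟨0, by simp⟩
  add_mem' := by
    rintro a b ⟨s, hs⟩ ⟨t, ht⟩
    refine ⟨s + t, fun e => ?_⟩
    simp only [Pi.add_apply, hs, ht]
    ring
  neg_mem' := by
    rintro a ⟨s, hs⟩
    refine ⟨-s, fun e => ?_⟩
    simp only [Pi.neg_apply, hs]
    ring

variable [DecidableEq E]

theorem single_sub_single_apply_mem (π : Equiv.Perm E) (y : E) :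
    (Pi.single y 1 - Pi.single (π y) 1 : E → ℤ) ∈ coboundaries π := by
  refine ⟨Pi.single (π y) 1, fun e => ?_⟩
  simp only [Pi.sub_apply, Pi.single_apply, π.injective.eq_iff]

theorem single_sub_single_mem {π : Equiv.Perm E} {x y : E} (h : π.SameCycle x y) :
    (Pi.single x 1 - Pi.single y 1 : E → ℤ) ∈ coboundaries π := by
  obtain ⟨k, rfl⟩ := h
  induction k with
  | zero => simp [zero_mem]
  | succ n ih =>
    rw [add_comm, zpow_add, zpow_one, Equiv.Perm.mul_apply]
    have := add_mem ih (single_sub_single_apply_mem π ((π ^ (n : ℤ)) x))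
    simpa using this
  | pred n ih =>
    rw [sub_eq_add_neg (-(n : ℤ)) 1, add_comm (-(n : ℤ)) (-1), zpow_add, zpow_neg_one, Equiv.Perm.mul_apply]
    have := sub_mem ih (single_sub_single_apply_mem π (π⁻¹ ((π ^ (-(n : ℤ))) x)))
    rw [← Equiv.Perm.mul_apply π, mul_inv_cancel, Equiv.Perm.one_apply] at this
    convert this using 1
    abel

theorem sum_range_single_mem {π α : Equiv.Perm E} {dart : ℕ → E}
    (h : ∀ i, π.SameCycle (α (dart i)) (dart (i + 1))) (k : ℕ) :
    ∑ i ∈ Finset.range k, (Pi.single (dart i) 1 - Pi.single (α (dart i)) 1 : E → ℤ) -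
      (Pi.single (dart 0) 1 - Pi.single (dart k) 1) ∈ coboundaries π := by
  induction k with
  | zero => simp [zero_mem]
  | succ k ih =>
    rw [Finset.sum_range_succ]
    have := sub_mem ih (single_sub_single_mem (h k))
    convert this using 1
    abel

-- The increments of `g` around a cycle of `π` sum to zero, and all but two of them vanish. At a
-- vertex of a simple cycle these two belong to the incoming and outgoing edges.
omit [DecidableEq E] in
theorem two_point_sum [Finite E] {π : Equiv.Perm E} {x y : E} (hxy : x ≠ y)
    (hc : π.SameCycle x y) {g : E → ℤ}
    (h : ∀ e, π.SameCycle x e → e ≠ x → e ≠ y → g (π e) = g e) :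
    (g (π x) - g x) + (g (π y) - g y) = 0 := by
  classical
  have : Fintype E := Fintype.ofFinite E
  let O : Finset E := Finset.univ.filter (π.SameCycle x)
  have h1 : ∑ e ∈ O, (g (π e) - g e) = 0 := by
    rw [Finset.sum_sub_distrib, sub_eq_zero]
    refine Finset.sum_bij (fun e _ => π e) ?_ ?_ ?_ ?_
    · intro e he
      simp only [O, Finset.mem_filter, Finset.mem_univ, true_and] at he ⊢
      exact Equiv.Perm.sameCycle_apply_right.2 he
    · intro a _ b _ hab
      exact π.injective hab
    · intro b hb
      simp only [O, Finset.mem_filter, Finset.mem_univ, true_and] at hb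
      refine ⟨π⁻¹ b, ?_, by simp⟩
      simp only [O, Finset.mem_filter, Finset.mem_univ, true_and]
      exact hb.trans ⟨-1, by simp⟩
    · intro e _
      rfl
  rw [← Finset.sum_subset (s₁ := {x, y})] at h1
  · rwa [Finset.sum_pair hxy] at h1
  · intro e he
    simp only [Finset.mem_insert, Finset.mem_singleton] at he
    rcases he with rfl | rfl
    · exact Finset.mem_filter.2 ⟨Finset.mem_univ _, .refl _ _⟩
    · simp [O, hc]
  · intro e he hne
    simp only [O, Finset.mem_filter, Finset.mem_univ, true_and] at he
    simp only [Finset.mem_insert, Finset.mem_singleton, not_or] at hne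
    rw [h e he hne.1 hne.2, sub_self]

end Coboundaries

section Voltages

variable {E : Type*} {N : CombMap E}

/-- The voltage that is trivial on rotations around faces. -/
def dualVoltage (N : CombMap E) (z : E → ℤ) : Bool → E → ℤ :=
  fun b d => if b then -z (N.σ d) else z d

/-- A curve is thought of as running on the left of its darts, so the turn from `d` to `σ d` crosses
`σ d` from right to left. Flatness at the vertices is Kirchhoff's law for `z`; turning inside a face
crosses nothing. -/
theorem dualVoltage_flat {z : E → ℤ} (hz : ∀ d, z (N.α d) = -z d) (hz' : z ∈ coboundaries N.σ) :
    N.Flat (N.dualVoltage z) where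
  rot := by
    obtain ⟨t, ht⟩ := hz'
    refine ⟨fun e => -t (N.σ e), fun d => ?_⟩
    simp only [dualVoltage, if_true, ht]
    ring
  flip d := by simp [dualVoltage, hz]
  face := ⟨0, fun d => by simp [dualVoltage, σ_φ, hz]⟩

theorem hol_dualVoltage_faceRot {z : E → ℤ} (hz : ∀ d, z (N.α d) = -z d) (d : E) :
    N.hol (N.dualVoltage z) faceRot d = 0 := by
  rw [hol_faceRot]
  simp [dualVoltage, σ_φ, hz]

@[simp] theorem hol_dualVoltage_flip (z : E → ℤ) (d : E) :
    N.hol (N.dualVoltage z) CombMap.flip d = z d := by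
  simp [dualVoltage]

theorem primalVoltage_flat_of_mem {z : E → ℤ} (hz : ∀ d, z (N.α d) = -z d)
    (hz' : z ∈ coboundaries N.φ) : N.Flat (primalVoltage z) := by
  obtain ⟨t, ht⟩ := hz'
  exact primalVoltage_flat hz ⟨t, fun d => by rw [ht]; ring⟩

theorem hol_zpow_of_mem_loops {A : Type*} [AddCommGroup A] (v : Bool → E → A) {w : Word} {d : E}
    (hw : N.act w d = d) (i : ℤ) : N.hol v (w ^ i) d = i • N.hol v w d := by
  let F : N.loops d →* Multiplicative A :=
    { toFun := fun w => Multiplicative.ofAdd (N.hol v w.1 d)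
      map_one' := by simp
      map_mul' := fun a b => by
        rw [← ofAdd_add, Subgroup.coe_mul, hol_mul, mem_loops.1 b.2] }
  have h := congrArg Multiplicative.toAdd (map_zpow F ⟨w, hw⟩ i)
  rw [toAdd_zpow] at h
  exact h

theorem hol_conj {A : Type*} [AddCommGroup A] (v : Bool → E → A) {w p : Word} {d : E}
    (hw : N.act w (N.act p d) = N.act p d) :
    N.hol v (p⁻¹ * w * p) d = N.hol v w (N.act p d) := by
  rw [hol_mul, hol_mul, hol_inv, hw, act_inv_apply_self]
  abel

theorem act_conj {w p : Word} {d : E} (hw : N.act w (N.act p d) = N.act p d) :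
    N.act (p⁻¹ * w * p) d = d := by
  rw [map_mul, map_mul, Equiv.Perm.mul_apply, Equiv.Perm.mul_apply, hw, act_inv_apply_self]

theorem act_zpow_of_mem_loops {w : Word} {d : E} (hw : N.act w d = d) (i : ℤ) :
    N.act (w ^ i) d = d := (N.loops d).zpow_mem hw i

/-- The holonomy along a cycle of `M` (or of its dual, if `R` is `faceRot`). -/
theorem Cycle.hol_word {M : CombMap E} (c : N.Cycle) (R : Word) (hσ : M.act R = N.σ)
    (hα : M.α = N.α) {A : Type*} [AddCommGroup A] (v : Bool → E → A) :
    M.hol v (c.word R) (c.dart 0) =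
      ∑ i, M.hol v (R ^ (c.next i).choose * CombMap.flip) (c.dart i) := by
  have hact : ∀ i, M.act (R ^ (c.next i).choose * CombMap.flip) (c.dart i) = c.dart (i + 1) := by
    intro i
    rw [map_mul, map_zpow, hσ, act_flip, hα, Equiv.Perm.mul_apply, (c.next i).choose_spec]
  have key : ∀ m : ℕ, m ≤ c.n + 1 →
      M.act ((((List.ofFn fun i => R ^ (c.next i).choose * CombMap.flip).take m).reverse).prod)
        (c.dart 0) = c.dart (Fin.ofNat (c.n + 1) m) ∧
      M.hol v ((((List.ofFn fun i => R ^ (c.next i).choose * CombMap.flip).take m).reverse).prod)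
        (c.dart 0) = ∑ j ∈ Finset.range m,
          M.hol v (R ^ (c.next (Fin.ofNat (c.n + 1) j)).choose * CombMap.flip)
            (c.dart (Fin.ofNat (c.n + 1) j)) := by
    intro m
    induction m with
    | zero => simp
    | succ m ih =>
      intro hm
      have hm1 : m < c.n + 1 := hm
      obtain ⟨ih1, ih2⟩ := ih hm1.le
      have e : ((⟨m, hm1⟩ : Fin (c.n + 1))) = (Fin.ofNat (c.n + 1) m) := by
        ext
        simp [Nat.mod_eq_of_lt hm1]
      rw [List.take_add_one, List.getElem?_eq_getElem (by simpa using hm1), List.reverse_append,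
        List.prod_append, map_mul, Equiv.Perm.mul_apply, hol_mul, ih1, ih2,
        Finset.sum_range_succ]
      simp only [Option.toList_some, List.reverse_singleton, List.prod_singleton, List.getElem_ofFn,
        e, hact]
      refine ⟨?_, add_comm _ _⟩
      congr 1
      ext
      simp [Fin.val_add]
  obtain ⟨-, h⟩ := key (c.n + 1) le_rfl
  rw [List.take_of_length_le (by simp)] at h
  rw [Cycle.word, h, Finset.sum_range]
  refine Finset.sum_congr rfl fun i _ => ?_
  simp

end Voltages

theorem eq_of_forall_succ {n : ℕ} {β : Type*} {u : Fin (n + 1) → β} (h : ∀ i, u (i + 1) = u i)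
    (i : Fin (n + 1)) : u i = u 0 := by
  obtain ⟨i, hi⟩ := i
  induction i with
  | zero => rfl
  | succ i ih =>
    have := h ⟨i, by omega⟩
    rw [ih] at this
    rw [← this]
    congr 1
    ext
    simp [Fin.val_add, Nat.mod_eq_of_lt hi]

end CombMap

/-! ### Crossing numbers with a cycle, and the detection of null-homotopy. -/

namespace CombMap

variable {D : Type*} {M : CombMap D}

namespace Cycle

open scoped Classical in
/-- The signed indicator function of the darts of a cycle: it counts the crossings, from left to
right, of a curve with the cycle. -/
noncomputable def chain (c : M.Cycle) (d : D) : ℤ :=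
  (if c.HasDart d then 1 else 0) - if c.HasDart (M.α d) then 1 else 0

variable (c : M.Cycle)

theorem dart_injective : Function.Injective c.dart := fun i j h =>
  c.simple i j (by rw [h])

theorem hasDart_dart (i : Fin (c.n + 1)) : c.HasDart (c.dart i) := ⟨i, rfl⟩

theorem not_hasDart_α {d : D} (h : c.HasDart d) : ¬ c.HasDart (M.α d) := by
  obtain ⟨i, rfl⟩ := h
  rintro ⟨j, hj⟩
  exact c.reduced i j hj.symm

theorem chain_of_hasDart {d : D} (h : c.HasDart d) : c.chain d = 1 := by
  simp [chain, h, c.not_hasDart_α h]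

theorem chain_α (d : D) : c.chain (M.α d) = -c.chain d := by
  have h : c.HasDart (M.α (M.α d)) ↔ c.HasDart d := by rw [M.α_invol]
  unfold chain
  split_ifs <;> first | rfl | tauto

theorem chain_of_hasDart_α {d : D} (h : c.HasDart (M.α d)) : c.chain d = -1 := by
  have := c.chain_of_hasDart h
  rw [chain_α] at this
  omega

theorem chain_of_not_hasEdge {d : D} (h : ¬ c.HasEdge d) : c.chain d = 0 := by
  rw [HasEdge, not_or] at h
  simp [chain, h]

theorem hasDart_iff_chain {d : D} : c.HasDart d ↔ c.chain d = 1 := by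
  refine ⟨c.chain_of_hasDart, fun h => ?_⟩
  by_contra hd
  by_cases hd' : c.HasDart (M.α d)
  · rw [c.chain_of_hasDart_α hd'] at h; omega
  · rw [c.chain_of_not_hasEdge (not_or.2 ⟨hd, hd'⟩)] at h; omega

theorem abs_chain_le (d : D) : |c.chain d| ≤ 1 := by
  unfold chain
  split_ifs <;> simp

theorem chain_eq_sum [DecidableEq D] : c.chain =
    ∑ i, (Pi.single (c.dart i) 1 - Pi.single (M.α (c.dart i)) 1 : D → ℤ) := by
  classical
  have h1 : ∀ d, (∑ i, (Pi.single (c.dart i) 1 : D → ℤ) d) = if c.HasDart d then 1 else 0 := by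
    intro d
    split_ifs with h
    · obtain ⟨i, rfl⟩ := h
      rw [Finset.sum_eq_single i]
      · simp
      · intro j _ hj
        exact Pi.single_eq_of_ne (fun e => hj (c.dart_injective e).symm) _
      · simp
    · refine Finset.sum_eq_zero fun i _ => Pi.single_eq_of_ne (fun e => h ⟨i, e.symm⟩) _
  ext d
  rw [Finset.sum_apply]
  simp only [Pi.sub_apply, Finset.sum_sub_distrib, h1, chain]
  congr 1
  rw [← h1]
  refine Finset.sum_congr rfl fun i _ => ?_
  simp only [Pi.single_apply]
  congr 1
  rw [eq_iff_iff]
  constructor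
  · rintro h; rw [← h, M.α_invol]
  · rintro rfl; rw [M.α_invol]

theorem chain_mem : c.chain ∈ coboundaries M.σ := by
  classical
  rw [chain_eq_sum, Finset.sum_sub_distrib,
    ← Equiv.sum_comp (Equiv.addRight 1) fun i => (Pi.single (c.dart i) 1 : D → ℤ),
    ← Finset.sum_sub_distrib]
  exact sum_mem fun i _ => single_sub_single_mem (c.next i).symm

theorem flat_chain : M.Flat (M.dualVoltage c.chain) := dualVoltage_flat c.chain_α c.chain_mem

/-- The darts of the cycle at the origin of `c.dart (i + 1)`. -/
theorem eq_or_eq_of_sameCycle {i : Fin (c.n + 1)} {e : D}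
    (h : M.σ.SameCycle (c.dart (i + 1)) e) (he : c.HasEdge e) :
    e = c.dart (i + 1) ∨ e = M.α (c.dart i) := by
  rcases he with ⟨j, rfl⟩ | ⟨j, hj⟩
  · left; rw [c.simple _ _ h]
  · right
    have h1 : M.σ.SameCycle e (c.dart (j + 1)) := by
      have := c.next j
      rwa [hj, M.α_invol] at this
    have h2 := c.simple _ _ (h.trans h1)
    rw [add_left_inj] at h2
    rw [h2, hj, M.α_invol]

/-- Around a vertex of the cycle, `t` goes up by one at the outgoing dart, down by one at the
reverse of the incoming dart, and is otherwise constant. Since the increments of `t ^ 2` also sum to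
zero, the values before the two jumps differ by one. -/
theorem potential_next [Finite D] {t : D → ℤ} (ht : ∀ e, c.chain e = t (M.σ e) - t e)
    (i : Fin (c.n + 1)) : t (M.α (c.dart i)) = t (c.dart (i + 1)) + 1 := by
  have h1 := ht (c.dart (i + 1))
  have h2 := ht (M.α (c.dart i))
  rw [c.chain_of_hasDart (c.hasDart_dart _)] at h1
  rw [c.chain_α, c.chain_of_hasDart (c.hasDart_dart _)] at h2
  have h3 := two_point_sum (g := fun e => t e ^ 2) (c.reduced i (i + 1)).symm (c.next i).symm (by
    intro e he h1 h2
    have : c.chain e = 0 := c.chain_of_not_hasEdge fun h => by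
      rcases c.eq_or_eq_of_sameCycle he h with h | h
      exacts [h1 h, h2 h]
    rw [ht, sub_eq_zero] at this
    simp only [this])
  have e1 : t (M.σ (c.dart (i + 1))) = t (c.dart (i + 1)) + 1 := by omega
  have e2 : t (M.σ (M.α (c.dart i))) = t (M.α (c.dart i)) - 1 := by omega
  rw [e1, e2] at h3
  linarith

/-- A cycle does not cross itself. -/
theorem hol_chain_curve [Finite D] : M.hol (M.dualVoltage c.chain) c.curve.word c.curve.base = 0 := by
  obtain ⟨t, ht⟩ := c.chain_mem
  change M.hol _ (c.word CombMap.rot) (c.dart 0) = 0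
  rw [c.hol_word CombMap.rot M.act_rot rfl]
  refine Finset.sum_eq_zero fun i _ => ?_
  rw [hol_mul, hol_dualVoltage_flip, c.chain_of_hasDart (c.hasDart_dart i), act_flip]
  have := M.potential_zpow (M.dualVoltage c.chain) (R := CombMap.rot) (s := fun e => -t (M.σ e))
    (fun d => by
      rw [hol_rot, act_rot]
      simp only [dualVoltage, if_true, ht]
      ring) (c.next i).choose (M.α (c.dart i))
  rw [map_zpow, act_rot, (c.next i).choose_spec] at this
  have h1 := ht (c.dart (i + 1))
  have h2 := ht (M.α (c.dart i))
  rw [c.chain_of_hasDart (c.hasDart_dart _)] at h1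
  rw [c.chain_α, c.chain_of_hasDart (c.hasDart_dart _)] at h2
  have h3 := c.potential_next ht i
  omega

/-- The holonomy of a primal voltage along a cycle. -/
theorem hol_word_primal {A : Type*} [AddCommGroup A] (f : D → A) :
    M.hol (primalVoltage f) (c.word CombMap.rot) (c.dart 0) = ∑ i, f (c.dart i) := by
  rw [c.hol_word CombMap.rot M.act_rot rfl]
  refine Finset.sum_congr rfl fun i _ => ?_
  have := M.potential_zpow (primalVoltage f) (R := CombMap.rot) (s := fun _ => 0)
    (by simp) (c.next i).choose (M.α (c.dart i))
  rw [hol_mul, act_flip, hol_flip]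
  simp only [add_zero] at this
  rw [← this, zero_add, primalVoltage_false]

end Cycle

variable (hM : M.IsToroidal) {Γ : M.Cycle}
include hM

/-- A cycle that bounds a set of faces is contractible. -/
theorem IsToroidal.contractible_of_bounds {S : Set D} (hφ : ∀ d, M.φ d ∈ S ↔ d ∈ S)
    (hα : ∀ d, ¬ Γ.HasEdge d → (M.α d ∈ S ↔ d ∈ S)) (h1 : ∀ i, Γ.dart i ∈ S)
    (h2 : ∀ i, M.α (Γ.dart i) ∉ S) : Γ.curve.Contractible := by
  classical
  have := hM.finite
  have : Fintype D := Fintype.ofFinite D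
  obtain ⟨A, _, f, hf, ⟨t, ht⟩, hnull, -⟩ := hM.exists_abelian_voltage (Γ.dart 0)
  refine (hnull _ _ Γ.curve.closed).1 ?_
  change M.hol _ (Γ.word CombMap.rot) (Γ.dart 0) = 0
  rw [Γ.hol_word_primal]
  let S' : Finset D := Finset.univ.filter (· ∈ S)
  -- The values of `f` sum to zero on every face, and inside `S` the edges off `Γ` cancel in pairs.
  -- What is left is the holonomy along `Γ`, which detects null-homotopy because the fundamental
  -- group is abelian.
  have hS' : ∑ d ∈ S', f d = 0 := by
    have : ∀ d, f d = t (M.φ d) - t d := fun d => by rw [ht]; abel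
    simp only [this, Finset.sum_sub_distrib]
    rw [sub_eq_zero]
    refine Finset.sum_bij (fun e _ => M.φ e) ?_ ?_ ?_ ?_
    · intro e he
      simpa [S', hφ] using he
    · intro a _ b _ hab
      exact M.φ.injective hab
    · intro b hb
      refine ⟨M.φ⁻¹ b, ?_, by simp⟩
      have := hφ (M.φ⁻¹ b)
      rw [← Equiv.Perm.mul_apply, mul_inv_cancel, Equiv.Perm.one_apply] at this
      exact Finset.mem_filter.2 ⟨Finset.mem_univ _, this.1 (by simpa [S'] using hb)⟩
    · intro e _
      rfl
  rw [← Finset.sum_filter_add_sum_filter_not S' Γ.HasDart] at hS'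
  have hS2 : ∑ d ∈ S' with ¬ Γ.HasDart d, f d = 0 := by
    refine Finset.sum_involution (fun d _ => M.α d) ?_ ?_ ?_ ?_
    · intro d _; rw [hf, add_neg_cancel]
    · intro d _ _; exact M.α_ne d
    · intro d hd
      simp only [S', Finset.mem_filter, Finset.mem_univ, true_and] at hd ⊢
      have h3 : ¬ Γ.HasDart (M.α d) := by
        rintro ⟨i, hi⟩
        apply h2 i
        rw [hi, M.α_invol]
        exact hd.1
      exact ⟨(hα d (not_or.2 ⟨hd.2, h3⟩)).2 hd.1, h3⟩
    · intro d _; exact M.α_invol d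
  rw [hS2, add_zero] at hS'
  rw [← hS']
  refine Finset.sum_bij (fun i _ => Γ.dart i) ?_ ?_ ?_ ?_
  · intro i _
    simp [S', h1, Γ.hasDart_dart]
  · intro i _ j _ h
    exact Γ.dart_injective h
  · intro d hd
    simp only [S', Finset.mem_filter, Finset.mem_univ, true_and] at hd
    obtain ⟨i, rfl⟩ := hd.2
    exact ⟨i, Finset.mem_univ _, rfl⟩
  · intro i _
    rfl

/-- Cutting a toroidal map along a non-contractible cycle does not disconnect it. -/
theorem IsToroidal.cut_connected (hΓ : ¬ Γ.curve.Contractible) {S : Set D}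
    (hφ : ∀ d, M.φ d ∈ S ↔ d ∈ S) (hα : ∀ d, ¬ Γ.HasEdge d → (M.α d ∈ S ↔ d ∈ S)) {x : D}
    (hx : x ∈ S) (y : D) : y ∈ S := by
  classical
  have := hM.finite
  let s : D → ℤ := fun d => if d ∈ S then 1 else 0
  -- The jump of the indicator of `S` across an edge. It is carried by `Γ` and satisfies Kirchhoff's
  -- law, so it is constant along `Γ`. The value `0` makes `S` everything; the values `1` and `-1`
  -- make `Γ` bound `S` or its complement.
  let z : D → ℤ := fun d => s d - s (M.α d)
  have hz : ∀ e, z (M.σ e) = s (M.σ e) - s e := by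
    intro e
    simp only [z, s]
    rw [← hφ (M.α (M.σ e)), φ_α_σ]
  have hz0 : ∀ d, ¬ Γ.HasEdge d → z d = 0 := by
    intro d hd
    simp only [z, s, hα d hd, sub_self]
  have hzα : ∀ d, z (M.α d) = -z d := fun d => by
    simp only [z, M.α_invol]; ring
  have hstep : ∀ i, z (Γ.dart (i + 1)) = z (Γ.dart i) := by
    intro i
    have h1 : M.σ (M.σ⁻¹ (Γ.dart (i + 1))) = Γ.dart (i + 1) := by simp
    have h2 : M.σ (M.σ⁻¹ (M.α (Γ.dart i))) = M.α (Γ.dart i) := by simp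
    have hc1 : M.σ.SameCycle (M.σ⁻¹ (Γ.dart (i + 1))) (Γ.dart (i + 1)) := ⟨1, by simp⟩
    have hc2 : M.σ.SameCycle (M.α (Γ.dart i)) (M.σ⁻¹ (M.α (Γ.dart i))) := ⟨-1, by simp⟩
    have := two_point_sum (π := M.σ) (x := M.σ⁻¹ (Γ.dart (i + 1))) (y := M.σ⁻¹ (M.α (Γ.dart i)))
      (g := s) (fun e => (Γ.reduced i (i + 1)).symm (M.σ⁻¹.injective e)) ((hc1.trans (Γ.next i).symm).trans hc2) (by
        intro e he h3 h4
        have : z (M.σ e) = 0 := hz0 _ fun h => by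
          rcases Γ.eq_or_eq_of_sameCycle (hc1.symm.trans (he.trans ⟨1, by simp⟩)) h with h | h
          · exact h3 (by rw [← h]; simp)
          · exact h4 (by rw [← h]; simp)
        rw [hz] at this
        omega)
    rw [← hz, ← hz, h1, h2, hzα] at this
    omega
  have hconst := eq_of_forall_succ (u := fun i => z (Γ.dart i)) hstep
  have hval : z (Γ.dart 0) = 0 ∨ z (Γ.dart 0) = 1 ∨ z (Γ.dart 0) = -1 := by
    simp only [z, s]
    split_ifs <;> simp
  rcases hval with h | h | h
  · have hα' : ∀ d, M.α d ∈ S ↔ d ∈ S := by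
      intro d
      have h0 : z d = 0 := by
        by_cases hd : Γ.HasEdge d
        · rcases hd with ⟨i, rfl⟩ | ⟨i, hi⟩
          · rw [hconst, h]
          · have := hzα d
            rw [← hi, hconst, h] at this
            omega
        · exact hz0 d hd
      simp only [z, s] at h0
      by_cases h1 : d ∈ S <;> by_cases h2 : M.α d ∈ S <;> simp_all
    have hσ' : ∀ d ∈ S, M.σ d ∈ S := fun d hd => by
      rw [← hα', ← hφ, φ_α_σ]; exact hd
    exact hM.mem_of_closed hσ' (fun d hd => (hα' d).2 hd) hx y
  · refine absurd (hM.contractible_of_bounds (Γ := Γ) hφ hα (fun i => ?_) (fun i => ?_)) hΓ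
    · have := hconst i
      rw [h] at this
      simp only [z, s] at this
      split_ifs at this with h1 h2 <;> first | exact h1 | omega
    · have := hconst i
      rw [h] at this
      simp only [z, s] at this
      split_ifs at this with h1 h2 <;> first | exact h2 | omega
  · refine absurd (hM.contractible_of_bounds (Γ := Γ) (S := Sᶜ) (fun d => not_congr (hφ d))
      (fun d hd => not_congr (hα d hd)) (fun i => ?_) (fun i => ?_)) hΓ
    · have := hconst i
      rw [h] at this
      simp only [z, s] at this
      split_ifs at this with h1 h2 <;> first | exact h1 | omega
    · have := hconst i
      rw [h] at this
      simp only [z, s] at this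
      intro h2
      rw [if_neg h2] at this
      split_ifs at this <;> omega

/-- A non-contractible cycle `Γ` has a dual closed curve that crosses it once, and an integer cocycle
that takes the value `1` on it. -/
theorem IsToroidal.exists_crossing (hΓ : ¬ Γ.curve.Contractible) :
    ∃ (ω : Word) (F : D → ℤ), M.act ω (Γ.dart 0) = Γ.dart 0 ∧
      M.hol (M.dualVoltage Γ.chain) ω (Γ.dart 0) = 1 ∧ (∀ d, F (M.α d) = -F d) ∧
      F ∈ coboundaries M.φ ∧ M.hol (primalVoltage F) Γ.curve.word Γ.curve.base = 1 := by
  classical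
  have := hM.finite
  -- The darts reached from the right of `Γ.dart 0` without crossing `Γ`, together with the signed
  -- count `F` of the edges crossed on the way. By `cut_connected` the left of `Γ.dart 0` is reached
  -- too, and crossing `Γ.dart 0` closes the curve.
  let S : Set D := {y | ∃ (w : Word) (F : D → ℤ), M.act w (M.α (Γ.dart 0)) = y ∧
    M.hol (M.dualVoltage Γ.chain) w (M.α (Γ.dart 0)) = 0 ∧ (∀ d, F (M.α d) = -F d) ∧
    (∀ d, Γ.HasDart d → F d = 0) ∧
    F + Pi.single y 1 - Pi.single (M.α (Γ.dart 0)) 1 ∈ coboundaries M.φ}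
  have hSφ : ∀ d ∈ S, M.φ d ∈ S := by
    rintro _ ⟨w, F, rfl, h1, h2, h3, h4⟩
    refine ⟨faceRot * w, F, ?_, ?_, h2, h3, ?_⟩
    · rw [map_mul, Equiv.Perm.mul_apply, act_faceRot]
    · rw [hol_mul, hol_dualVoltage_faceRot Γ.chain_α, h1, zero_add]
    · have := sub_mem h4 (single_sub_single_apply_mem M.φ (M.act w (M.α (Γ.dart 0))))
      convert this using 1
      abel
  have hSα : ∀ d ∈ S, ¬ Γ.HasEdge d → M.α d ∈ S := by
    rintro y ⟨w, F, hw, h1, h2, h3, h4⟩ hy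
    refine ⟨CombMap.flip * w, F + Pi.single y 1 - Pi.single (M.α y) 1, ?_, ?_, ?_, ?_, ?_⟩
    · rw [map_mul, Equiv.Perm.mul_apply, act_flip, hw]
    · rw [hol_mul, hol_dualVoltage_flip, h1, hw, Γ.chain_of_not_hasEdge hy, zero_add]
    · intro d
      have e1 : (Pi.single y (1 : ℤ) : D → ℤ) (M.α d) = (Pi.single (M.α y) (1 : ℤ) : D → ℤ) d := by
        simp only [Pi.single_apply]
        congr 1
        rw [eq_iff_iff]
        exact ⟨fun h => by rw [← h, M.α_invol], fun h => by rw [h, M.α_invol]⟩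
      have e2 : (Pi.single (M.α y) (1 : ℤ) : D → ℤ) (M.α d) = (Pi.single y (1 : ℤ) : D → ℤ) d := by
        simp only [Pi.single_apply, M.α.injective.eq_iff]
      simp only [Pi.add_apply, Pi.sub_apply, e1, e2, h2]
      ring
    · intro d hd
      have e1 : d ≠ y := fun h => hy (Or.inl (h ▸ hd))
      have e2 : d ≠ M.α y := fun h => hy (Or.inr (h ▸ hd))
      simp [h3 d hd, Pi.single_eq_of_ne e1, Pi.single_eq_of_ne e2]
    · convert h4 using 1
      abel
  have hφ : ∀ d, M.φ d ∈ S ↔ d ∈ S := fun d =>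
    ⟨fun h => mem_of_sameCycle (ψ := M.φ) (P := (· ∈ S)) hSφ ⟨-1, by simp⟩ h, hSφ d⟩
  have hα : ∀ d, ¬ Γ.HasEdge d → (M.α d ∈ S ↔ d ∈ S) := fun d hd =>
    ⟨fun h => by
      have := hSα _ h (by rw [Cycle.HasEdge, M.α_invol, or_comm]; exact hd)
      rwa [M.α_invol] at this, fun h => hSα d h hd⟩
  have h0 : M.α (Γ.dart 0) ∈ S := ⟨1, 0, by simp, by simp, by simp, by simp, by simp [zero_mem]⟩
  obtain ⟨w, F, hw, h1, h2, h3, h4⟩ := hM.cut_connected hΓ hφ hα h0 (Γ.dart 0)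
  have hd0 := Γ.hasDart_dart 0
  refine ⟨w * CombMap.flip, F + Pi.single (Γ.dart 0) 1 - Pi.single (M.α (Γ.dart 0)) 1, ?_, ?_, ?_,
    h4, ?_⟩
  · rw [map_mul, Equiv.Perm.mul_apply, act_flip, hw]
  · rw [hol_mul, act_flip, h1, hol_dualVoltage_flip, Γ.chain_of_hasDart hd0, zero_add]
  · intro d
    have e1 : (Pi.single (Γ.dart 0) (1 : ℤ) : D → ℤ) (M.α d) =
        (Pi.single (M.α (Γ.dart 0)) (1 : ℤ) : D → ℤ) d := by
      simp only [Pi.single_apply]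
      congr 1
      rw [eq_iff_iff]
      exact ⟨fun h => by rw [← h, M.α_invol], fun h => by rw [h, M.α_invol]⟩
    have e2 : (Pi.single (M.α (Γ.dart 0)) (1 : ℤ) : D → ℤ) (M.α d) =
        (Pi.single (Γ.dart 0) (1 : ℤ) : D → ℤ) d := by
      simp only [Pi.single_apply, M.α.injective.eq_iff]
    simp only [Pi.add_apply, Pi.sub_apply, e1, e2, h2]
    ring
  · change M.hol _ (Γ.word CombMap.rot) (Γ.dart 0) = 1
    rw [Γ.hol_word_primal, Finset.sum_eq_single 0]
    · simp only [Pi.add_apply, Pi.sub_apply, h3 _ hd0, Pi.single_eq_same]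
      rw [Pi.single_eq_of_ne (Γ.reduced 0 0).symm]
      norm_num
    · intro i _ hi
      simp only [Pi.add_apply, Pi.sub_apply, h3 _ (Γ.hasDart_dart i)]
      rw [Pi.single_eq_of_ne (fun e => hi (Γ.dart_injective e)),
        Pi.single_eq_of_ne (Γ.reduced 0 i).symm]
      norm_num
    · simp

/-- The crossing number with `Γ` and the value of the cocycle `F` detect contractibility. -/
theorem IsToroidal.mem_nullLoops_iff {ω : Word} {F : D → ℤ}
    (hω : M.act ω (Γ.dart 0) = Γ.dart 0) (hω1 : M.hol (M.dualVoltage Γ.chain) ω (Γ.dart 0) = 1)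
    (hFα : ∀ d, F (M.α d) = -F d) (hF : F ∈ coboundaries M.φ)
    (hFΓ : M.hol (primalVoltage F) Γ.curve.word Γ.curve.base = 1) {d : D} {w : Word}
    (hw : M.act w d = d) : w ∈ M.nullLoops d ↔
      M.hol (M.dualVoltage Γ.chain) w d = 0 ∧ M.hol (primalVoltage F) w d = 0 := by
  have := hM.finite
  set v₁ := M.dualVoltage Γ.chain with hv₁
  set v₂ : Bool → D → ℤ := primalVoltage F with hv₂
  have f1 : M.Flat v₁ := Γ.flat_chain
  have f2 : M.Flat v₂ := primalVoltage_flat_of_mem hFα hF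
  refine ⟨fun h => ⟨f1.hol_eq_zero h, f2.hol_eq_zero h⟩, ?_⟩
  rintro ⟨z1, z2⟩
  obtain ⟨A, _, f, -, -, hnull, wx, wy, hx, hy, hgen⟩ := hM.exists_abelian_voltage d
  set X := M.hol (primalVoltage f) wx d
  set Y := M.hol (primalVoltage f) wy d
  -- A flat voltage factors through the fundamental group, so its holonomy is linear in the
  -- coordinates with respect to the generators.
  have key : ∀ u, M.act u d = d → ∀ i j : ℤ, M.hol (primalVoltage f) u d = i • X + j • Y →
      ∀ v : Bool → D → ℤ, M.Flat v → M.hol v u d = i * M.hol v wx d + j * M.hol v wy d := by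
    intro u hu i j h v hv
    have c1 : M.act (wx ^ i * wy ^ j) d = d := by
      rw [map_mul, Equiv.Perm.mul_apply, act_zpow_of_mem_loops hy, act_zpow_of_mem_loops hx]
    have c2 : M.act (wx ^ i * wy ^ j)⁻¹ d = d := (M.loops d).inv_mem c1
    have c3 : ∀ {B : Type} [AddCommGroup B] (v : Bool → D → B),
        M.hol v (u * (wx ^ i * wy ^ j)⁻¹) d =
          M.hol v u d - (i • M.hol v wx d + j • M.hol v wy d) := by
      intro B _ v
      rw [hol_mul, hol_inv, c2, hol_mul, act_zpow_of_mem_loops hy, hol_zpow_of_mem_loops v hx,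
        hol_zpow_of_mem_loops v hy]
      abel
    have c4 : M.act (u * (wx ^ i * wy ^ j)⁻¹) d = d := by
      rw [map_mul, Equiv.Perm.mul_apply, c2, hu]
    have c5 := (hnull d _ c4).1 (by rw [c3, h, sub_self])
    have c6 := hv.hol_eq_zero c5
    rw [c3, sub_eq_zero] at c6
    simpa using c6
  obtain ⟨p, hp⟩ := hM.connected d (Γ.dart 0)
  have hγ : M.act Γ.curve.word (M.act p d) = M.act p d := by rw [hp]; exact Γ.curve.closed
  have hω' : M.act ω (M.act p d) = M.act p d := by rw [hp, hω]
  obtain ⟨i, j, hij⟩ := hgen (M.hol (primalVoltage f) w d)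
  obtain ⟨i₁, j₁, h1⟩ := hgen (M.hol (primalVoltage f) (p⁻¹ * Γ.curve.word * p) d)
  obtain ⟨i₂, j₂, h2⟩ := hgen (M.hol (primalVoltage f) (p⁻¹ * ω * p) d)
  have a1 := key _ hw i j hij v₁ f1
  have a2 := key _ hw i j hij v₂ f2
  have b1 := key _ (act_conj hγ) _ _ h1 v₁ f1
  have b2 := key _ (act_conj hγ) _ _ h1 v₂ f2
  have c1 := key _ (act_conj hω') _ _ h2 v₁ f1
  rw [z1] at a1
  rw [z2] at a2
  rw [hol_conj _ hγ, hp] at b1 b2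
  rw [hol_conj _ hω', hp, hω1] at c1
  rw [show M.hol v₁ Γ.curve.word (Γ.dart 0) = 0 from Γ.hol_chain_curve] at b1
  rw [show M.hol v₂ Γ.curve.word (Γ.dart 0) = 1 from hFΓ] at b2
  set a := M.hol v₁ wx d
  set b := M.hol v₁ wy d
  set c := M.hol v₂ wx d
  set e := M.hol v₂ wy d
  -- `Γ` has the values `0, 1` and `ω` has first value `1`. The determinant of these two columns is
  -- the product of the integer matrix of coordinates and that of the two voltages on the
  -- generators, so the latter is nonsingular.
  have det : (i₁ * j₂ - i₂ * j₁) * (a * e - b * c) = -1 := by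
    have : (i₁ * j₂ - i₂ * j₁) * (a * e - b * c) =
      (i₁ * a + j₁ * b) * (i₂ * c + j₂ * e) - (i₁ * c + j₁ * e) * (i₂ * a + j₂ * b) := by ring
    rw [this, ← b1, ← b2, ← c1]
    ring
  have hdet : a * e - b * c ≠ 0 := by
    intro h
    rw [h] at det
    omega
  have hi : i = 0 := by
    have : i * (a * e - b * c) = 0 := by linear_combination (-e) * a1 + b * a2
    exact (mul_eq_zero.1 this).resolve_right hdet
  have hj : j = 0 := by
    have : j * (a * e - b * c) = 0 := by linear_combination c * a1 - a * a2
    exact (mul_eq_zero.1 this).resolve_right hdet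
  refine (hnull d w hw).1 ?_
  rw [hij, hi, hj]
  simp

end CombMap

namespace CombMap

/-! ### The infinite annulus and its planarity. -/

section Cover

variable {D : Type*} {M : CombMap D}

/-- The cyclic cover of a map given by the crossing numbers `z`: crossing `d` from the face on the
left to the face on the right leads from level `n` to level `z d + n`. -/
def cover (M : CombMap D) (z : D → ℤ) (hz : ∀ d, z (M.α d) = -z d) : CombMap (D × ℤ) where
  σ := stepPerm M.σ fun d => -z (M.σ d)
  α := stepPerm M.α z
  α_invol x := by simp [M.α_invol, hz]
  α_ne x h := M.α_ne x.1 (congrArg Prod.fst h)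

variable {z : D → ℤ} (hz : ∀ d, z (M.α d) = -z d)

theorem cover_act (w : Word) (d : D) (n : ℤ) : (M.cover z hz).act w (d, n) =
    (M.act w d, M.hol (M.dualVoltage z) w d + n) := by
  rw [← liftAct_apply]
  have : (M.cover z hz).act = M.liftAct (M.dualVoltage z) := by
    refine FreeGroup.ext_hom _ _ fun b => ?_
    cases b
    · simp [act, liftAct, cover]; rfl
    · simp [act, liftAct, cover]; rfl
  rw [this]

@[simp] theorem cover_φ (x : D × ℤ) : (M.cover z hz).φ x = (M.φ x.1, x.2) := by
  obtain ⟨d, n⟩ := x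
  rw [← act_faceRot, cover_act, hol_dualVoltage_faceRot hz, zero_add, act_faceRot]

theorem cover_φ_zpow (k : ℤ) (x : D × ℤ) :
    ((M.cover z hz).φ ^ k) x = ((M.φ ^ k) x.1, x.2) := by
  obtain ⟨d, n⟩ := x
  have h : M.hol (M.dualVoltage z) (faceRot ^ k) d = 0 := by
    have := M.potential_zpow (M.dualVoltage z) (R := faceRot) (s := fun _ => 0)
      (fun d => by rw [hol_dualVoltage_faceRot hz, add_zero]) k d
    rw [add_zero] at this
    exact this.symm
  rw [← act_faceRot, ← act_faceRot, ← map_zpow, ← map_zpow, cover_act, h, zero_add]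

theorem cover_σ_zpow (k : ℤ) (x : D × ℤ) : ((M.cover z hz).σ ^ k) x =
    ((M.σ ^ k) x.1, M.hol (M.dualVoltage z) (CombMap.rot ^ k) x.1 + x.2) := by
  obtain ⟨d, n⟩ := x
  rw [← act_rot, ← act_rot, ← map_zpow, ← map_zpow, cover_act]

theorem cover_hol {A : Type*} [AddGroup A] (v : Bool → D → A) (w : Word) (d : D) (n : ℤ) :
    (M.cover z hz).hol (fun b x => v b x.1) w (d, n) = M.hol v w d := by
  refine hol_unique (h := fun w (x : D × ℤ) => M.hol v w x.1) ?_ ?_ w (d, n)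
  · rintro x y ⟨d, n⟩
    rw [hol_mul, cover_act]
  · intro b x
    cases b
    · exact M.hol_flip v x.1
    · exact M.hol_rot v x.1

/-- Flatness ensures that the turns in the generators still close up after lifting. -/
theorem mem_nullLoops_cover (hv : M.Flat (M.dualVoltage z)) {w : Word} {d : D}
    (h : w ∈ M.nullLoops d) (n : ℤ) : w ∈ (M.cover z hz).nullLoops (d, n) := by
  induction h using Subgroup.closure_induction with
  | mem x hx =>
    obtain ⟨w, r, hr, h, rfl⟩ := hx
    refine Subgroup.subset_closure ⟨w, r, hr, ?_, rfl⟩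
    rw [cover_act, cover_act, hv.hol_local hr h, h, zero_add]
  | one => exact one_mem _
  | mul x y _ _ hx hy => exact mul_mem hx hy
  | inv x _ hx => exact inv_mem hx

end Cover

/-- A dual closed curve and a cocycle that cross a cycle once. -/
structure Crossing {D : Type*} {M : CombMap D} (Γ : M.Cycle) where
  ω : Word
  F : D → ℤ
  act_ω : M.act ω (Γ.dart 0) = Γ.dart 0
  hol_ω : M.hol (M.dualVoltage Γ.chain) ω (Γ.dart 0) = 1
  F_α : ∀ d, F (M.α d) = -F d
  F_mem : F ∈ coboundaries M.φ
  hol_F : M.hol (primalVoltage F) Γ.curve.word Γ.curve.base = 1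

/-- A locally finite connected map on which finite cycles separate and finite cocycles are
coboundaries. -/
structure Planar {E : Type*} (N : CombMap E) : Prop where
  finσ : IsOfFinOrder N.σ
  finφ : IsOfFinOrder N.φ
  connected : ∀ P : Set E, (∀ e ∈ P, N.φ e ∈ P) → (∀ e ∈ P, N.α e ∈ P) → ∀ x ∈ P, ∀ y, y ∈ P
  jordan : ∀ z : E → ℤ, (∀ e, z (N.α e) = -z e) → z ∈ coboundaries N.σ → {e | z e ≠ 0}.Finite →
    ∃ h : E → ℤ, (∀ e, h (N.φ e) = h e) ∧ ∀ e, z e = h (N.α e) - h e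
  cojordan : ∀ z : E → ℤ, (∀ e, z (N.α e) = -z e) → z ∈ coboundaries N.φ → {e | z e ≠ 0}.Finite →
    ∃ h : E → ℤ, (∀ e, h (N.σ e) = h e) ∧ ∀ e, z e = h (N.α e) - h e

section Annulus

variable {D : Type*} {M : CombMap D}

/-- The infinite annulus obtained by unrolling the torus along the curves that do not cross `Γ`. -/
noncomputable def annulus (Γ : M.Cycle) : CombMap (D × ℤ) := M.cover Γ.chain Γ.chain_α

variable (hM : M.IsToroidal) {Γ : M.Cycle} (C : Crossing Γ)
include hM C

/-- The loop `ω` crosses `Γ` once, so its powers reach all levels. -/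
theorem annulus_connected (e e' : D × ℤ) : ∃ w, (annulus Γ).act w e = e' := by
  obtain ⟨d, n⟩ := e
  obtain ⟨d', n'⟩ := e'
  obtain ⟨p, hp⟩ := hM.connected d (Γ.dart 0)
  obtain ⟨q, hq⟩ := hM.connected (Γ.dart 0) d'
  let v := M.dualVoltage Γ.chain
  let k := n' - n - M.hol v p d - M.hol v q (Γ.dart 0)
  refine ⟨q * C.ω ^ k * p, ?_⟩
  have h1 := act_zpow_of_mem_loops C.act_ω k
  rw [annulus, cover_act, map_mul, map_mul, Equiv.Perm.mul_apply, Equiv.Perm.mul_apply, hp, h1, hq,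
    hol_mul, hol_mul, hp, h1, hol_zpow_of_mem_loops _ C.act_ω, C.hol_ω]
  simp only [k, v, smul_eq_mul, Prod.mk.injEq, true_and]
  ring

theorem annulus_mem_nullLoops_iff {w : Word} {d : D} (hw : M.act w d = d) : w ∈ M.nullLoops d ↔
    M.hol (M.dualVoltage Γ.chain) w d = 0 ∧ M.hol (primalVoltage C.F) w d = 0 :=
  hM.mem_nullLoops_iff C.act_ω C.hol_ω C.F_α C.F_mem C.hol_F hw

-- A fixed word changes the level by a bounded amount, so from a high enough start it never meets
-- the finite support of `v`.
omit C in
theorem exists_hol_eq_zero {v : Bool → D × ℤ → ℤ} (hfin : ∀ b, {e | v b e ≠ 0}.Finite) (w : Word) :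
    ∃ L : ℤ, ∀ n, L ≤ n → ∀ d, (annulus Γ).hol v w (d, n) = 0 := by
  have := hM.finite
  have hlevel : ∀ (u : Word) (L : ℤ), ∃ L' : ℤ, ∀ n, L' ≤ n → ∀ d,
      L ≤ ((annulus Γ).act u (d, n)).2 := by
    intro u L
    obtain ⟨B, hB⟩ := (Set.finite_range fun d => -M.hol (M.dualVoltage Γ.chain) u d).bddAbove
    refine ⟨L + B, fun n hn d => ?_⟩
    have := hB ⟨d, rfl⟩
    rw [annulus, cover_act]
    simp only at this ⊢
    linarith
  have hgen : ∀ b, ∃ L : ℤ, ∀ n, L ≤ n → ∀ d, (annulus Γ).hol v (FreeGroup.of b) (d, n) = 0 := by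
    intro b
    obtain ⟨B, hB⟩ := ((hfin b).image Prod.snd).bddAbove
    refine ⟨B + 1, fun n hn d => ?_⟩
    have h1 : (annulus Γ).hol v (FreeGroup.of b) (d, n) = v b (d, n) := by
      cases b
      · exact (annulus Γ).hol_flip v _
      · exact (annulus Γ).hol_rot v _
    rw [h1]
    by_contra h
    have := hB ⟨(d, n), h, rfl⟩
    simp only at this
    linarith
  induction w using FreeGroup.induction_on with
  | C1 => exact ⟨0, by simp⟩
  | of b => exact hgen b
  | inv_of b _ =>
    obtain ⟨L, hL⟩ := hgen b
    obtain ⟨L', hL'⟩ := hlevel (FreeGroup.of b)⁻¹ L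
    refine ⟨L', fun n hn d => ?_⟩
    rw [hol_inv, neg_eq_zero]
    exact hL _ (hL' n hn d) _
  | mul x y hx hy =>
    obtain ⟨L₁, h₁⟩ := hx
    obtain ⟨L₂, h₂⟩ := hy
    obtain ⟨L', hL'⟩ := hlevel y L₁
    refine ⟨max L' L₂, fun n hn d => ?_⟩
    rw [hol_mul, h₂ n ((le_max_right _ _).trans hn), add_zero]
    exact h₁ _ (hL' n ((le_max_left _ _).trans hn) d) _

/-- A finite flat voltage on the annulus has a potential. -/
theorem annulus_exists_potential {v : Bool → D × ℤ → ℤ} (hv : (annulus Γ).Flat v)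
    (hfin : ∀ b, {e | v b e ≠ 0}.Finite) :
    ∃ q : D × ℤ → ℤ, ∀ w e, q ((annulus Γ).act w e) = (annulus Γ).hol v w e + q e := by
  obtain ⟨L, hL⟩ := exists_hol_eq_zero hM (Γ := Γ) hfin Γ.curve.word
  let e₀ : D × ℤ := (Γ.dart 0, L)
  have hγ : (annulus Γ).act Γ.curve.word e₀ = e₀ := by
    rw [annulus, cover_act]
    have := hM.finite
    have h1 := Γ.hol_chain_curve
    have h2 := Γ.curve.closed
    change M.hol _ _ (Γ.dart 0) = 0 at h1
    change M.act _ (Γ.dart 0) = Γ.dart 0 at h2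
    rw [h1, h2, zero_add]
  have hγ1 : M.act Γ.curve.word (Γ.dart 0) = Γ.dart 0 := Γ.curve.closed
  have hclosed : ∀ x, (annulus Γ).act x e₀ = e₀ → (annulus Γ).hol v x e₀ = 0 := by
    intro x hx
    rw [annulus, cover_act, Prod.mk.injEq, add_eq_right] at hx
    obtain ⟨hx1, hx2⟩ := hx
    let m := M.hol (primalVoltage C.F) x (Γ.dart 0)
    have hm := act_zpow_of_mem_loops hγ1 (-m)
    -- A loop with crossing number `0` is homotopic in the torus to a power of `Γ`, and this
    -- homotopy lifts. The lift of `Γ` at level `L` sees nothing of `v`, so the loop has no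
    -- holonomy.
    have hnull : x * Γ.curve.word ^ (-m) ∈ M.nullLoops (Γ.dart 0) := by
      have := hM.finite
      rw [annulus_mem_nullLoops_iff hM C (by rw [map_mul, Equiv.Perm.mul_apply, hm, hx1]),
        hol_mul, hol_mul, hm, hx2, hol_zpow_of_mem_loops _ hγ1, hol_zpow_of_mem_loops _ hγ1]
      have h1 := Γ.hol_chain_curve
      have h2 := C.hol_F
      change M.hol _ _ (Γ.dart 0) = 0 at h1
      change M.hol _ _ (Γ.dart 0) = 1 at h2
      rw [h1, h2]
      simp [m]
    have h3 := hv.hol_eq_zero (mem_nullLoops_cover Γ.chain_α Γ.flat_chain hnull L)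
    have h4 := act_zpow_of_mem_loops hγ (-m)
    change (annulus Γ).hol v _ e₀ = 0 at h3
    rw [hol_mul, h4, hol_zpow_of_mem_loops _ hγ, hL L le_rfl, smul_zero, add_zero] at h3
    exact h3
  choose p hp using annulus_connected hM C e₀
  refine ⟨fun e => (annulus Γ).hol v (p e) e₀, fun w e => ?_⟩
  have h1 : (annulus Γ).act (p ((annulus Γ).act w e))⁻¹ ((annulus Γ).act w e) = e₀ := by
    rw [map_inv, Equiv.Perm.inv_eq_iff_eq, hp]
  have h2 := hclosed ((p ((annulus Γ).act w e))⁻¹ * (w * p e)) (by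
    rw [map_mul, map_mul, Equiv.Perm.mul_apply, Equiv.Perm.mul_apply, hp, h1])
  rw [hol_mul, hol_mul, hol_inv, map_mul, Equiv.Perm.mul_apply, hp, h1] at h2
  simp only
  linarith

/-- A finite flat voltage has a potential: the dual voltage of a closed chain gives `jordan`, the
primal voltage of a cocycle gives `cojordan`. Finiteness matters, since the lift of the cocycle
`C.F` has holonomy `1` along the lifts of `Γ`. -/
theorem annulus_planar : (annulus Γ).Planar := by
  have := hM.finite
  have : Fintype D := Fintype.ofFinite D
  have hσ : IsOfFinOrder M.σ := isOfFinOrder_of_finite _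
  have hφ : IsOfFinOrder M.φ := isOfFinOrder_of_finite _
  have hσ' : IsOfFinOrder (annulus Γ).σ := by
    obtain ⟨m, hm, h⟩ := isOfFinOrder_iff_pow_eq_one.1 hσ
    refine isOfFinOrder_iff_pow_eq_one.2 ⟨m, hm, ?_⟩
    ext1 x
    have h1 : (M.σ ^ (m : ℤ)) x.1 = x.1 := by rw [zpow_natCast, h, Equiv.Perm.one_apply]
    rw [← zpow_natCast, annulus, cover_σ_zpow, h1, Γ.flat_chain.hol_local (Or.inl ⟨m, rfl⟩)
      (by rw [map_zpow, act_rot, h1]), zero_add, Equiv.Perm.one_apply]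
  have hφ' : IsOfFinOrder (annulus Γ).φ := by
    obtain ⟨m, hm, h⟩ := isOfFinOrder_iff_pow_eq_one.1 hφ
    refine isOfFinOrder_iff_pow_eq_one.2 ⟨m, hm, ?_⟩
    ext1 x
    rw [← zpow_natCast, annulus, cover_φ_zpow, zpow_natCast, h, Equiv.Perm.one_apply,
      Equiv.Perm.one_apply]
  refine ⟨hσ', hφ', ?_, ?_, ?_⟩
  · intro P hφP hαP x hx y
    obtain ⟨w, rfl⟩ := annulus_connected hM C x y
    have hφi : ∀ e ∈ P, (annulus Γ).φ⁻¹ e ∈ P := by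
      intro e he
      obtain ⟨m, hm, h⟩ := isOfFinOrder_iff_pow_eq_one.1 hφ'
      obtain ⟨k, rfl⟩ : ∃ k, m = k + 1 := ⟨m - 1, by omega⟩
      have h1 : (annulus Γ).φ⁻¹ = (annulus Γ).φ ^ k := by
        rw [inv_eq_iff_mul_eq_one, ← pow_succ', h]
      rw [h1]
      clear h h1 hm
      induction k with
      | zero => exact he
      | succ k ih => rw [pow_succ', Equiv.Perm.mul_apply]; exact hφP _ ih
    have hαi : ∀ e ∈ P, (annulus Γ).α⁻¹ e ∈ P := fun e he => by
      have : (annulus Γ).α⁻¹ e = (annulus Γ).α e := by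
        rw [Equiv.Perm.inv_eq_iff_eq, (annulus Γ).α_invol]
      rw [this]; exact hαP e he
    have hσP : ∀ e ∈ P, (annulus Γ).σ e ∈ P := fun e he => by
      have h1 := hαP _ (hφi e he)
      rwa [← (annulus Γ).σ_φ, ← Equiv.Perm.mul_apply (annulus Γ).φ, mul_inv_cancel,
        Equiv.Perm.one_apply] at h1
    have hσi : ∀ e ∈ P, (annulus Γ).σ⁻¹ e ∈ P := fun e he => by
      have h1 := hφP _ (hαP e he)
      rwa [φ_eq, (annulus Γ).α_invol] at h1
    induction w using FreeGroup.induction_on generalizing x with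
    | C1 => simpa
    | of b => cases b <;> simp [act, hσP _ hx, hαP _ hx]
    | inv_of b _ =>
      cases b
      · simpa [act] using hαi _ hx
      · simpa [act] using hσi _ hx
    | mul u v hu hv =>
      rw [map_mul, Equiv.Perm.mul_apply]
      exact hu _ (hv _ hx)
  · intro z hz hz' hfin
    obtain ⟨h, hh⟩ := annulus_exists_potential hM C (dualVoltage_flat hz hz') (by
      intro b
      cases b
      · exact hfin
      · refine (hfin.preimage (annulus Γ).σ.injective.injOn).subset fun e he => ?_
        simpa [dualVoltage] using he)
    refine ⟨h, fun e => ?_, fun e => ?_⟩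
    · rw [← act_faceRot, hh, hol_dualVoltage_faceRot hz, zero_add]
    · have := hh CombMap.flip e
      rw [act_flip, hol_dualVoltage_flip] at this
      omega
  · intro z hz hz' hfin
    obtain ⟨h, hh⟩ := annulus_exists_potential hM C (primalVoltage_flat_of_mem hz hz') (by
      intro b
      cases b
      · exact hfin
      · simp)
    refine ⟨h, fun e => ?_, fun e => ?_⟩
    · rw [← act_rot, hh, hol_rot, primalVoltage_true, zero_add]
    · have := hh CombMap.flip e
      rw [act_flip, hol_flip, primalVoltage_false] at this
      omega

end Annulus

end CombMap

namespace CombMap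

theorem mem_of_sameCycle_of_isOfFinOrder {E : Type*} {ψ : Equiv.Perm E} (hψ : IsOfFinOrder ψ)
    {P : E → Prop} (h : ∀ c, P c → P (ψ c)) {x y : E} (hxy : ψ.SameCycle x y) (hx : P x) : P y := by
  obtain ⟨k, rfl⟩ := hxy
  obtain ⟨m, hm⟩ := hψ.mem_powers_iff_mem_zpowers.2 ⟨k, rfl⟩
  simp only at hm
  rw [← hm]
  clear hm
  induction m with
  | zero => exact hx
  | succ m ih => rw [pow_succ', Equiv.Perm.mul_apply]; exact h _ ih

/-! ### Regions as sets of darts closed under `φ`, strips, and tight strips. -/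

section Region

variable {E : Type*} (N : CombMap E)

/-- The set `S` is saturated for the adjacency of faces inside the region `U`. -/
def LocallyClosed (U S : Set E) : Prop :=
  (∀ x ∈ U, N.φ x ∈ S ↔ x ∈ S) ∧ ∀ x ∈ U, N.α x ∈ U → (N.α x ∈ S ↔ x ∈ S)

/-- The region `U` is connected. -/
def Conn (U : Set E) : Prop := ∀ S, N.LocallyClosed U S → ∀ x ∈ U, ∀ y ∈ U, x ∈ S → y ∈ S

/-- The boundary darts of a region, with the region on the left. -/
def bd (U : Set E) : Set E := {d | d ∈ U ∧ N.α d ∉ U}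

/-- The origin of `e` lies on the boundary of the region `U`. -/
def Mixed (U : Set E) (e : E) : Prop :=
  ∃ x y, N.σ.SameCycle e x ∧ N.σ.SameCycle e y ∧ x ∈ U ∧ y ∉ U

variable {N}

theorem LocallyClosed.compl {U S : Set E} (h : N.LocallyClosed U S) : N.LocallyClosed U Sᶜ :=
  ⟨fun x hx => not_congr (h.1 x hx), fun x hx hx' => not_congr (h.2 x hx hx')⟩

theorem LocallyClosed.mono {U V S : Set E} (h : N.LocallyClosed V S) (hUV : U ⊆ V) :
    N.LocallyClosed U S :=
  ⟨fun x hx => h.1 x (hUV hx), fun x hx hx' => h.2 x (hUV hx) (hUV hx')⟩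

theorem Conn.eq_of_forall {U : Set E} (hU : N.Conn U) {h : E → ℤ} (hφ : ∀ e, h (N.φ e) = h e)
    (hα : ∀ e ∈ U, N.α e ∈ U → h (N.α e) = h e) {x y : E} (hx : x ∈ U) (hy : y ∈ U) : h y = h x :=
  hU {e | h e = h x} ⟨fun e _ => by simp [hφ], fun e he he' => by simp [hα e he he']⟩ x hx y hy rfl

theorem α_mem_iff {U : Set E} (hU : ∀ e, N.φ e ∈ U ↔ e ∈ U) (e : E) : N.σ⁻¹ e ∈ U ↔ N.α e ∈ U := by
  rw [← hU (N.α e), φ_eq, N.α_invol]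

theorem sameCycle_σ_inv (e : E) : N.σ.SameCycle e (N.σ⁻¹ e) := ⟨-1, by simp⟩

theorem sameCycle_α_φ (e : E) : N.σ.SameCycle (N.α e) (N.φ e) := sameCycle_σ_inv _

theorem mixed_congr {U : Set E} {e e' : E} (h : N.σ.SameCycle e e') :
    N.Mixed U e ↔ N.Mixed U e' :=
  ⟨fun ⟨x, y, hx, hy, h'⟩ => ⟨x, y, h.symm.trans hx, h.symm.trans hy, h'⟩,
    fun ⟨x, y, hx, hy, h'⟩ => ⟨x, y, h.trans hx, h.trans hy, h'⟩⟩

@[simp] theorem mixed_compl {U : Set E} {e : E} : N.Mixed Uᶜ e ↔ N.Mixed U e := by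
  constructor <;> rintro ⟨x, y, hx, hy, h, h'⟩ <;> exact ⟨y, x, hy, hx, by simpa using h', by simpa using h⟩

theorem mixed_of_mem_of_notMem {U : Set E} (hU : ∀ e, N.φ e ∈ U ↔ e ∈ U) {e : E}
    (h : e ∈ U ∧ N.α e ∉ U ∨ e ∉ U ∧ N.α e ∈ U) : N.Mixed U e := by
  rcases h with ⟨h, h'⟩ | ⟨h, h'⟩
  · exact ⟨e, N.σ⁻¹ e, .refl _ _, sameCycle_σ_inv e, h, by rwa [α_mem_iff hU]⟩
  · exact ⟨N.σ⁻¹ e, e, sameCycle_σ_inv e, .refl _ _, by rwa [α_mem_iff hU], h⟩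

theorem mem_iff_of_not_mixed {U : Set E} {e e' : E} (h : ¬ N.Mixed U e)
    (h' : N.σ.SameCycle e e') : e' ∈ U ↔ e ∈ U := by
  by_contra hc
  refine h ?_
  by_cases he : e ∈ U
  · exact ⟨e, e', .refl _ _, h', he, fun h => hc (by tauto)⟩
  · exact ⟨e', e, h', .refl _ _, by tauto, he⟩

theorem α_mem_iff_of_not_mixed {U : Set E} (hU : ∀ e, N.φ e ∈ U ↔ e ∈ U) {e : E}
    (h : ¬ N.Mixed U e) : N.α e ∈ U ↔ e ∈ U := by
  rw [← α_mem_iff hU, mem_iff_of_not_mixed h (sameCycle_σ_inv e)]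

theorem mixed_of_mem_bd {U : Set E} (hU : ∀ e, N.φ e ∈ U ↔ e ∈ U) {e : E} (h : e ∈ N.bd U) :
    N.Mixed U e ∧ N.Mixed U (N.α e) :=
  ⟨mixed_of_mem_of_notMem hU (.inl h),
    mixed_of_mem_of_notMem hU (.inr ⟨h.2, by rw [N.α_invol]; exact h.1⟩)⟩

theorem mem_bd_compl {U : Set E} {e : E} : e ∈ N.bd Uᶜ ↔ N.α e ∈ N.bd U := by
  simp [bd, N.α_invol, and_comm]

theorem mem_iff_of_sameCycle {U : Set E} (hU : ∀ e, N.φ e ∈ U ↔ e ∈ U) {x y : E}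
    (h : N.φ.SameCycle x y) : y ∈ U ↔ x ∈ U := by
  obtain ⟨k, rfl⟩ := h
  induction k generalizing x with
  | zero => simp
  | succ k ih => rw [add_comm, zpow_add, zpow_one, Equiv.Perm.mul_apply, hU, ih]
  | pred k ih =>
    have := hU ((N.φ ^ (-(k : ℤ) - 1)) x)
    rw [← this, ← Equiv.Perm.mul_apply, ← zpow_one_add, show 1 + (-(k : ℤ) - 1) = -k by ring, ih]

theorem Planar.exists_mem_bd (hN : N.Planar) {U : Set E} (hU : ∀ e, N.φ e ∈ U ↔ e ∈ U) {e : E}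
    (h : N.Mixed U e) : ∃ x ∈ N.bd U, N.σ.SameCycle e x := by
  by_contra! hc
  obtain ⟨x, y, hx, hy, hxU, hyU⟩ := h
  have hxy : (N.σ⁻¹).SameCycle x y := Equiv.Perm.sameCycle_inv.2 (hx.symm.trans hy)
  have := mem_of_sameCycle_of_isOfFinOrder hN.finσ.inv (P := fun c => N.σ.SameCycle e c ∧ c ∈ U)
    (fun c hc' => ⟨hc'.1.trans (sameCycle_σ_inv c), by
      rw [α_mem_iff hU]
      by_contra hα
      exact hc c ⟨hc'.2, hα⟩ hc'.1⟩) hxy ⟨hx, hxU⟩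
  exact hyU this.2

theorem Planar.bd_nonempty (hN : N.Planar) {U : Set E} (hU : ∀ e, N.φ e ∈ U ↔ e ∈ U)
    (h : U.Nonempty) (h' : Uᶜ.Nonempty) : (N.bd U).Nonempty := by
  by_contra hc
  obtain ⟨x, hx⟩ := h
  obtain ⟨y, hy⟩ := h'
  refine hy (hN.connected U (fun e he => (hU e).2 he) (fun e he => ?_) x hx y)
  by_contra h
  exact hc ⟨e, he, h⟩

variable (N) in
/-- The component of the region `Y` that contains the connected region `U`. -/
def component (Y U : Set E) : Set E := {y | y ∈ Y ∧ ∀ S, N.LocallyClosed Y S → U ⊆ S → y ∈ S}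

theorem subset_component {Y U : Set E} (h : U ⊆ Y) : U ⊆ N.component Y U :=
  fun _ hx => ⟨h hx, fun _ _ hS => hS hx⟩

theorem locallyClosed_component {Y U : Set E} (hY : ∀ e, N.φ e ∈ Y ↔ e ∈ Y) :
    N.LocallyClosed Y (N.component Y U) :=
  ⟨fun x hx => and_congr (hY x) (forall₃_congr fun _ hS _ => hS.1 x hx),
    fun x hx hx' => and_congr (iff_of_true hx' hx) (forall₃_congr fun _ hS _ => hS.2 x hx hx')⟩

theorem φ_mem_component {Y U : Set E} (hY : ∀ e, N.φ e ∈ Y ↔ e ∈ Y) (e : E) :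
    N.φ e ∈ N.component Y U ↔ e ∈ N.component Y U := by
  by_cases he : e ∈ Y
  · exact (locallyClosed_component hY).1 e he
  · exact iff_of_false (fun h => he ((hY e).1 h.1)) fun h => he h.1

/-- A saturated set that contains `u` contains `U`, and its trace on the component is saturated in
`Y`, hence is the whole component. If it misses `u`, the same applies to its complement. -/
theorem conn_component {Y U : Set E} (hY : ∀ e, N.φ e ∈ Y ↔ e ∈ Y) (hUY : U ⊆ Y) (hU : N.Conn U)
    (hne : U.Nonempty) : N.Conn (N.component Y U) := by
  obtain ⟨u, hu⟩ := hne
  have key : ∀ S, N.LocallyClosed (N.component Y U) S → u ∈ S → N.component Y U ⊆ S := by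
    intro S hS huS y hy
    have hUS : U ⊆ S := fun x hx => hU S (hS.mono (subset_component hUY)) u hu x hx huS
    refine (hy.2 (N.component Y U ∩ S) ⟨fun x hx => ?_, fun x hx hx' => ?_⟩
      (Set.subset_inter (subset_component hUY) hUS)).2
    · by_cases hxK : x ∈ N.component Y U
      · exact and_congr (φ_mem_component hY x) (hS.1 x hxK)
      · exact iff_of_false (fun h => hxK ((φ_mem_component hY x).1 h.1)) fun h => hxK h.1
    · have h := (locallyClosed_component (U := U) hY).2 x hx hx'
      by_cases hxK : x ∈ N.component Y U
      · exact and_congr h (hS.2 x hxK (h.2 hxK))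
      · exact iff_of_false (fun h' => hxK (h.1 h'.1)) fun h => hxK h.1
  intro S hS x hx y hy hxS
  by_cases huS : u ∈ S
  · exact key S hS huS hy
  · exact absurd hxS (key _ hS.compl huS hx)

variable (N) in
/-- Two nested regions that are connected, with connected complements, and whose boundaries have no
common vertex. -/
structure Strip (U V : Set E) : Prop where
  φU : ∀ e, N.φ e ∈ U ↔ e ∈ U
  φV : ∀ e, N.φ e ∈ V ↔ e ∈ V
  sub : U ⊆ V
  connU : N.Conn U
  connU' : N.Conn Uᶜ
  connV : N.Conn V
  connV' : N.Conn Vᶜ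
  disj : ∀ e, N.Mixed U e → ¬ N.Mixed V e
  neU : U.Nonempty
  neV : Vᶜ.Nonempty

/-- This symmetry exchanges the two boundaries, so what is proved near the boundary of `U` also
holds near that of `V`. -/
theorem Strip.compl {U V : Set E} (h : N.Strip U V) : N.Strip Vᶜ Uᶜ where
  φU e := not_congr (h.φV e)
  φV e := not_congr (h.φU e)
  sub := Set.compl_subset_compl.2 h.sub
  connU := h.connV'
  connU' := by rw [compl_compl]; exact h.connV
  connV := h.connU'
  connV' := by rw [compl_compl]; exact h.connU
  disj e h1 h2 := h.disj e (mixed_compl.1 h2) (mixed_compl.1 h1)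
  neU := h.neV
  neV := by rw [compl_compl]; exact h.neU

/-- A strip can be shrunk along a face that touches the first boundary but not the second. -/
theorem Strip.exists_shrink (hN : N.Planar) {U V : Set E} (h : N.Strip U V) {d : E}
    (hd : d ∈ N.bd U) (hm : ∀ x, N.φ.SameCycle (N.α d) x → ¬ N.Mixed V x) :
    ∃ U', N.Strip U' V ∧ U ⊆ U' ∧ N.α d ∈ U' := by
  -- The faces that touch the boundary of `V`. The region `U` is first enlarged to its component `K`
  -- in `V \ R`, which contains the face of `α d`.
  let R : Set E := {e | ∃ x, N.φ.SameCycle e x ∧ N.Mixed V x}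
  have hRφ : ∀ e, N.φ e ∈ R ↔ e ∈ R := fun e =>
    exists_congr fun x => and_congr Equiv.Perm.sameCycle_apply_left Iff.rfl
  have hUR : ∀ e ∈ U, e ∉ R := by
    rintro e he ⟨x, hx, hxV⟩
    obtain ⟨-, y, -, hy, -, hyV⟩ := id hxV
    exact h.disj x ⟨x, y, .refl _ _, hy, (mem_iff_of_sameCycle h.φU hx).2 he, fun h' => hyV (h.sub h')⟩
      hxV
  have hYφ : ∀ e, N.φ e ∈ V \ R ↔ e ∈ V \ R := fun e => and_congr (h.φV e) (not_congr (hRφ e))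
  have hUY : U ⊆ V \ R := fun e he => ⟨h.sub he, hUR e he⟩
  let K := N.component (V \ R) U
  have hKφ : ∀ e, N.φ e ∈ K ↔ e ∈ K := φ_mem_component hYφ
  have hKc : N.Conn K := conn_component hYφ hUY h.connU h.neU
  have hUK : U ⊆ K := subset_component hUY
  have hdR : N.α d ∉ R := fun ⟨x, hx, hxV⟩ => hm x hx hxV
  have hdV : N.α d ∈ V := by
    by_contra hc
    exact hm _ (.refl _ _) (mixed_of_mem_bd h.φV ⟨h.sub hd.1, hc⟩).2
  have hdK : N.α d ∈ K :=
    ((locallyClosed_component hYφ).2 d (hUY hd.1) ⟨hdV, hdR⟩).2 (hUK hd.1)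
  have hK'φ : ∀ e, N.φ e ∈ Kᶜ ↔ e ∈ Kᶜ := fun e => not_congr (hKφ e)
  have hVK : Vᶜ ⊆ Kᶜ := fun e he hK => he hK.1.1
  -- The complement of `K` may be disconnected. Keeping only its component around `Vᶜ` fills the
  -- holes.
  let L := N.component Kᶜ Vᶜ
  have hLφ : ∀ e, N.φ e ∈ L ↔ e ∈ L := φ_mem_component hK'φ
  have hLc : N.Conn L := conn_component hK'φ hVK h.connV' h.neV
  have hVL : Vᶜ ⊆ L := subset_component hVK
  -- Around a vertex on the boundary of `V` no dart is in `K` and one is outside `V`, so all of them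
  -- are in `L`. The boundary of the new region therefore avoids that vertex.
  have hML : ∀ x, N.Mixed V x → x ∈ L := by
    rintro x hx
    have hall : ∀ e, N.σ.SameCycle x e → e ∉ K := fun e he hK =>
      hK.1.2 ⟨e, .refl _ _, (mixed_congr he).1 hx⟩
    obtain ⟨-, y, -, hy, -, hyV⟩ := id hx
    refine (mem_of_sameCycle_of_isOfFinOrder hN.finσ.inv
      (P := fun c => N.σ.SameCycle x c ∧ c ∈ L) (fun c hc => ?_)
      (Equiv.Perm.sameCycle_inv.2 hy.symm) ⟨hy, hVL hyV⟩).2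
    have h1 := hc.1.trans (sameCycle_σ_inv c)
    refine ⟨h1, ?_⟩
    rw [α_mem_iff hLφ]
    refine ((locallyClosed_component hK'φ).2 c (hall c hc.1) ?_).2 hc.2
    rw [← α_mem_iff hK'φ]
    exact hall _ h1
  have hKL : K ⊆ Lᶜ := fun e he hL => hL.1 he
  refine ⟨Lᶜ, ⟨fun e => not_congr (hLφ e), h.φV, Set.compl_subset_comm.1 hVL, ?_, ?_, h.connV,
    h.connV', ?_, ⟨_, hKL hdK⟩, h.neV⟩, hUK.trans hKL, hKL hdK⟩
  -- A part of `Lᶜ` that misses `K` has no neighbour in `K` by saturation, and none in `L` because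
  -- `L` is a component of `Kᶜ`. It would be closed under `φ` and `α`.
  · have key : ∀ S, N.LocallyClosed Lᶜ S → N.α d ∈ S → Lᶜ ⊆ S := by
      intro S hS hdS y hy
      by_contra hyS
      have hKS : K ⊆ S := fun x hx => hKc S (hS.mono hKL) _ hdK x hx hdS
      refine (hN.connected {x | x ∉ L ∧ x ∉ S} (fun e he => ?_) (fun e he => ?_) y ⟨hy, hyS⟩
        (N.α d)).2 hdS
      · exact ⟨fun hL => he.1 ((hLφ e).1 hL), fun hs => he.2 ((hS.1 e he.1).1 hs)⟩
      · have heK : e ∉ K := fun hK => he.2 (hKS hK)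
        have h1 : N.α e ∉ K := fun hK => he.2 ((hS.2 e he.1 (hKL hK)).1 (hKS hK))
        have h2 : N.α e ∉ L := fun hL =>
          he.1 (((locallyClosed_component hK'φ).2 e heK h1).1 hL)
        exact ⟨h2, fun hs => he.2 ((hS.2 e he.1 h2).1 hs)⟩
    intro S hS x hx y hy hxS
    by_cases hdS : N.α d ∈ S
    · exact key S hS hdS hy
    · exact absurd hxS (key _ hS.compl hdS hx)
  · rw [compl_compl]
    exact hLc
  · rintro e ⟨x, -, hx, -, hxL, -⟩ hV
    exact hxL (hML x ((mixed_congr hx).1 hV))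

variable (N) in
/-- A finite strip that cannot be shrunk. -/
structure Tight (U V : Set E) : Prop extends N.Strip U V where
  fin : (V \ U).Finite
  finU : (N.bd U).Finite
  finV : (N.bd V).Finite
  touchV : ∀ d ∈ N.bd U, ∃ x, N.φ.SameCycle (N.α d) x ∧ N.Mixed V x
  touchU : ∀ d ∈ N.bd V, ∃ x, N.φ.SameCycle d x ∧ N.Mixed U x

theorem bd_compl_finite {U : Set E} (h : (N.bd U).Finite) : (N.bd Uᶜ).Finite :=
  (h.preimage N.α.injective.injOn).subset fun _ he => mem_bd_compl.1 he

theorem Tight.compl {U V : Set E} (h : N.Tight U V) : N.Tight Vᶜ Uᶜ where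
  toStrip := h.toStrip.compl
  fin := h.fin.subset fun e he => ⟨by simpa using he.2, he.1⟩
  finU := bd_compl_finite h.finV
  finV := bd_compl_finite h.finU
  touchV d hd := by
    obtain ⟨x, hx, hx'⟩ := h.touchU _ (mem_bd_compl.1 hd)
    exact ⟨x, hx, mixed_compl.2 hx'⟩
  touchU d hd := by
    obtain ⟨x, hx, hx'⟩ := h.touchV _ (mem_bd_compl.1 hd)
    rw [N.α_invol] at hx
    exact ⟨x, hx, mixed_compl.2 hx'⟩

theorem bd_finite_of_subset {U V : Set E} (h : U ⊆ V) (hfin : (V \ U).Finite)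
    (hU : (N.bd U).Finite) : (N.bd V).Finite := by
  refine (hU.union hfin).subset fun e he => ?_
  by_cases heU : e ∈ U
  · exact .inl ⟨heU, fun h' => he.2 (h h')⟩
  · exact .inr ⟨he.1, heU⟩

/-- Each failure of tightness lets a face leave the strip on one side or, by symmetry, on the other;
the strip is finite. -/
theorem Strip.exists_tight (hN : N.Planar) {U V : Set E} (h : N.Strip U V) (hfin : (V \ U).Finite)
    (hU : (N.bd U).Finite) : ∃ U' V', N.Tight U' V' ∧ U ⊆ U' ∧ V' ⊆ V := by
  induction hn : (V \ U).ncard using Nat.strong_induction_on generalizing U V with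
  | h n ih =>
    have hV := bd_finite_of_subset h.sub hfin hU
    by_cases h1 : ∀ d ∈ N.bd U, ∃ x, N.φ.SameCycle (N.α d) x ∧ N.Mixed V x
    · by_cases h2 : ∀ d ∈ N.bd V, ∃ x, N.φ.SameCycle d x ∧ N.Mixed U x
      · exact ⟨U, V, ⟨h, hfin, hU, hV, h1, h2⟩, subset_rfl, subset_rfl⟩
      · push Not at h2
        obtain ⟨d, hd, hd'⟩ := h2
        obtain ⟨V', hV', hsub, hdV'⟩ := h.compl.exists_shrink hN (d := N.α d)
          (by rw [mem_bd_compl, N.α_invol]; exact hd)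
          (fun x hx hx' => by
            rw [N.α_invol] at hx
            exact hd' x hx (mixed_compl.1 hx'))
        rw [N.α_invol] at hdV'
        have h3 := hV'.compl
        rw [compl_compl] at h3
        have hsub' : V'ᶜ \ U ⊆ V \ U := Set.sdiff_subset_sdiff_left (Set.compl_subset_comm.1 hsub)
        have hdU : d ∉ U := by
          have := hV'.sub hdV'
          exact this
        obtain ⟨U'', V'', ht, hs, hs'⟩ := ih _ (by
          rw [← hn]
          exact Set.ncard_lt_ncard (hsub'.ssubset_of_mem_notMem ⟨hd.1, hdU⟩ fun h' => h'.1 hdV')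
            hfin) h3 (hfin.subset hsub') hU rfl
        exact ⟨U'', V'', ht, hs, hs'.trans (Set.compl_subset_comm.1 hsub)⟩
    · push Not at h1
      obtain ⟨d, hd, hd'⟩ := h1
      obtain ⟨U', hU', hsub, hdU'⟩ := h.exists_shrink hN hd hd'
      have hsub' : V \ U' ⊆ V \ U := Set.sdiff_subset_sdiff_right hsub
      obtain ⟨U'', V'', ht, hs, hs'⟩ := ih _ (by
        rw [← hn]
        exact Set.ncard_lt_ncard (hsub'.ssubset_of_mem_notMem ⟨hU'.sub hdU', hd.2⟩
          fun h' => h'.2 hdU') hfin) hU' (hfin.subset hsub')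
          (bd_finite_of_subset hsub (hfin.subset (Set.sdiff_subset_sdiff_left hU'.sub)) hU) rfl
      exact ⟨U'', V'', ht, hsub.trans hs, hs'⟩

end Region

end CombMap

namespace CombMap

/-! ### Recognizing a simple cycle by its closed chains. -/

section CycleOfSet

variable {E : Type*} {N : CombMap E}

/-- A finite set of darts without reversed pairs, in which every dart has a successor, and on which
every 1-chain supported by the set without boundary is constant, is the set of darts of a cycle. -/
theorem exists_cycle_of_set {B : Set E} (hfin : B.Finite) (hne : B.Nonempty)
    (hB : ∀ d ∈ B, N.α d ∉ B) (hnext : ∀ d ∈ B, ∃ d' ∈ B, N.σ.SameCycle (N.α d) d')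
    (hconst : ∀ z : E → ℤ, (∀ e, z (N.α e) = -z e) → z ∈ coboundaries N.σ →
      (∀ e, z e ≠ 0 → e ∈ B ∨ N.α e ∈ B) → ∀ x ∈ B, ∀ y ∈ B, z x = z y) :
    ∃ c : N.Cycle, ∀ d, c.HasDart d ↔ d ∈ B := by
  classical
  obtain ⟨b₀, hb₀⟩ := hne
  -- One outgoing dart is fixed at each vertex, so the successor of a dart depends only on its end.
  -- Simplicity will follow from this.
  have hg : ∀ v : N.Vertex, ∃ b ∈ B, (∃ b' ∈ B, N.origin b' = v) → N.origin b = v := by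
    intro v
    by_cases h : ∃ b' ∈ B, N.origin b' = v
    · obtain ⟨b, hb, hv⟩ := h
      exact ⟨b, hb, fun _ => hv⟩
    · exact ⟨b₀, hb₀, fun h' => absurd h' h⟩
  choose g hgB hg using hg
  let nxt : E → E := fun d => g (N.origin (N.α d))
  have hnB : ∀ d, nxt d ∈ B := fun d => hgB _
  have hns : ∀ d ∈ B, N.σ.SameCycle (N.α d) (nxt d) := by
    intro d hd
    obtain ⟨d', hd', h⟩ := hnext d hd
    have : N.origin (nxt d) = N.origin (N.α d) := hg _ ⟨d', hd', Quotient.sound h.symm⟩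
    exact (Quotient.exact this).symm
  have hit : ∀ k, nxt^[k] b₀ ∈ B := by
    intro k
    cases k with
    | zero => exact hb₀
    | succ k => rw [Function.iterate_succ_apply']; exact hnB _
  obtain ⟨b, hbB, hbp⟩ : ∃ b ∈ B, b ∈ Function.periodicPts nxt := by
    have := hfin.to_subtype
    obtain ⟨i, j, hij, h⟩ := Finite.exists_ne_map_eq_of_infinite fun k => (⟨_, hit k⟩ : B)
    simp only [Subtype.mk.injEq] at h
    wlog hlt : i < j generalizing i j
    · exact this j i hij.symm h.symm (by omega)
    refine ⟨_, hit i, j - i, by omega, ?_⟩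
    rw [Function.IsPeriodicPt, Function.IsFixedPt, ← Function.iterate_add_apply,
      Nat.sub_add_cancel hlt.le, h]
  have hbit : ∀ k, nxt^[k] b ∈ B := by
    intro k
    cases k with
    | zero => exact hbB
    | succ k => rw [Function.iterate_succ_apply']; exact hnB _
  obtain ⟨n, hn⟩ : ∃ n, Function.minimalPeriod nxt b = n + 1 :=
    ⟨_, (Nat.succ_pred_eq_of_pos (Function.minimalPeriod_pos_of_mem_periodicPts hbp)).symm⟩
  have hper : nxt^[n + 1] b = b := by rw [← hn]; exact Function.isPeriodicPt_minimalPeriod nxt b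
  -- The closed chain of a periodic orbit of the successor map. It is nonzero at `b` and constant on
  -- `B`, so the orbit is all of `B`.
  let z : E → ℤ := ∑ i ∈ Finset.range (n + 1),
    (Pi.single (nxt^[i] b) 1 - Pi.single (N.α (nxt^[i] b)) 1)
  have hzapp : ∀ e, z e = ∑ i ∈ Finset.range (n + 1),
      ((if e = nxt^[i] b then 1 else 0) - if e = N.α (nxt^[i] b) then 1 else 0) := by
    intro e
    simp only [z, Finset.sum_apply, Pi.sub_apply, Pi.single_apply]
  have hαeq : ∀ x y, N.α x = y ↔ x = N.α y := fun x y =>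
    ⟨fun h => by rw [← h, N.α_invol], fun h => by rw [h, N.α_invol]⟩
  have hzmem : z ∈ coboundaries N.σ := by
    have := sum_range_single_mem (π := N.σ) (α := N.α) (dart := fun i => nxt^[i] b)
      (fun i => by rw [Function.iterate_succ_apply']; exact hns _ (hbit i)) (n + 1)
    simp only [hper, Function.iterate_zero, id, sub_self, sub_zero] at this
    exact this
  have hzα : ∀ e, z (N.α e) = -z e := by
    intro e
    rw [hzapp, hzapp, ← Finset.sum_neg_distrib]
    refine Finset.sum_congr rfl fun i _ => ?_
    rw [N.α.injective.eq_iff, hαeq]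
    ring
  have hzB : ∀ e ∈ B, z e = ∑ i ∈ Finset.range (n + 1), if e = nxt^[i] b then 1 else 0 := by
    intro e he
    rw [hzapp]
    refine Finset.sum_congr rfl fun i _ => ?_
    rw [if_neg fun h : e = N.α (nxt^[i] b) => hB _ (hbit i) (h ▸ he), sub_zero]
  have hzsupp : ∀ e, z e ≠ 0 → e ∈ B ∨ N.α e ∈ B := by
    intro e he
    by_contra! hc
    refine he ?_
    rw [hzapp]
    refine Finset.sum_eq_zero fun i _ => ?_
    rw [if_neg fun h : e = nxt^[i] b => hc.1 (h ▸ hbit i),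
      if_neg fun h : e = N.α (nxt^[i] b) => hc.2 (by rw [h, N.α_invol]; exact hbit i), sub_zero]
  have hzb : z b ≠ 0 := by
    rw [hzB b hbB]
    refine (lt_of_lt_of_le zero_lt_one (Finset.single_le_sum
      (f := fun i => if b = nxt^[i] b then (1 : ℤ) else 0)
      (fun i _ => by split_ifs <;> simp) (Finset.mem_range.2 n.succ_pos) |>.trans' ?_)).ne'
    simp
  have hall : ∀ e ∈ B, ∃ i < n + 1, nxt^[i] b = e := by
    intro e he
    by_contra! hc
    have h1 := hconst z hzα hzmem hzsupp e he b hbB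
    rw [hzB e he, Finset.sum_eq_zero fun i hi => if_neg (hc i (Finset.mem_range.1 hi)).symm] at h1
    exact hzb h1.symm
  -- Every dart of `B` is a successor, hence the dart fixed at its own origin.
  have hfix : ∀ e ∈ B, g (N.origin e) = e := by
    have hrep : ∀ e ∈ B, ∃ d ∈ B, nxt d = e := by
      intro e he
      obtain ⟨i, -, rfl⟩ := hall e he
      cases i with
      | zero => exact ⟨_, hbit n, (Function.iterate_succ_apply' nxt n b).symm.trans hper⟩
      | succ i => exact ⟨_, hbit i, (Function.iterate_succ_apply' _ _ _).symm⟩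
    intro e he
    obtain ⟨d, hd, rfl⟩ := hrep e he
    rw [show N.origin (nxt d) = N.origin (N.α d) from Quotient.sound (hns d hd).symm]
  have hinj : ∀ i j : Fin (n + 1), nxt^[i] b = nxt^[j] b → i = j := by
    intro i j h
    have := Function.iterate_injOn_Iio_minimalPeriod (f := nxt) (x := b)
      (by rw [hn]; exact i.2) (by rw [hn]; exact j.2) h
    exact Fin.ext this
  refine ⟨⟨n, fun i => nxt^[i] b, fun i => ?_, fun i j h => ?_, fun i j h => ?_⟩, fun d => ?_⟩
  · have : nxt^[((i + 1 : Fin (n + 1)) : ℕ)] b = nxt (nxt^[i] b) := by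
      rw [← Function.iterate_succ_apply' nxt i b]
      by_cases hi : i = Fin.last n
      · subst hi
        simp [hper]
      · rw [Fin.val_add_one, if_neg hi]
    rw [this]
    exact hns _ (hbit i)
  · have : N.origin (nxt^[i] b) = N.origin (nxt^[j] b) := Quotient.sound h
    exact hinj i j (by rw [← hfix _ (hbit i), ← hfix _ (hbit j), this])
  · exact hB _ (hbit i) (h ▸ hbit j)
  · constructor
    · rintro ⟨i, rfl⟩
      exact hbit i
    · intro hd
      obtain ⟨i, hi, rfl⟩ := hall d hd
      exact ⟨⟨i, hi⟩, rfl⟩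

/-- The 1-chain of an arc of a cycle. -/
theorem Cycle.exists_arc [DecidableEq E] (c : N.Cycle) {i j : Fin (c.n + 1)} (hij : i ≠ j) :
    ∃ a : E → ℤ, (∀ e, a (N.α e) = -a e) ∧ (∀ e, a e ≠ 0 → c.HasEdge e) ∧
      a (c.dart i) ≠ a (c.dart j) ∧
      a - (Pi.single (c.dart i) 1 - Pi.single (c.dart j) 1) ∈ coboundaries N.σ := by
  let u : ℕ → Fin (c.n + 1) := fun k => i + Fin.ofNat (c.n + 1) k
  have hu : ∀ k, u (k + 1) = u k + 1 := by
    intro k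
    simp only [u, add_assoc]
    congr 1
    ext
    simp [Fin.val_add]
  let m : ℕ := (j - i).val
  have hm : u m = j := by simp [u, m]
  have hk : ∀ k < m, u k ≠ j := by
    intro k hk h
    have h1 : Fin.ofNat (c.n + 1) k = j - i := by rw [← h]; simp [u]
    have h2 := congrArg Fin.val h1
    rw [Fin.val_ofNat, Nat.mod_eq_of_lt (by omega)] at h2
    omega
  have hki : ∀ k < m, u k = i → k = 0 := by
    intro k hk h
    have h1 : Fin.ofNat (c.n + 1) k = 0 := by simpa [u] using h
    have h2 := congrArg Fin.val h1
    rw [Fin.val_ofNat, Nat.mod_eq_of_lt (by omega)] at h2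
    simpa using h2
  have hm0 : 0 < m := Nat.pos_of_ne_zero fun h => hij (by rw [← hm, h]; simp [u])
  -- The darts from index `i` included to index `j` excluded, whence the values `1` and `0` at the
  -- two ends.
  let a : E → ℤ := ∑ k ∈ Finset.range m,
    (Pi.single (c.dart (u k)) 1 - Pi.single (N.α (c.dart (u k))) 1)
  have haapp : ∀ e, a e = ∑ k ∈ Finset.range m,
      ((if e = c.dart (u k) then 1 else 0) - if e = N.α (c.dart (u k)) then 1 else 0) := by
    intro e
    simp only [a, Finset.sum_apply, Pi.sub_apply, Pi.single_apply]
  have hαeq : ∀ x y, N.α x = y ↔ x = N.α y := fun x y =>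
    ⟨fun h => by rw [← h, N.α_invol], fun h => by rw [h, N.α_invol]⟩
  have hadart : ∀ l, a (c.dart l) = ∑ k ∈ Finset.range m, if u k = l then 1 else 0 := by
    intro l
    rw [haapp]
    refine Finset.sum_congr rfl fun k _ => ?_
    rw [if_neg (c.reduced _ _).symm, sub_zero]
    simp only [c.dart_injective.eq_iff, eq_comm]
  refine ⟨a, fun e => ?_, fun e he => ?_, ?_, ?_⟩
  · rw [haapp, haapp, ← Finset.sum_neg_distrib]
    refine Finset.sum_congr rfl fun i _ => ?_
    simp only [N.α.injective.eq_iff, hαeq e]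
    ring
  · by_contra hc
    rw [Cycle.HasEdge, not_or] at hc
    refine he ?_
    rw [haapp]
    refine Finset.sum_eq_zero fun i _ => ?_
    rw [if_neg fun h : e = _ => hc.1 ⟨_, h.symm⟩,
      if_neg fun h : e = N.α _ => hc.2 ⟨_, by rw [h, N.α_invol]⟩, sub_zero]
  · rw [hadart, hadart, Finset.sum_eq_single 0 (fun k hk h => if_neg fun h' =>
      h (hki k (Finset.mem_range.1 hk) h')) (fun h => absurd (Finset.mem_range.2 hm0) h),
      Finset.sum_eq_zero fun k hk' => if_neg (hk k (Finset.mem_range.1 hk'))]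
    simp [u]
  · have := sum_range_single_mem (π := N.σ) (α := N.α) (dart := fun k => c.dart (u k))
      (fun k => by rw [hu]; exact c.next _) m
    rw [hm, show u 0 = i by simp [u]] at this
    exact this

end CycleOfSet

end CombMap

namespace CombMap

/-! ### Paths inside a tight strip. -/

section StripPath

variable {E : Type*} {N : CombMap E}

/-- The words whose curve from `e` turns around vertices freely and flips only at the darts in
`P`. -/
inductive PathIn (N : CombMap E) (P : E → Prop) (e : E) : Word → Prop
  | one : PathIn N P e 1
  | rot (w : Word) (k : ℤ) : PathIn N P e w → PathIn N P e (CombMap.rot ^ k * w)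
  | flip (w : Word) : PathIn N P e w → P (N.act w e) → PathIn N P e (CombMap.flip * w)

theorem PathIn.mono {P Q : E → Prop} (h : ∀ e, P e → Q e) {e : E} {w : Word}
    (hw : PathIn N P e w) : PathIn N Q e w := by
  induction hw with
  | one => exact .one
  | rot w k _ ih => exact .rot w k ih
  | flip w _ hP ih => exact .flip w ih (h _ hP)

/-- The values against a cocycle of a finite chain. -/
noncomputable def pairing (F : E → ℤ) : (E →₀ ℤ) →+ ℤ :=
  Finsupp.liftAddHom fun e => AddMonoidHom.mulRight (F e)

theorem pairing_apply (F : E → ℤ) (z : E →₀ ℤ) : pairing F z = z.sum fun e n => n * F e := rfl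

theorem pairing_eq_sum (F : E → ℤ) (z : E →₀ ℤ) {s : Finset E} (hs : z.support ⊆ s) :
    pairing F z = ∑ e ∈ s, z e * F e := by
  rw [pairing_apply, Finsupp.sum_of_support_subset _ hs _ (by simp)]

theorem hol_rot_zpow_primal (F : E → ℤ) (k : ℤ) (e : E) :
    N.hol (primalVoltage F) (CombMap.rot ^ k) e = 0 := by
  have := N.potential_zpow (primalVoltage F) (R := CombMap.rot) (s := fun _ => 0) (by simp) k e
  simpa using this.symm

/-- The chain of a path. -/
theorem PathIn.exists_chain [DecidableEq E] {P : E → Prop} (hP : ∀ e, P (N.α e) ↔ P e) {e : E}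
    {w : Word} (hw : PathIn N P e w) : ∃ z : E →₀ ℤ, (∀ x, z (N.α x) = -z x) ∧
      (∀ x, z x ≠ 0 → P x) ∧
      ⇑z - (Pi.single e 1 - Pi.single (N.act w e) 1) ∈ coboundaries N.σ ∧
      ∀ F : E → ℤ, (∀ x, F (N.α x) = -F x) →
        pairing F z = 2 * N.hol (primalVoltage F) w e := by
  induction hw with
  | one => exact ⟨0, by simp, by simp, by simp [zero_mem], by simp⟩
  | rot w k _ ih =>
    obtain ⟨z, h1, h2, h3, h4⟩ := ih
    refine ⟨z, h1, h2, ?_, fun F hF => ?_⟩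
    · have : N.σ.SameCycle (N.act w e) (N.act (CombMap.rot ^ k * w) e) := ⟨k, by simp [act_rot]⟩
      have := sub_mem h3 (single_sub_single_mem this)
      convert this using 1
      abel
    · rw [hol_mul, hol_rot_zpow_primal, zero_add, h4 F hF]
  | flip w _ hx ih =>
    obtain ⟨z, h1, h2, h3, h4⟩ := ih
    set y := N.act w e with hy
    have hact : N.act (CombMap.flip * w) e = N.α y := by simp [act_flip, hy]
    -- A flip adds its dart and subtracts the reverse. Both pair with `F` to the same value, whence
    -- the factor `2`.
    refine ⟨z + Finsupp.single y 1 - Finsupp.single (N.α y) 1, fun x => ?_, fun x hx' => ?_, ?_,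
      fun F hF => ?_⟩
    · have h5 : N.α y = N.α x ↔ y = x := N.α.injective.eq_iff
      have h6 : y = N.α x ↔ N.α y = x :=
        ⟨fun h => by rw [h, N.α_invol], fun h => by rw [← h, N.α_invol]⟩
      simp only [Finsupp.sub_apply, Finsupp.add_apply, Finsupp.single_apply, h1, h5, h6]
      ring
    · by_cases hxy : y = x
      · rwa [← hxy]
      by_cases hxy' : N.α y = x
      · rwa [← hxy', hP]
      · refine h2 x ?_
        simpa [Finsupp.single_apply, hxy, hxy'] using hx'
    · rw [hact]
      convert h3 using 1
      rw [Finsupp.coe_sub, Finsupp.coe_add, Finsupp.single_eq_pi_single,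
        Finsupp.single_eq_pi_single]
      abel
    · rw [map_sub, map_add, h4 F hF, hol_mul, ← hy, hol_flip]
      simp [pairing_apply, hF]
      ring

/-- A cocycle vanishes on the finite chains that are constant on faces. -/
theorem pairing_eq_zero {F : E → ℤ} (hF : F ∈ coboundaries N.φ) {z : E →₀ ℤ}
    (hz : ∀ e, z (N.φ e) = z e) : pairing F z = 0 := by
  obtain ⟨t, ht⟩ := hF
  rw [pairing_eq_sum F z subset_rfl]
  simp only [ht, mul_sub, Finset.sum_sub_distrib, sub_eq_zero]
  refine Finset.sum_bij (fun e _ => N.φ e) (fun e he => ?_) (fun a _ b _ h => N.φ.injective h)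
    (fun e he => ⟨N.φ.symm e, ?_, by simp⟩) (fun e _ => by rw [hz])
  · rw [Finsupp.mem_support_iff] at he ⊢
    rwa [hz]
  · rw [Finsupp.mem_support_iff] at he ⊢
    rwa [← hz, Equiv.apply_symm_apply]

theorem pairing_α {F : E → ℤ} (hF : ∀ e, F (N.α e) = -F e) (z : E →₀ ℤ) :
    pairing F (z.equivMapDomain N.α) = -pairing F z := by
  rw [pairing_apply, pairing_apply, Finsupp.sum_equivMapDomain, Finsupp.sum, Finsupp.sum,
    ← Finset.sum_neg_distrib]
  exact Finset.sum_congr rfl fun e _ => by rw [hF]; ring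

variable (N) in
/-- The edges inside the strip between `U` and `V` that do not touch the boundary of `V`. -/
def Free (U V : Set E) (e : E) : Prop :=
  (e ∈ V ∧ e ∉ U ∧ ¬ N.Mixed V e) ∧ N.α e ∈ V ∧ N.α e ∉ U ∧ ¬ N.Mixed V (N.α e)

theorem free_α {U V : Set E} (e : E) : N.Free U V (N.α e) ↔ N.Free U V e := by
  unfold Free
  rw [N.α_invol]
  exact and_comm

/-- The boundary of a connected region with connected complement is a cycle. -/
theorem Planar.exists_cycle_bd (hN : N.Planar) {U : Set E} (hφ : ∀ e, N.φ e ∈ U ↔ e ∈ U)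
    (hU : N.Conn U) (hU' : N.Conn Uᶜ) (hne : U.Nonempty) (hne' : Uᶜ.Nonempty)
    (hfin : (N.bd U).Finite) : ∃ c : N.Cycle, ∀ d, c.HasDart d ↔ d ∈ N.bd U := by
  refine exists_cycle_of_set hfin (hN.bd_nonempty hφ hne hne') (fun d hd h => h.2 ?_)
    (fun d hd => ?_) (fun z hz hz' hsupp x hx y hy => ?_)
  · rw [N.α_invol]
    exact hd.1
  · exact hN.exists_mem_bd hφ (mixed_of_mem_bd hφ hd).2
  -- A closed chain carried by the boundary is the jump of a function on faces that is constant on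
  -- each of the two connected sides.
  · obtain ⟨h, hh, hh'⟩ := hN.jordan z hz hz' ((hfin.union
      (hfin.preimage N.α.injective.injOn)).subset hsupp)
    have hin : ∀ e ∈ U, N.α e ∈ U → h (N.α e) = h e := by
      intro e he he'
      have : z e = 0 := by
        by_contra hc
        rcases hsupp e hc with h1 | h1
        · exact h1.2 he'
        · exact h1.2 (by rwa [N.α_invol])
      linarith [hh' e]
    have hout : ∀ e ∈ Uᶜ, N.α e ∈ Uᶜ → h (N.α e) = h e := by
      intro e he he'
      have : z e = 0 := by
        by_contra hc
        rcases hsupp e hc with h1 | h1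
        · exact he h1.1
        · exact he' h1.1
      linarith [hh' e]
    rw [hh', hh', hU.eq_of_forall hh hin hx.1 hy.1,
      hU'.eq_of_forall hh hout (x := N.α x) (y := N.α y) hx.2 hy.2]

theorem Strip.neU' {U V : Set E} (h : N.Strip U V) : Uᶜ.Nonempty :=
  h.neV.mono (Set.compl_subset_compl.2 h.sub)

theorem Strip.neV' {U V : Set E} (h : N.Strip U V) : V.Nonempty := h.neU.mono h.sub

variable {U V : Set E} (hN : N.Planar) (hT : N.Tight U V)
include hN hT

theorem Tight.exists_cycle : ∃ c : N.Cycle, ∀ d, c.HasDart d ↔ d ∈ N.bd U :=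
  hN.exists_cycle_bd hT.φU hT.connU hT.connU' hT.neU hT.neU' hT.finU

/-- A chain whose support, apart from free edges, lies on the boundary of `U`, is the boundary of a
function on the faces that takes the same values on both sides along all of this boundary. -/
theorem Tight.exists_const {z : E → ℤ} (hz : ∀ e, z (N.α e) = -z e) (hz' : z ∈ coboundaries N.σ)
    (hsupp : ∀ e, z e ≠ 0 → N.Free U V e ∨ e ∈ N.bd U ∨ N.α e ∈ N.bd U) :
    ∃ (h : E → ℤ) (a b : ℤ), (∀ e, h (N.φ e) = h e) ∧ (∀ e, z e = h (N.α e) - h e) ∧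
      (∀ e ∈ U, h e = a) ∧ (∀ e ∉ V, h e = b) ∧ ∀ e ∈ N.bd U, z e = b - a := by
  have hfin : {e | z e ≠ 0}.Finite := by
    refine (hT.fin.union (hT.finU.union (hT.finU.preimage N.α.injective.injOn))).subset fun e he => ?_
    rcases hsupp e he with h | h
    · exact .inl ⟨h.1.1, h.1.2.1⟩
    · exact .inr h
  obtain ⟨h, hh, hh'⟩ := hN.jordan z hz hz' hfin
  have hU : ∀ e ∈ U, N.α e ∈ U → h (N.α e) = h e := by
    intro e he he'
    have : z e = 0 := by
      by_contra hc
      rcases hsupp e hc with h1 | h1 | h1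
      · exact h1.1.2.1 he
      · exact h1.2 he'
      · exact h1.2 (by rwa [N.α_invol])
    linarith [hh' e]
  have hV : ∀ e ∈ Vᶜ, N.α e ∈ Vᶜ → h (N.α e) = h e := by
    intro e he he'
    have : z e = 0 := by
      by_contra hc
      rcases hsupp e hc with h1 | h1 | h1
      · exact he h1.1.1
      · exact he (hT.sub h1.1)
      · exact he' (hT.sub h1.1)
    linarith [hh' e]
  obtain ⟨u, hu⟩ := hT.neU
  obtain ⟨v, hv⟩ := hT.neV
  refine ⟨h, h u, h v, hh, hh', fun e he => hT.connU.eq_of_forall hh hU hu he,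
    fun e he => hT.connV'.eq_of_forall hh hV hv he, fun e he => ?_⟩
  -- Tightness enters here. The face on the right of `e` has a vertex on the boundary of `V`, and no
  -- edge of the chain meets that vertex. So `h` is constant around it and the face has the value
  -- taken outside `V`.
  obtain ⟨x, hx, hxV⟩ := hT.touchV e he
  have h1 : h x = h (N.α e) := by
    exact (mem_iff_of_sameCycle (U := {y | h y = h (N.α e)}) (fun e => by simp [hh]) hx).2 rfl
  have h2 : ∀ y, N.σ.SameCycle x y → h y = h x := by
    have h3 : ∀ y, N.Mixed V y → h (N.σ⁻¹ y) = h y := by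
      intro y hy
      have : z y = 0 := by
        by_contra hc
        rcases hsupp y hc with h1 | h1 | h1
        · exact h1.1.2.2 hy
        · exact hT.disj y (mixed_of_mem_bd hT.φU h1).1 hy
        · refine hT.disj y ?_ hy
          have := (mixed_of_mem_bd hT.φU h1).2
          rwa [N.α_invol] at this
      have h4 := hh (N.α y)
      rw [φ_eq, N.α_invol] at h4
      linarith [hh' y]
    intro y hy
    refine (mem_of_sameCycle_of_isOfFinOrder hN.finσ.inv
      (P := fun c => N.σ.SameCycle x c ∧ h c = h x) (fun c hc => ?_)
      (Equiv.Perm.sameCycle_inv.2 hy) ⟨.refl _ _, rfl⟩).2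
    exact ⟨hc.1.trans (sameCycle_σ_inv c), by rw [h3 c ((mixed_congr hc.1).1 hxV), hc.2]⟩
  obtain ⟨-, y, -, hy, -, hyV⟩ := hxV
  rw [hh', ← h1, ← h2 y hy, hT.connV'.eq_of_forall hh hV hv hyV,
    hT.connU.eq_of_forall hh hU hu he.1]

/-- Two free paths issued from the same dart reach the boundary of `U` at the same vertex. -/
theorem Tight.sameCycle_of_mixed {e : E} {w w' : Word} (hw : PathIn N (N.Free U V) e w)
    (hw' : PathIn N (N.Free U V) e w') (hm : N.Mixed U (N.act w e)) (hm' : N.Mixed U (N.act w' e)) :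
    N.σ.SameCycle (N.act w e) (N.act w' e) := by
  classical
  obtain ⟨c, hc⟩ := hT.exists_cycle hN
  obtain ⟨x, hx, hx'⟩ := hN.exists_mem_bd hT.φU hm
  obtain ⟨y, hy, hy'⟩ := hN.exists_mem_bd hT.φU hm'
  obtain ⟨i, rfl⟩ := (hc x).2 hx
  obtain ⟨j, rfl⟩ := (hc y).2 hy
  by_cases hij : i = j
  · subst hij
    exact hx'.trans hy'.symm
  -- Two distinct end vertices would be joined by an arc of the boundary of `U`, closing the paths
  -- to a chain that is not constant on this boundary.
  obtain ⟨a, ha1, ha2, ha3, ha4⟩ := c.exists_arc hij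
  obtain ⟨z, hz1, hz2, hz3, -⟩ := hw.exists_chain free_α
  obtain ⟨z', hz1', hz2', hz3', -⟩ := hw'.exists_chain free_α
  have hfree : ∀ e ∈ N.bd U, z e = 0 ∧ z' e = 0 := fun e he =>
    ⟨by by_contra h; exact (hz2 e h).1.2.1 he.1, by by_contra h; exact (hz2' e h).1.2.1 he.1⟩
  obtain ⟨h, s, t, -, -, -, -, hbd⟩ := hT.exists_const hN (z := z - z' + a)
    (fun e => by simp only [Pi.add_apply, Pi.sub_apply, ha1, hz1, hz1']; ring) (by
      have h1 := single_sub_single_mem hx'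
      have h2 := single_sub_single_mem hy'
      convert add_mem (add_mem (sub_mem hz3 hz3') ha4) (sub_mem h2 h1) using 1
      abel) (fun e he => by
      by_cases h1 : z e = 0
      · by_cases h2 : z' e = 0
        · have : a e ≠ 0 := by simpa [h1, h2] using he
          right
          exact (ha2 e this).imp (hc _).1 (hc _).1
        · exact .inl (hz2' e h2)
      · exact .inl (hz2 e h1))
  have h1 := hbd _ hx
  have h2 := hbd _ hy
  simp only [Pi.add_apply, Pi.sub_apply, hfree _ hx, hfree _ hy] at h1 h2
  exact absurd (by linarith) ha3

/-- Two free paths with the same ends have the same values against cocycles. -/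
theorem Tight.hol_eq {e : E} {w w' : Word} (hw : PathIn N (N.Free U V) e w)
    (hw' : PathIn N (N.Free U V) e w') (hm : N.σ.SameCycle (N.act w e) (N.act w' e)) {F : E → ℤ}
    (hFα : ∀ e, F (N.α e) = -F e) (hF : F ∈ coboundaries N.φ) :
    N.hol (primalVoltage F) w e = N.hol (primalVoltage F) w' e := by
  classical
  obtain ⟨z, hz1, hz2, hz3, hz4⟩ := hw.exists_chain free_α
  obtain ⟨z', hz1', hz2', hz3', hz4'⟩ := hw'.exists_chain free_α
  have hfree : ∀ e ∈ N.bd U, z e = 0 ∧ z' e = 0 := fun e he =>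
    ⟨by by_contra h; exact (hz2 e h).1.2.1 he.1, by by_contra h; exact (hz2' e h).1.2.1 he.1⟩
  obtain ⟨h, s, t, hh, hh', hs, ht, hbd⟩ := hT.exists_const hN (z := ⇑(z - z'))
    (fun e => by simp only [Finsupp.sub_apply, hz1, hz1']; ring) (by
      rw [Finsupp.coe_sub]
      convert sub_mem (sub_mem hz3 hz3') (single_sub_single_mem hm) using 1
      abel) (fun e he => by
      by_cases h1 : z e = 0
      · by_cases h2 : z' e = 0
        · simp [h1, h2] at he
        · exact .inl (hz2' e h2)
      · exact .inl (hz2 e h1))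
  -- The chain vanishes on the boundary of `U`, so its potential is the same in `U` and outside `V`.
  -- Minus that constant it has finite support, and a cocycle vanishes on the boundary of a finite
  -- chain of faces.
  have hst : t = s := by
    obtain ⟨x, hx⟩ := hN.bd_nonempty hT.φU hT.neU hT.neU'
    have h1 := hbd x hx
    rw [Finsupp.sub_apply, (hfree x hx).1, (hfree x hx).2] at h1
    linarith
  have hfin : {e | h e - s ≠ 0}.Finite := by
    refine hT.fin.subset fun e he => ⟨?_, fun hU => he (by rw [hs e hU, sub_self])⟩
    by_contra hV
    exact he (by rw [ht e hV, hst, sub_self])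
  let k : E →₀ ℤ := Finsupp.ofSupportFinite (fun e => h e - s) hfin
  have hk : ∀ e, k e = h e - s := fun e => rfl
  have hzk : z - z' = k.equivMapDomain N.α - k := by
    ext e
    have hα : N.α.symm e = N.α e := by rw [Equiv.symm_apply_eq, N.α_invol]
    rw [hh' e, Finsupp.sub_apply, Finsupp.equivMapDomain_apply, hα, hk, hk]
    ring
  have h1 : pairing F (z - z') = 0 := by
    rw [hzk, map_sub, pairing_α hFα, pairing_eq_zero hF fun e => by rw [hk, hk, hh]]
    simp
  rw [map_sub, hz4 F hFα, hz4' F hFα] at h1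
  linarith

end StripPath

end CombMap

namespace CombMap

/-! ### What 3-connectedness of the universal cover forbids in a tight strip. -/

section ThreeConnected

variable {D : Type*} {M : CombMap D}

theorem universalCover_act (d₀ : D) (u w : Word) :
    (M.universalCover d₀).act u (w : Word ⧸ M.nullLoops d₀) = ((u * w : Word) : Word ⧸ _) := by
  have : (M.universalCover d₀).act = MulAction.toPermHom Word (Word ⧸ M.nullLoops d₀) := by
    refine FreeGroup.ext_hom _ _ fun b => ?_
    cases b
    · simp [act, universalCover, CombMap.flip]
    · simp [act, universalCover, CombMap.rot]
  rw [this]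
  rfl

theorem universalCover_origin_eq_iff {d₀ : D} {w w' : Word} :
    (M.universalCover d₀).origin (w : Word ⧸ M.nullLoops d₀) = (M.universalCover d₀).origin w' ↔
      ∃ k : ℤ, w'⁻¹ * (CombMap.rot ^ k * w) ∈ M.nullLoops d₀ := by
  have h1 : (M.universalCover d₀).origin (w : Word ⧸ M.nullLoops d₀) =
      (M.universalCover d₀).origin w' ↔ (M.universalCover d₀).σ.SameCycle w w' := Quotient.eq
  rw [h1]
  refine exists_congr fun k => ?_
  rw [← act_rot, ← map_zpow, universalCover_act, eq_comm]
  exact QuotientGroup.eq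

variable (hM : M.IsToroidal) {Γ : M.Cycle} (C : Crossing Γ)

/-- The cocycle of a crossing, on the annulus. -/
def Crossing.lift (x : D × ℤ) : ℤ := C.F x.1

theorem Crossing.lift_α (x : D × ℤ) : C.lift ((annulus Γ).α x) = -C.lift x := C.F_α x.1

theorem Crossing.lift_mem : C.lift ∈ coboundaries (annulus Γ).φ := by
  obtain ⟨t, ht⟩ := C.F_mem
  exact ⟨fun x => t x.1, fun x => by rw [annulus, cover_φ]; exact ht x.1⟩

theorem Crossing.hol_lift (w : Word) (d : D) (n : ℤ) :
    (annulus Γ).hol (primalVoltage C.lift) w (d, n) = M.hol (primalVoltage C.F) w d := by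
  rw [← cover_hol Γ.chain_α (primalVoltage C.F) w d n]
  rfl

include hM in
theorem Crossing.mem_nullLoops_iff {w : Word} {d : D} {n : ℤ} : w ∈ M.nullLoops d ↔
    (annulus Γ).act w (d, n) = (d, n) ∧ (annulus Γ).hol (primalVoltage C.lift) w (d, n) = 0 := by
  rw [annulus, cover_act, Prod.mk.injEq, add_eq_right, ← annulus, C.hol_lift, and_assoc]
  constructor
  · intro h
    have hw := M.act_of_mem_nullLoops h
    exact ⟨hw, (annulus_mem_nullLoops_iff hM C hw).1 h⟩
  · rintro ⟨hw, h⟩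
    exact (annulus_mem_nullLoops_iff hM C hw).2 h

-- The universal cover unrolls the annulus once more along `C.F`. For curves from a fixed dart, a
-- vertex of it amounts to a vertex of the annulus and a value of the cocycle.
include hM in
theorem Crossing.origin_eq_iff {d : D} (n : ℤ) {w w' : Word} :
    (M.universalCover d).origin (w : Word ⧸ M.nullLoops d) = (M.universalCover d).origin w' ↔
      (annulus Γ).σ.SameCycle ((annulus Γ).act w (d, n)) ((annulus Γ).act w' (d, n)) ∧
      (annulus Γ).hol (primalVoltage C.lift) w (d, n) =
        (annulus Γ).hol (primalVoltage C.lift) w' (d, n) := by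
  rw [universalCover_origin_eq_iff, Equiv.Perm.SameCycle, ← exists_and_right]
  refine exists_congr fun k => ?_
  rw [C.mem_nullLoops_iff hM (n := n), ← act_rot, ← map_zpow, map_mul, map_mul, map_inv,
    Equiv.Perm.mul_apply, Equiv.Perm.mul_apply, Equiv.Perm.inv_eq_iff_eq]
  refine and_congr_right fun h => ?_
  rw [hol_mul, hol_mul, hol_inv, hol_rot_zpow_primal, map_mul, Equiv.Perm.mul_apply, h,
    act_inv_apply_self]
  omega

variable (h3 : M.WeaklyThreeConnected) {U V : Set (D × ℤ)} (hT : (annulus Γ).Tight U V)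
include hM C h3 hT

/-- The edge and the constant path are two free paths to the boundary of `U`. They end at the same
vertex with the same cocycle value, so the edge would lift to a loop. -/
theorem not_mixed_α_of_mixed {e : D × ℤ} (h : e ∈ V ∧ e ∉ U)
    (h' : (annulus Γ).α e ∈ V ∧ (annulus Γ).α e ∉ U) (hm : (annulus Γ).Mixed U e) :
    ¬ (annulus Γ).Mixed U ((annulus Γ).α e) := by
  intro hm'
  have hN := annulus_planar hM C
  obtain ⟨d, n⟩ := e
  have h1 : PathIn (annulus Γ) ((annulus Γ).Free U V) (d, n) (CombMap.flip * 1) :=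
    .flip 1 .one (by
      rw [map_one, Equiv.Perm.one_apply]
      exact ⟨⟨h.1, h.2, hT.disj _ hm⟩, h'.1, h'.2, hT.disj _ hm'⟩)
  have h2 : PathIn (annulus Γ) ((annulus Γ).Free U V) (d, n) 1 := .one
  have h4 := hT.sameCycle_of_mixed hN h1 h2 (by simpa [act_flip] using hm') (by simpa using hm)
  have h5 := (C.origin_eq_iff hM n).2 ⟨h4, hT.hol_eq hN h1 h2 h4 C.lift_α C.lift_mem⟩
  refine (h3 d).no_loop ((1 : Word) : Word ⧸ M.nullLoops d) ?_
  rw [← h5, ← act_flip, universalCover_act]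

/-- There is no vertex strictly inside a tight strip. -/
theorem mixed_or_mixed (hU : ∀ x : D × ℤ, x.2 ≤ 0 → x ∈ U) {e : D × ℤ} (he : e ∈ V ∧ e ∉ U) :
    (annulus Γ).Mixed U e ∨ (annulus Γ).Mixed V e := by
  by_contra! hme
  have := hM.finite
  have hN := annulus_planar hM C
  obtain ⟨d, n⟩ := e
  set N := annulus Γ with hNdef
  let K := M.universalCover d
  let mk : Word → K.Vertex := fun w => K.origin (w : Word ⧸ M.nullLoops d)
  have hmk : ∀ {w w'}, mk w = mk w' ↔ N.σ.SameCycle (N.act w (d, n)) (N.act w' (d, n)) ∧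
      N.hol (primalVoltage C.lift) w (d, n) = N.hol (primalVoltage C.lift) w' (d, n) :=
    C.origin_eq_iff hM n
  let I : D × ℤ → Prop := fun x => (x ∈ V ∧ x ∉ U) ∧ ¬ N.Mixed U x ∧ ¬ N.Mixed V x
  have hI : ∀ {x y}, N.σ.SameCycle x y → I x → I y := fun {x y} h hx => by
    refine ⟨⟨(mem_iff_of_not_mixed hx.2.2 h).2 hx.1.1, ?_⟩, ?_, ?_⟩
    · rw [mem_iff_of_not_mixed hx.2.1 h]; exact hx.1.2
    · rw [← mixed_congr h]; exact hx.2.1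
    · rw [← mixed_congr h]; exact hx.2.2
  let Q : Word → Prop := PathIn N (fun x => I x ∧ I (N.α x)) (d, n)
  have hQI : ∀ {p}, Q p → I (N.act p (d, n)) := by
    intro p hp
    induction hp with
    | one => exact ⟨he, hme⟩
    | rot w k _ ih => exact hI ⟨k, by simp [act_rot]⟩ ih
    | flip w _ hx _ => simpa [act_flip] using hx.2
  let S : Set K.Vertex := {v | ∃ p, Q p ∧ mk p = v}
  have hSI : ∀ {w}, mk w ∈ S → I (N.act w (d, n)) := by
    rintro w ⟨p, hp, h⟩
    exact hI (hmk.1 h).1 (hQI hp)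
  let exitU : K.Vertex → Prop := fun u => ∃ p, Q p ∧ N.Mixed U (N.α (N.act p (d, n))) ∧
    mk (CombMap.flip * p) = u
  let exitV : K.Vertex → Prop := fun u => ∃ p, Q p ∧ N.Mixed V (N.α (N.act p (d, n))) ∧
    mk (CombMap.flip * p) = u
  have hfl : ∀ p, N.act (CombMap.flip * p) (d, n) = N.α (N.act p (d, n)) := by simp [act_flip]
  have hin : ∀ {x}, I x → N.α x ∈ V ∧ N.α x ∉ U := fun {x} hx =>
    ⟨(α_mem_iff_of_not_mixed hT.φV hx.2.2).2 hx.1.1, by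
      rw [α_mem_iff_of_not_mixed hT.φU hx.2.1]; exact hx.1.2⟩
  have hstep : ∀ {v u}, v ∈ S → K.graph.Adj v u → u ∈ S ∨ exitU u ∨ exitV u := by
    rintro _ u ⟨p, hp, rfl⟩ ⟨-, x, hx, rfl⟩
    induction x using QuotientGroup.induction_on with
    | H w =>
      obtain ⟨k, hk⟩ := universalCover_origin_eq_iff.1 hx.symm
      have hp' : Q (CombMap.rot ^ k * p) := .rot p k hp
      have h1 : K.origin (K.α (w : Word ⧸ M.nullLoops d)) =
          mk (CombMap.flip * (CombMap.rot ^ k * p)) := by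
        rw [QuotientGroup.eq.2 hk, ← act_flip, universalCover_act]
      rw [h1]
      by_cases hU' : N.Mixed U (N.α (N.act (CombMap.rot ^ k * p) (d, n)))
      · exact .inr (.inl ⟨_, hp', hU', rfl⟩)
      by_cases hV' : N.Mixed V (N.α (N.act (CombMap.rot ^ k * p) (d, n)))
      · exact .inr (.inr ⟨_, hp', hV', rfl⟩)
      have h2 := hQI hp'
      exact .inl ⟨_, .flip _ hp' ⟨h2, hin h2, hU', hV'⟩, rfl⟩
  -- All exits from `S` through the boundary of `U` lead to one vertex of the universal cover,
  -- because the paths are free and both their end and their cocycle value are determined. The next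
  -- claim is its mirror image.
  have hUeq : ∀ {u u'}, exitU u → exitU u' → u = u' := by
    rintro _ _ ⟨p, hp, hpm, rfl⟩ ⟨p', hp', hpm', rfl⟩
    have hfree : ∀ {p}, Q p → N.Mixed U (N.α (N.act p (d, n))) →
        PathIn N (N.Free U V) (d, n) (CombMap.flip * p) := fun {p} hp hpm =>
      .flip p (PathIn.mono (fun x hx => ⟨⟨hx.1.1.1, hx.1.1.2, hx.1.2.2⟩, hx.2.1.1, hx.2.1.2,
        hx.2.2.2⟩) hp)
        ⟨⟨(hQI hp).1.1, (hQI hp).1.2, (hQI hp).2.2⟩, (hin (hQI hp)).1, (hin (hQI hp)).2,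
          hT.disj _ hpm⟩
    have h1 := hT.sameCycle_of_mixed hN (hfree hp hpm) (hfree hp' hpm') (by rwa [hfl])
      (by rwa [hfl])
    exact hmk.2 ⟨h1, hT.hol_eq hN (hfree hp hpm) (hfree hp' hpm') h1 C.lift_α C.lift_mem⟩
  have hVeq : ∀ {u u'}, exitV u → exitV u' → u = u' := by
    rintro _ _ ⟨p, hp, hpm, rfl⟩ ⟨p', hp', hpm', rfl⟩
    have hfree : ∀ {p}, Q p → N.Mixed V (N.α (N.act p (d, n))) →
        PathIn N (N.Free Vᶜ Uᶜ) (d, n) (CombMap.flip * p) := fun {p} hp hpm =>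
      .flip p (PathIn.mono (fun x hx => by
          simpa [Free] using ⟨⟨hx.1.1.2, hx.1.1.1, hx.1.2.1⟩, hx.2.1.2, hx.2.1.1, hx.2.2.1⟩) hp)
        (by
          simpa [Free] using ⟨⟨(hQI hp).1.2, (hQI hp).1.1, (hQI hp).2.1⟩, (hin (hQI hp)).2,
            (hin (hQI hp)).1, fun h => hT.disj _ h hpm⟩)
    have h1 := hT.compl.sameCycle_of_mixed hN (hfree hp hpm) (hfree hp' hpm')
      (by rw [hfl]; exact mixed_compl.2 hpm) (by rw [hfl]; exact mixed_compl.2 hpm')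
    exact hmk.2 ⟨h1, hT.compl.hol_eq hN (hfree hp hpm) (hfree hp' hpm') h1 C.lift_α C.lift_mem⟩
  obtain ⟨q, hq⟩ := annulus_connected hM C (d, n) (Γ.dart 0, 0)
  have hγ : N.act Γ.curve.word (Γ.dart 0, 0) = (Γ.dart 0, 0) := by
    rw [hNdef, annulus, cover_act]
    have h1 := Γ.hol_chain_curve
    have h2 := Γ.curve.closed
    change M.hol _ _ (Γ.dart 0) = 0 at h1
    change M.act _ (Γ.dart 0) = Γ.dart 0 at h2
    rw [h1, h2, zero_add]
  have hγF : N.hol (primalVoltage C.lift) Γ.curve.word (Γ.dart 0, 0) = 1 := by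
    rw [hNdef, C.hol_lift]
    exact C.hol_F
  -- Lifts of one vertex of the annulus at level `0`, hence outside `S`. The value `1` of the
  -- cocycle on `Γ` makes them pairwise distinct, so one of them avoids the two exits.
  let far : ℤ → K.Vertex := fun j => mk (Γ.curve.word ^ j * q)
  have hact : ∀ j : ℤ, N.act (Γ.curve.word ^ j * q) (d, n) = (Γ.dart 0, 0) := fun j => by
    rw [map_mul, Equiv.Perm.mul_apply, hq, act_zpow_of_mem_loops hγ]
  have hfar : ∀ j, far j ∉ S := fun j h => by
    have h1 := hSI h
    rw [hact] at h1
    exact h1.1.2 (hU _ le_rfl)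
  have hfarinj : ∀ {i j}, far i = far j → i = j := by
    intro i j h
    have h1 := (hmk.1 h).2
    rw [hol_mul, hol_mul, hq, hol_zpow_of_mem_loops _ hγ, hol_zpow_of_mem_loops _ hγ, hγF] at h1
    simpa using h1
  -- If there is no exit on this side, any vertex outside `S` serves.
  obtain ⟨a, haS, ha⟩ : ∃ a, a ∉ S ∧ ∀ u, exitU u → u = a := by
    by_cases h : ∃ u, exitU u
    · obtain ⟨u, hu⟩ := h
      refine ⟨u, ?_, fun u' hu' => hUeq hu' hu⟩
      obtain ⟨p, -, hpm, rfl⟩ := hu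
      intro h
      have := (hSI h).2.1
      rw [hfl] at this
      exact this hpm
    · exact ⟨far 0, hfar 0, fun u hu => absurd ⟨u, hu⟩ h⟩
  obtain ⟨b, hbS, hb⟩ : ∃ b, b ∉ S ∧ ∀ u, exitV u → u = b := by
    by_cases h : ∃ u, exitV u
    · obtain ⟨u, hu⟩ := h
      refine ⟨u, ?_, fun u' hu' => hVeq hu' hu⟩
      obtain ⟨p, -, hpm, rfl⟩ := hu
      intro h
      have := (hSI h).2.2
      rw [hfl] at this
      exact this hpm
    · exact ⟨far 0, hfar 0, fun u hu => absurd ⟨u, hu⟩ h⟩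
  obtain ⟨j, hja, hjb⟩ : ∃ j, far j ≠ a ∧ far j ≠ b := by
    obtain ⟨v, ⟨j, rfl⟩, hv⟩ := (Set.infinite_range_of_injective fun _ _ => hfarinj).exists_notMem_finite
      (Set.toFinite {a, b})
    simp only [Set.mem_insert_iff, Set.mem_singleton_iff, not_or] at hv
    exact ⟨j, hv⟩
  have h1S : mk 1 ∈ S := ⟨1, .one, rfl⟩
  -- Deleting the two exits `a`, `b` would separate `mk 1` from `far j`.
  have hreach := ((h3 d).connected a b).preconnected
    ⟨mk 1, fun h => haS (h ▸ h1S), fun h => hbS (h ▸ h1S)⟩ ⟨far j, hja, hjb⟩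
  obtain ⟨walk⟩ := hreach
  have key : ∀ {x y : {x // x ≠ a ∧ x ≠ b}}, (K.graph.induce {x | x ≠ a ∧ x ≠ b}).Walk x y →
      x.1 ∈ S → y.1 ∈ S := by
    intro x y p
    induction p with
    | nil => exact id
    | @cons x z y h _ ih =>
      intro hx
      refine ih ?_
      rcases hstep hx h with h1 | h1 | h1
      · exact h1
      · exact absurd (ha _ h1) z.2.1
      · exact absurd (hb _ h1) z.2.2
  exact hfar j (key walk h1S)

end ThreeConnected

end CombMap

namespace CombMap

theorem eq_of_sameCycle {E β : Type*} {ψ : Equiv.Perm E} {f : E → β} (h : ∀ e, f (ψ e) = f e)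
    {x y : E} (hxy : ψ.SameCycle x y) : f y = f x := by
  obtain ⟨k, rfl⟩ := hxy
  induction k generalizing x with
  | zero => simp
  | succ k ih => rw [add_comm, zpow_add, zpow_one, Equiv.Perm.mul_apply, h, ih]
  | pred k ih =>
    have := h ((ψ ^ (-(k : ℤ) - 1)) x)
    rw [← this, ← Equiv.Perm.mul_apply, ← zpow_one_add, show 1 + (-(k : ℤ) - 1) = -k by ring, ih]

/-! ### Thin strips and their dual cycle. -/

section Thin

variable {E : Type*} {N : CombMap E}

variable (N) in
/-- A tight strip without vertices inside and whose inside edges join both boundaries. -/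
structure Thin (U V : Set E) : Prop extends N.Tight U V where
  mixed_or : ∀ e ∈ V \ U, N.Mixed U e ∨ N.Mixed V e
  not_mixedU : ∀ e ∈ V \ U, N.α e ∈ V \ U → N.Mixed U e → ¬ N.Mixed U (N.α e)
  not_mixedV : ∀ e ∈ V \ U, N.α e ∈ V \ U → N.Mixed V e → ¬ N.Mixed V (N.α e)

theorem mem_compl_sdiff_compl {U V : Set E} {e : E} : e ∈ Uᶜ \ Vᶜ ↔ e ∈ V \ U := by
  simp [and_comm]

theorem Thin.compl {U V : Set E} (h : N.Thin U V) : N.Thin Vᶜ Uᶜ where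
  toTight := h.toTight.compl
  mixed_or e he := by
    rw [mixed_compl, mixed_compl]
    exact (h.mixed_or e (mem_compl_sdiff_compl.1 he)).symm
  not_mixedU e he he' := by
    rw [mixed_compl, mixed_compl]
    exact h.not_mixedV e (mem_compl_sdiff_compl.1 he) (mem_compl_sdiff_compl.1 he')
  not_mixedV e he he' := by
    rw [mixed_compl, mixed_compl]
    exact h.not_mixedU e (mem_compl_sdiff_compl.1 he) (mem_compl_sdiff_compl.1 he')

variable (N) in
/-- The darts inside a strip that go from the first boundary to the second one. -/
def crossDarts (U V : Set E) : Set E :=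
  {e | e ∈ V \ U ∧ N.α e ∈ V \ U ∧ N.Mixed U e ∧ N.Mixed V (N.α e)}

theorem mem_crossDarts_compl {U V : Set E} {e : E} :
    e ∈ N.crossDarts Vᶜ Uᶜ ↔ N.α e ∈ N.crossDarts U V := by
  change _ ∈ _ ∧ _ ∈ _ ∧ _ ∧ _ ↔ _ ∈ _ ∧ _ ∈ _ ∧ _ ∧ _
  rw [mem_compl_sdiff_compl, mem_compl_sdiff_compl, mixed_compl, mixed_compl, N.α_invol]
  tauto

section

variable {U V : Set E} (hT : N.Thin U V)
include hT

theorem Thin.mem_diff_iff {x y : E} (h : N.φ.SameCycle x y) : y ∈ V \ U ↔ x ∈ V \ U :=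
  and_congr (mem_iff_of_sameCycle hT.φV h) (not_congr (mem_iff_of_sameCycle hT.φU h))

/-- An edge with a side in the strip is either inside the strip or on one of its boundaries. -/
theorem Thin.α_cases {e : E} (he : e ∈ V \ U) : N.α e ∈ V \ U ∨
    (N.α e ∈ N.bd U ∧ N.Mixed U e ∧ N.Mixed U (N.α e)) ∨
    (e ∈ N.bd V ∧ N.Mixed V e ∧ N.Mixed V (N.α e)) := by
  by_cases hU : N.α e ∈ U
  · have h : N.α e ∈ N.bd U := ⟨hU, by rw [N.α_invol]; exact he.2⟩
    have h' := mixed_of_mem_bd hT.φU h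
    rw [N.α_invol] at h'
    exact .inr (.inl ⟨h, h'.2, h'.1⟩)
  by_cases hV : N.α e ∈ V
  · exact .inl ⟨hV, hU⟩
  · have h : e ∈ N.bd V := ⟨he.1, hV⟩
    exact .inr (.inr ⟨h, mixed_of_mem_bd hT.φV h⟩)

theorem Thin.mem_crossDarts_or {e : E} (he : e ∈ V \ U) (he' : N.α e ∈ V \ U) :
    e ∈ N.crossDarts U V ∨ N.α e ∈ N.crossDarts U V := by
  rcases hT.mixed_or e he with h | h
  · exact .inl ⟨he, he', h, (hT.mixed_or _ he').resolve_left (hT.not_mixedU e he he' h)⟩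
  · refine .inr ⟨he', by rwa [N.α_invol], ?_, by rwa [N.α_invol]⟩
    exact (hT.mixed_or _ he').resolve_right (hT.not_mixedV e he he' h)

/-- If all vertices of the face were on the boundary of `U`, the edge of `e` could neither be inside
the strip, having both ends there, nor lie on the boundary of `V`. On the boundary of `U`, tightness
provides a vertex on the other one. -/
theorem Thin.exists_mixedV {e : E} (he : e ∈ V \ U) : ∃ x, N.φ.SameCycle e x ∧ N.Mixed V x := by
  by_contra! hc
  have hmU : ∀ x, N.φ.SameCycle e x → N.Mixed U x := fun x hx =>
    (hT.mixed_or x ((hT.mem_diff_iff hx).2 he)).resolve_right (hc x hx)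
  rcases hT.α_cases he with h | h | h
  · refine hT.not_mixedU e he h (hmU e (.refl _ _)) ?_
    rw [mixed_congr (sameCycle_α_φ e)]
    exact hmU _ ⟨1, rfl⟩
  · obtain ⟨x, hx, hx'⟩ := hT.touchV _ h.1
    rw [N.α_invol] at hx
    exact hc x hx hx'
  · exact hc e (.refl _ _) h.2.1

theorem Thin.exists_mixedU {e : E} (he : e ∈ V \ U) : ∃ x, N.φ.SameCycle e x ∧ N.Mixed U x := by
  obtain ⟨x, hx, hx'⟩ := hT.compl.exists_mixedV (mem_compl_sdiff_compl.2 he)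
  exact ⟨x, hx, mixed_compl.1 hx'⟩

/-- Every face of the strip is left by an edge that goes to the second boundary. -/
theorem Thin.exists_mem_crossDarts (hN : N.Planar) {e : E} (he : e ∈ V \ U) :
    ∃ x ∈ N.crossDarts U V, N.φ.SameCycle e x := by
  obtain ⟨a, ha, haU⟩ := hT.exists_mixedU he
  obtain ⟨b, hb, hbV⟩ := hT.exists_mixedV he
  -- Going round the face from the first boundary to the second, some dart has its origin, but not
  -- its end, on the first.
  obtain ⟨x, hx, hxU, hxU'⟩ : ∃ x, N.φ.SameCycle e x ∧ N.Mixed U x ∧ ¬ N.Mixed U (N.φ x) := by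
    by_contra! hc
    exact hT.disj b (mem_of_sameCycle_of_isOfFinOrder hN.finφ
      (P := fun x => N.φ.SameCycle e x ∧ N.Mixed U x)
      (fun c h => ⟨Equiv.Perm.sameCycle_apply_right.2 h.1, hc c h.1 h.2⟩) (ha.symm.trans hb)
      ⟨ha, haU⟩).2 hbV
  rw [← mixed_congr (sameCycle_α_φ x)] at hxU'
  have hxm := (hT.mem_diff_iff hx).2 he
  rcases hT.α_cases hxm with h | h | h
  · exact ⟨x, ⟨hxm, h, hxU, (hT.mixed_or _ h).resolve_left hxU'⟩, hx⟩
  · exact absurd h.2.2 hxU'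
  · exact absurd h.2.1 (hT.disj x hxU)

theorem Thin.exists_α_mem_crossDarts (hN : N.Planar) {e : E} (he : e ∈ V \ U) :
    ∃ x, N.α x ∈ N.crossDarts U V ∧ N.φ.SameCycle e x := by
  obtain ⟨x, hx, hx'⟩ := hT.compl.exists_mem_crossDarts hN (mem_compl_sdiff_compl.2 he)
  exact ⟨x, mem_crossDarts_compl.1 hx, hx'⟩

theorem Thin.nonempty (hN : N.Planar) : (V \ U).Nonempty := by
  obtain ⟨d, hd⟩ := hN.bd_nonempty hT.φU hT.neU hT.neU'
  refine ⟨N.α d, ?_, hd.2⟩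
  by_contra h
  exact hT.disj d (mixed_of_mem_bd hT.φU hd).1 (mixed_of_mem_bd hT.φV ⟨hT.sub hd.1, h⟩).1

end

/-- A function on the vertices that is constant along the edges of the boundary of a region is
constant on this boundary. -/
theorem eq_of_mixed (hN : N.Planar) {U : Set E} (hφ : ∀ e, N.φ e ∈ U ↔ e ∈ U) {c : N.Cycle}
    (hc : ∀ d, c.HasDart d ↔ d ∈ N.bd U) {q : E → ℤ} (hq : ∀ e, q (N.σ e) = q e)
    (hqα : ∀ e ∈ N.bd U, q (N.α e) = q e) {x y : E} (hx : N.Mixed U x) (hy : N.Mixed U y) :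
    q x = q y := by
  have key : ∀ x, N.Mixed U x → q x = q (c.dart 0) := by
    intro x hx
    obtain ⟨d, hd, hd'⟩ := hN.exists_mem_bd hφ hx
    obtain ⟨i, rfl⟩ := (hc d).2 hd
    rw [← eq_of_sameCycle hq hd']
    refine eq_of_forall_succ (u := fun i => q (c.dart i)) (fun i => ?_) i
    rw [eq_of_sameCycle hq (c.next i)]
    exact hqα _ ((hc _).1 (c.hasDart_dart i))
  rw [key x hx, key y hy]

/-- The inside edges of a thin strip form a cycle of the dual map. -/
theorem Thin.exists_dual_cycle (hN : N.Planar) {U V : Set E} (hT : N.Thin U V) :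
    ∃ c : N.dual.Cycle, ∀ d, c.HasDart d ↔ N.α d ∈ N.crossDarts U V := by
  obtain ⟨c₁, hc₁⟩ := hN.exists_cycle_bd hT.φU hT.connU hT.connU' hT.neU hT.neU' hT.finU
  obtain ⟨c₂, hc₂⟩ := hN.exists_cycle_bd hT.φV hT.connV hT.connV' hT.neV' hT.neV hT.finV
  obtain ⟨e₀, he₀⟩ := hT.nonempty hN
  obtain ⟨x₀, hx₀, -⟩ := hT.exists_α_mem_crossDarts hN he₀
  have hX : (N.crossDarts U V).Finite := hT.fin.subset fun e he => he.1
  -- The darts run from the second boundary to the first. Their dual darts, crossing them from left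
  -- to right, then follow the direction of the boundaries, which keep `U` and `V` on their left.
  refine exists_cycle_of_set (N := N.dual) (B := {d | N.α d ∈ N.crossDarts U V})
    (hX.preimage N.α.injective.injOn) ⟨x₀, hx₀⟩ (fun d hd h => ?_) (fun d hd => ?_)
    (fun z hz hz' hsupp x hx y hy => ?_)
  · have h1 : N.α (N.α d) ∈ N.crossDarts U V := h
    rw [N.α_invol] at h1
    exact hT.disj d h1.2.2.1 (by have := hd.2.2.2; rwa [N.α_invol] at this)
  · obtain ⟨x, hx, hx'⟩ := hT.exists_α_mem_crossDarts hN hd.1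
    exact ⟨x, hx, hx'⟩
  · have hsupp' : ∀ e, z e ≠ 0 → N.α e ∈ N.crossDarts U V ∨ e ∈ N.crossDarts U V := by
      intro e he
      refine (hsupp e he).imp id fun h => ?_
      have h1 : N.α (N.α e) ∈ N.crossDarts U V := h
      rwa [N.α_invol] at h1
    -- A closed dual chain on the inside edges is the jump of a function on vertices. It has no jump
    -- along the boundary edges, so it is constant on each boundary.
    obtain ⟨q, hq, hq'⟩ := hN.cojordan z hz hz'
      (((hX.preimage N.α.injective.injOn).union hX).subset hsupp')
    have h1 : ∀ e ∈ N.bd U, q (N.α e) = q e := by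
      intro e he
      have : z e = 0 := by
        by_contra hc
        rcases hsupp' e hc with h | h
        · have := h.2.1.2
          rw [N.α_invol] at this
          exact this he.1
        · exact h.1.2 he.1
      linarith [hq' e]
    have h2 : ∀ e ∈ N.bd V, q (N.α e) = q e := by
      intro e he
      have : z e = 0 := by
        by_contra hc
        rcases hsupp' e hc with h | h
        · exact he.2 h.1.1
        · exact he.2 h.2.1.1
      linarith [hq' e]
    have h3 := eq_of_mixed hN hT.φU hc₁ hq h1 hx.2.2.1 hy.2.2.1
    have hx' := hx.2.2.2
    have hy' := hy.2.2.2
    rw [N.α_invol] at hx' hy'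
    have h4 := eq_of_mixed hN hT.φV hc₂ hq h2 hx' hy'
    rw [hq', hq', h3, h4]

theorem sum_φ_eq {P P' : Finset E} (h : ∀ e, N.φ e ∈ P' ↔ e ∈ P) (t : E → ℤ) :
    ∑ e ∈ P, t (N.φ e) = ∑ e ∈ P', t e :=
  Finset.sum_bij (fun e _ => N.φ e) (fun e he => (h e).2 he) (fun a _ b _ h => N.φ.injective h)
    (fun e he => ⟨N.φ.symm e, (h _).1 (by simpa using he), by simp⟩) fun _ _ => rfl

/-- A cocycle takes the same value on the dual cycle of a thin strip and on the boundary. -/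
theorem Thin.sum_eq {U V : Set E} (hT : N.Thin U V) {F t : E → ℤ} (hF : ∀ e, F (N.α e) = -F e)
    (ht : ∀ e, F e = t (N.φ e) - t e) {Y B : Finset E}
    (hY : ∀ e, e ∈ Y ↔ N.α e ∈ N.crossDarts U V) (hB : ∀ e, e ∈ B ↔ e ∈ N.bd U) :
    ∑ e ∈ Y, (t (N.φ e) - t (N.α e)) = ∑ e ∈ B, F e := by
  classical
  let X := Y.map N.α.toEmbedding
  let Q := B.map N.α.toEmbedding
  have hX : ∀ e, e ∈ X ↔ e ∈ N.crossDarts U V := fun e => by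
    simp only [X, Finset.mem_map_equiv]
    rw [hY, Equiv.apply_symm_apply]
  have hQ : ∀ e, e ∈ Q ↔ N.α e ∈ N.bd U := fun e => by
    have : N.α.symm e = N.α e := by rw [Equiv.symm_apply_eq, N.α_invol]
    simp only [Q, Finset.mem_map_equiv]
    rw [hB, this]
  have hQU : ∀ e ∈ Q, e ∈ V \ U ∧ N.α e ∈ U ∧ N.Mixed U e ∧ N.Mixed U (N.α e) := by
    intro e he
    have h := (hQ e).1 he
    have h' := mixed_of_mem_bd hT.φU h
    have h2 := h.2
    rw [N.α_invol] at h' h2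
    refine ⟨⟨?_, h2⟩, h.1, h'.2, h'.1⟩
    by_contra hV
    refine hT.disj e h'.2 (mixed_of_mem_of_notMem hT.φV (.inr ⟨hV, hT.sub h.1⟩))
  have hQY : Disjoint Q Y := Finset.disjoint_left.2 fun e he he' =>
    ((hY e).1 he').1.2 (hQU e he).2.1
  have hQX : Disjoint Q X := Finset.disjoint_left.2 fun e he he' =>
    ((hX e).1 he').2.1.2 (hQU e he).2.1
  -- `φ` maps the darts of the strip that end on the boundary of `U` bijectively onto those that
  -- start there. The reversed boundary edges `Q` occur in both sets, the inside edges as `Y` in one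
  -- and as `X` in the other.
  have hP : ∀ e, e ∈ Q ∪ Y ↔ e ∈ V \ U ∧ N.Mixed U (N.α e) := by
    intro e
    rw [Finset.mem_union]
    constructor
    · rintro (h | h)
      · exact ⟨(hQU e h).1, (hQU e h).2.2.2⟩
      · have h' := (hY e).1 h
        have := h'.2.1
        rw [N.α_invol] at this
        exact ⟨this, h'.2.2.1⟩
    · rintro ⟨h, h'⟩
      rcases hT.α_cases h with h1 | h1 | h1
      · right
        rw [hY]
        refine ⟨h1, by rwa [N.α_invol], h', ?_⟩
        refine (hT.mixed_or _ (by rwa [N.α_invol])).resolve_left (hT.not_mixedU _ h1 ?_ h')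
        rwa [N.α_invol]
      · exact .inl ((hQ e).2 h1.1)
      · exact absurd h1.2.2 (hT.disj _ h')
  have hP' : ∀ e, e ∈ Q ∪ X ↔ e ∈ V \ U ∧ N.Mixed U e := by
    intro e
    rw [Finset.mem_union]
    constructor
    · rintro (h | h)
      · exact ⟨(hQU e h).1, (hQU e h).2.2.1⟩
      · have h' := (hX e).1 h
        exact ⟨h'.1, h'.2.2.1⟩
    · rintro ⟨h, h'⟩
      rcases hT.α_cases h with h1 | h1 | h1
      · right
        rw [hX]
        exact ⟨h, h1, h', (hT.mixed_or _ h1).resolve_left (hT.not_mixedU _ h h1 h')⟩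
      · exact .inl ((hQ e).2 h1.1)
      · exact absurd h1.2.1 (hT.disj _ h')
  have h1 : ∑ e ∈ Q ∪ Y, t (N.φ e) = ∑ e ∈ Q ∪ X, t e := by
    refine sum_φ_eq (fun e => ?_) t
    rw [hP, hP', mixed_congr (sameCycle_α_φ e), hT.mem_diff_iff (x := e) (y := N.φ e) ⟨1, rfl⟩]
  rw [Finset.sum_union hQY, Finset.sum_union hQX] at h1
  have h2 : ∑ e ∈ X, t e = ∑ e ∈ Y, t (N.α e) := by simp [X]
  have h3 : ∑ e ∈ Q, (t (N.φ e) - t e) = -∑ e ∈ B, F e := by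
    simp only [← ht, Q, Finset.sum_map, Equiv.coe_toEmbedding, hF, Finset.sum_neg_distrib]
  rw [Finset.sum_sub_distrib] at h3 ⊢
  linarith

/-- A cocycle takes the same value on the boundaries of two regions with a finite difference. -/
theorem sum_bd_eq {U V : Set E} (hU : ∀ e, N.φ e ∈ U ↔ e ∈ U) (hV : ∀ e, N.φ e ∈ V ↔ e ∈ V)
    (hsub : U ⊆ V) (hfin : (V \ U).Finite) {F : E → ℤ} (hF : ∀ e, F (N.α e) = -F e)
    (hF' : F ∈ coboundaries N.φ) {A B : Finset E} (hA : ∀ e, e ∈ A ↔ e ∈ N.bd U)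
    (hB : ∀ e, e ∈ B ↔ e ∈ N.bd V) : ∑ e ∈ A, F e = ∑ e ∈ B, F e := by
  classical
  obtain ⟨t, ht⟩ := hF'
  let W := hfin.toFinset
  have hW : ∀ e, e ∈ W ↔ e ∈ V ∧ e ∉ U := fun e => hfin.mem_toFinset
  have h0 : ∑ e ∈ W, F e = 0 := by
    simp only [ht, Finset.sum_sub_distrib]
    rw [sum_φ_eq (P := W) (P' := W) (fun e => by rw [hW, hW, hU, hV]), sub_self]
  have h1 : ∑ e ∈ W with N.α e ∈ W, F e = 0 := by
    refine Finset.sum_involution (fun e _ => N.α e) (fun e _ => by rw [hF]; ring)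
      (fun e _ _ => N.α_ne e) (fun e he => ?_) (fun e _ => N.α_invol e)
    rw [Finset.mem_filter] at he ⊢
    rw [N.α_invol]
    exact he.symm
  have h2 : ∑ e ∈ W with N.α e ∈ U, F e = -∑ e ∈ A with N.α e ∈ V, F e := by
    rw [← Finset.sum_neg_distrib]
    refine Finset.sum_bij (fun e _ => N.α e) (fun e he => ?_) (fun a _ b _ h => N.α.injective h)
      (fun e he => ⟨N.α e, ?_, N.α_invol e⟩) (fun e _ => by rw [hF, neg_neg])
    · rw [Finset.mem_filter, hW] at he
      rw [Finset.mem_filter, hA, N.α_invol]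
      exact ⟨⟨he.2, by rw [N.α_invol]; exact he.1.2⟩, he.1.1⟩
    · rw [Finset.mem_filter, hA] at he
      rw [Finset.mem_filter, hW, N.α_invol]
      exact ⟨⟨he.2, he.1.2⟩, he.1.1⟩
  have h3 : ∑ e ∈ W with N.α e ∉ V, F e = ∑ e ∈ B with e ∉ U, F e := by
    congr 1
    ext e
    rw [Finset.mem_filter, Finset.mem_filter, hW, hB]
    exact ⟨fun h => ⟨⟨h.1.1, h.2⟩, h.1.2⟩, fun h => ⟨⟨h.1.1, h.2⟩, h.1.2⟩⟩
  -- Darts common to both boundaries do not border `V \ U` and are matched with themselves.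
  have h4 : ∑ e ∈ A with N.α e ∉ V, F e = ∑ e ∈ B with e ∈ U, F e := by
    congr 1
    ext e
    rw [Finset.mem_filter, Finset.mem_filter, hA, hB]
    exact ⟨fun h => ⟨⟨hsub h.1.1, h.2⟩, h.1.1⟩, fun h => ⟨⟨h.2, fun h' => h.1.2 (hsub h')⟩, h.1.2⟩⟩
  have h5 : ∑ e ∈ W, F e = ∑ e ∈ W with N.α e ∈ W, F e + ∑ e ∈ W with N.α e ∈ U, F e +
      ∑ e ∈ W with N.α e ∉ V, F e := by
    rw [Finset.sum_filter, Finset.sum_filter, Finset.sum_filter, ← Finset.sum_add_distrib,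
      ← Finset.sum_add_distrib]
    refine Finset.sum_congr rfl fun e _ => ?_
    by_cases hu : N.α e ∈ U
    · simp [hW, hu, hsub hu]
    · by_cases hv : N.α e ∈ V <;> simp [hW, hu, hv]
  have h6 := Finset.sum_filter_add_sum_filter_not A (fun e => N.α e ∈ V) F
  have h7 := Finset.sum_filter_add_sum_filter_not B (fun e => e ∈ U) F
  linarith

end Thin

end CombMap

namespace CombMap

/-! ### The strip between two lifts, and projection to the torus. -/

section AnnulusStrip

variable {D : Type*} {M : CombMap D} {Γ : M.Cycle}

theorem annulus_σ_zpow (k : ℤ) (x : D × ℤ) : ((annulus Γ).σ ^ k) x =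
    ((M.σ ^ k) x.1, M.hol (M.dualVoltage Γ.chain) (CombMap.rot ^ k) x.1 + x.2) :=
  cover_σ_zpow _ k x

theorem annulus_φ_zpow (k : ℤ) (x : D × ℤ) : ((annulus Γ).φ ^ k) x = ((M.φ ^ k) x.1, x.2) :=
  cover_φ_zpow _ k x

theorem sameCycle_of_annulus {x y : D × ℤ} (h : (annulus Γ).σ.SameCycle x y) :
    M.σ.SameCycle x.1 y.1 := by
  obtain ⟨k, rfl⟩ := h
  exact ⟨k, by rw [annulus_σ_zpow]⟩

/-- Turns around a vertex that return to the same dart of the torus have zero holonomy, so they do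
not change the level. -/
theorem eq_of_sameCycle_annulus {x y : D × ℤ} (h : (annulus Γ).σ.SameCycle x y) (h1 : x.1 = y.1) :
    x = y := by
  obtain ⟨k, rfl⟩ := h
  rw [annulus_σ_zpow] at h1 ⊢
  have h2 : M.hol (M.dualVoltage Γ.chain) (CombMap.rot ^ k) x.1 = 0 :=
    Γ.flat_chain.hol_local (.inl ⟨k, rfl⟩) (by rw [map_zpow, act_rot]; exact h1.symm)
  rw [h2, zero_add]
  exact Prod.ext h1 rfl

theorem sameCycle_annulus_shift {d d' : D} {n n' : ℤ} (s : ℤ)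
    (h : (annulus Γ).σ.SameCycle (d, n) (d', n')) :
    (annulus Γ).σ.SameCycle (d, n + s) (d', n' + s) := by
  obtain ⟨k, hk⟩ := h
  refine ⟨k, ?_⟩
  rw [annulus_σ_zpow, Prod.mk.injEq] at hk ⊢
  exact ⟨hk.1, by rw [← hk.2, add_assoc]⟩

@[simp] theorem annulus_φ (x : D × ℤ) : (annulus Γ).φ x = (M.φ x.1, x.2) := cover_φ _ x

@[simp] theorem annulus_α (x : D × ℤ) : (annulus Γ).α x = (M.α x.1, Γ.chain x.1 + x.2) := rfl

/-- A single level is the torus cut along `Γ`, which is connected, and `Γ.dart 0` leads from each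
level to the next. -/
theorem conn_levels (hM : M.IsToroidal) (hΓ : ¬ Γ.curve.Contractible) {I : Set ℤ}
    (hI : I.OrdConnected) : (annulus Γ).Conn {x | x.2 ∈ I} := by
  intro S hS
  have hslice : ∀ n ∈ I, ∀ d d', (d, n) ∈ S → (d', n) ∈ S := by
    intro n hn d d' hd
    refine hM.cut_connected (Γ := Γ) hΓ (S := {d | (d, n) ∈ S}) (fun d => ?_) (fun d h => ?_) hd d'
    · have := hS.1 (d, n) hn
      rwa [annulus_φ] at this
    · have h2 : (annulus Γ).α (d, n) = (M.α d, n) := by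
        rw [annulus_α, Γ.chain_of_not_hasEdge h, zero_add]
      have := hS.2 (d, n) hn (by rw [h2]; exact hn)
      rwa [h2] at this
  have hsucc : ∀ n ∈ I, n + 1 ∈ I → ∀ d d', (d, n) ∈ S ↔ (d', n + 1) ∈ S := by
    intro n hn hn' d d'
    have h2 : (annulus Γ).α (Γ.dart 0, n) = (M.α (Γ.dart 0), n + 1) := by
      rw [annulus_α, Γ.chain_of_hasDart (Γ.hasDart_dart 0)]
      exact Prod.ext rfl (add_comm 1 n)
    have h3 := hS.2 (Γ.dart 0, n) hn (by rw [h2]; exact hn')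
    rw [h2] at h3
    exact ⟨fun h => hslice _ hn' _ _ (h3.2 (hslice _ hn _ _ h)),
      fun h => hslice _ hn _ _ (h3.1 (hslice _ hn' _ _ h))⟩
  have hle : ∀ a ∈ I, ∀ b, a ≤ b → b ∈ I → ∀ d d', (d, a) ∈ S ↔ (d', b) ∈ S := by
    intro a ha b hab
    induction b, hab using Int.leInduction with
    | base => exact fun _ d d' => ⟨hslice a ha d d', hslice a ha d' d⟩
    | succ b hab ih =>
      intro hb d d'
      have hb' : b ∈ I := hI.out ha hb ⟨hab, by omega⟩
      exact (ih hb' d d').trans (hsucc b hb' hb d' d')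
  rintro ⟨d, a⟩ ha ⟨d', b⟩ hb h
  rcases le_total a b with hab | hab
  · exact (hle a ha b hab hb d d').1 h
  · exact (hle b hb a hab ha d' d).2 h

/-- The darts up to a level. -/
def below (D : Type*) (m : ℤ) : Set (D × ℤ) := {x | x.2 ≤ m}

theorem mem_bd_below {m : ℤ} {x : D × ℤ} :
    x ∈ (annulus Γ).bd (below D m) ↔ Γ.HasDart x.1 ∧ x.2 = m := by
  have h1 := abs_le.1 (Γ.abs_chain_le x.1)
  rw [Γ.hasDart_iff_chain]
  change x.2 ≤ m ∧ ¬ Γ.chain x.1 + x.2 ≤ m ↔ _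
  omega

/-- This strip is a copy of the torus cut along `Γ`. Its boundaries are consecutive lifts of `Γ`,
which share no vertex because `Γ` is simple and a turn around a vertex never returns to a dart at
another level. -/
theorem strip_below (hM : M.IsToroidal) (hΓ : ¬ Γ.curve.Contractible)
    (hN : (annulus Γ).Planar) : (annulus Γ).Strip (below D 0) (below D 1) where
  φU e := by rw [annulus_φ]; rfl
  φV e := by rw [annulus_φ]; rfl
  sub x hx := (show x.2 ≤ 0 from hx).trans zero_le_one
  connU := conn_levels hM hΓ Set.ordConnected_Iic
  connU' := by
    have := conn_levels hM hΓ (Set.ordConnected_Ioi (a := 0))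
    convert this using 1
    ext x
    change ¬ x.2 ≤ 0 ↔ 0 < x.2
    exact not_le
  connV := conn_levels hM hΓ Set.ordConnected_Iic
  connV' := by
    have := conn_levels hM hΓ (Set.ordConnected_Ioi (a := 1))
    convert this using 1
    ext x
    change ¬ x.2 ≤ 1 ↔ 1 < x.2
    exact not_le
  disj e h0 h1 := by
    obtain ⟨x, hx, hex⟩ := hN.exists_mem_bd (fun e => by rw [annulus_φ]; rfl) h0
    obtain ⟨y, hy, hey⟩ := hN.exists_mem_bd (fun e => by rw [annulus_φ]; rfl) h1
    obtain ⟨⟨i, hi⟩, hx0⟩ := mem_bd_below.1 hx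
    obtain ⟨⟨j, hj⟩, hy1⟩ := mem_bd_below.1 hy
    have hxy := hex.symm.trans hey
    have hij := Γ.simple i j (by rw [hi, hj]; exact sameCycle_of_annulus hxy)
    have := eq_of_sameCycle_annulus hxy (by rw [← hi, ← hj, hij])
    rw [this, hy1] at hx0
    exact one_ne_zero hx0
  neU := ⟨(Γ.dart 0, 0), show (0 : ℤ) ≤ 0 from le_rfl⟩
  neV := ⟨(Γ.dart 0, 2), show ¬ (2 : ℤ) ≤ 1 by norm_num⟩

theorem exists_thin (hM : M.IsToroidal) (C : Crossing Γ) (hΓ : ¬ Γ.curve.Contractible)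
    (h3 : M.WeaklyThreeConnected) : ∃ U V, (annulus Γ).Thin U V ∧
      (∀ x : D × ℤ, x.2 ≤ 0 → x ∈ U) ∧ ∀ x ∈ V, x.2 ≤ 1 := by
  have := hM.finite
  have hN := annulus_planar hM C
  obtain ⟨U, V, hT, hU, hV⟩ := (strip_below hM hΓ hN).exists_tight hN
    ((Set.finite_univ.prod (Set.finite_singleton 1)).subset fun x hx => by
      have h1 : x.2 ≤ 1 := hx.1
      have h2 : ¬ x.2 ≤ 0 := hx.2
      exact ⟨trivial, show x.2 = 1 by omega⟩)
    ((Set.finite_univ.prod (Set.finite_singleton 0)).subset fun x hx =>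
      ⟨trivial, (mem_bd_below.1 hx).2⟩)
  refine ⟨U, V, ⟨hT, fun e he => mixed_or_mixed hM C h3 hT hU he, fun e he he' =>
    not_mixed_α_of_mixed hM C h3 hT he he', fun e he he' h h' => ?_⟩, hU, hV⟩
  exact not_mixed_α_of_mixed hM C h3 hT.compl (mem_compl_sdiff_compl.2 he)
    (mem_compl_sdiff_compl.2 he') (mixed_compl.2 h) (mixed_compl.2 h')

section

variable {U V : Set (D × ℤ)} (hT : (annulus Γ).Thin U V) (hU : ∀ x : D × ℤ, x.2 ≤ 0 → x ∈ U)
  (hV : ∀ x ∈ V, x.2 ≤ 1)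
include hT hU hV

/-- At the lower vertex some dart is outside `U`, hence above level `0`. Its translate at the upper
vertex is above level `1`, hence outside `V`, and the upper vertex would be on both boundaries. So
boundary vertices have distinct images in the torus. -/
theorem level_eq_of_mixedU {d : D} {n m : ℤ} (hn : (annulus Γ).Mixed U (d, n))
    (hm : (annulus Γ).Mixed U (d, m)) : n = m := by
  wlog h : n < m generalizing n m
  · by_contra hne
    exact hne (this hm hn (by omega)).symm
  exfalso
  obtain ⟨-, y, -, hy, -, hyU⟩ := hn
  obtain ⟨x, -, hx, -, hxU, -⟩ := id hm
  obtain ⟨d', l⟩ := y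
  refine hT.disj _ hm ⟨x, (d', l + (m - n)), hx, ?_, hT.sub hxU, fun h' => ?_⟩
  · have := sameCycle_annulus_shift (m - n) hy
    rwa [add_sub_cancel] at this
  · have h1 : l + (m - n) ≤ 1 := hV _ h'
    exact hyU (hU _ (show l ≤ 0 by omega))

theorem level_eq_of_mixedV {d : D} {n m : ℤ} (hn : (annulus Γ).Mixed V (d, n))
    (hm : (annulus Γ).Mixed V (d, m)) : n = m := by
  wlog h : n < m generalizing n m
  · by_contra hne
    exact hne (this hm hn (by omega)).symm
  exfalso
  obtain ⟨-, y, -, hy, -, hyV⟩ := id hn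
  obtain ⟨x, -, hx, -, hxV, -⟩ := hm
  obtain ⟨d', l⟩ := x
  refine hT.disj _ ⟨(d', l + (n - m)), y, ?_, hy, hU _ ?_, fun h' => hyV (hT.sub h')⟩ hn
  · have := sameCycle_annulus_shift (n - m) hx
    rwa [add_sub_cancel] at this
  · have h1 : l ≤ 1 := hV _ hxV
    change l + (n - m) ≤ 0
    omega

end

/-- The image in the torus of a cycle of the annulus that bounds a region. -/
theorem exists_cycle_of_annulus (C : Crossing Γ) {W : Set (D × ℤ)}
    (hφ : ∀ e, (annulus Γ).φ e ∈ W ↔ e ∈ W)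
    (hW : ∀ x : D × ℤ, x.2 ≤ 0 → x ∈ W) (hW' : ∀ x ∈ W, x.2 ≤ 1)
    (hmixed : ∀ d n m, (annulus Γ).Mixed W (d, n) → (annulus Γ).Mixed W (d, m) → n = m)
    {c : (annulus Γ).Cycle} (hc : ∀ d, c.HasDart d ↔ d ∈ (annulus Γ).bd W) :
    ∃ c' : M.Cycle, (∀ d, c'.HasDart d ↔ ∃ n, (d, n) ∈ (annulus Γ).bd W) ∧
      M.hol (M.dualVoltage Γ.chain) c'.curve.word c'.curve.base = 0 ∧
      M.hol (primalVoltage C.F) c'.curve.word c'.curve.base = ∑ i, C.lift (c.dart i) := by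
  have hcW : ∀ i, c.dart i ∈ (annulus Γ).bd W := fun i => (hc _).1 (c.hasDart_dart i)
  let c' : M.Cycle :=
    { n := c.n
      dart := fun i => (c.dart i).1
      next := fun i => by
        have := sameCycle_of_annulus (c.next i)
        rwa [annulus_α] at this
      simple := fun i j h => by
        refine c.simple i j ?_
        obtain ⟨k, hk⟩ := h
        have h1 : (annulus Γ).σ.SameCycle (c.dart i) (((annulus Γ).σ ^ k) (c.dart i)) := ⟨k, rfl⟩
        have h2 := (mixed_of_mem_bd hφ (hcW i)).1
        rw [mixed_congr h1] at h2
        rw [annulus_σ_zpow, hk] at h1 h2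
        have h3 := hmixed _ _ _ h2 (mixed_of_mem_bd hφ (hcW j)).1
        rw [h3] at h1
        exact h1
      reduced := fun i j h => by
        obtain ⟨hi, hi'⟩ := hcW i
        obtain ⟨hj, hj'⟩ := hcW j
        rw [annulus_α] at hi' hj'
        have hj'' := Γ.chain_α (c.dart i).1
        rw [h] at hi' hj''
        rw [← h, M.α_invol, h, hj''] at hj'
        have h1 := hW' _ hi
        have h2 := hW' _ hj
        -- Membership in `W` can only be lost as the level rises. Boundary darts over a dart and its
        -- reverse would give two strict inequalities that contradict each other.
        have key : ∀ d n m, (d, n) ∈ W → (d, m) ∉ W → n < m := by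
          intro d n m hn hm
          by_contra hlt
          have h1 : n ≤ 1 := hW' _ hn
          have h2 : 0 < m := by
            by_contra h0
            exact hm (hW _ (show m ≤ 0 by omega))
          exact hm (by rwa [show m = n by omega])
        have h3 := key (c.dart j).1 (c.dart j).2 _ hj hi'
        have h4 := key (c.dart i).1 (c.dart i).2 _ hi hj'
        omega }
  have hc'0 : c'.curve.base = c'.dart 0 := rfl
  have hc'w : c'.curve.word = c'.word CombMap.rot := rfl
  refine ⟨c', fun d => ?_, ?_, ?_⟩
  · constructor
    · rintro ⟨i, rfl⟩
      exact ⟨(c.dart i).2, hcW i⟩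
    · rintro ⟨n, hn⟩
      obtain ⟨i, hi⟩ := (hc _).2 hn
      exact ⟨i, congrArg Prod.fst hi⟩
  · rw [hc'0, hc'w, c'.hol_word CombMap.rot M.act_rot rfl]
    -- The crossings with `Γ` are the changes of level along a cycle that closes up in the annulus,
    -- so they telescope.
    have hterm : ∀ i, M.hol (M.dualVoltage Γ.chain)
        (CombMap.rot ^ (c'.next i).choose * CombMap.flip) (c'.dart i) =
        (c.dart (i + 1)).2 - (c.dart i).2 := by
      intro i
      let u : Word := CombMap.rot ^ (c'.next i).choose * CombMap.flip
      have h1 : (annulus Γ).act u (c.dart i) = (M.act u (c.dart i).1,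
          M.hol (M.dualVoltage Γ.chain) u (c.dart i).1 + (c.dart i).2) := cover_act _ _ _ _
      have h2 : M.act u (c.dart i).1 = (c.dart (i + 1)).1 := by
        simp only [u, map_mul, map_zpow, act_rot, act_flip, Equiv.Perm.mul_apply]
        exact (c'.next i).choose_spec
      have h3 : (annulus Γ).σ.SameCycle ((annulus Γ).α (c.dart i)) ((annulus Γ).act u (c.dart i)) :=
        ⟨(c'.next i).choose, by
          simp only [u, map_mul, map_zpow, act_rot, act_flip, Equiv.Perm.mul_apply]⟩
      have h4 := eq_of_sameCycle_annulus (h3.symm.trans (c.next i)) (by rw [h1]; exact h2)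
      have h5 := congrArg Prod.snd (h1.symm.trans h4)
      change M.hol _ u (c.dart i).1 = _
      simp only at h5
      omega
    rw [Finset.sum_congr rfl fun i _ => hterm i, Finset.sum_sub_distrib, sub_eq_zero]
    exact Equiv.sum_comp (Equiv.addRight 1) fun i => (c.dart i).2
  · rw [hc'0, hc'w, c'.hol_word_primal]
    rfl

/-- The image in the torus of a dual cycle of the annulus that stays on one level. -/
theorem exists_dual_cycle_of_annulus (C : Crossing Γ) {t : D → ℤ}
    (ht : ∀ d, C.F d = t (M.φ d) - t d) {c : (annulus Γ).dual.Cycle} {l : ℤ}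
    (hl : ∀ i, (c.dart i).2 = l) (hl' : ∀ i, ((annulus Γ).α (c.dart i)).2 = l) :
    ∃ c' : M.dual.Cycle, (∀ d, c'.HasDart d ↔ c.HasDart (d, l)) ∧
      M.hol (M.dualVoltage Γ.chain) (Cycle.dualCurve c').word (Cycle.dualCurve c').base = 0 ∧
      M.hol (primalVoltage C.F) (Cycle.dualCurve c').word (Cycle.dualCurve c').base =
        ∑ i, (t (M.φ (c.dart i).1) - t (M.α (c.dart i).1)) := by
  have hdart : ∀ i, c.dart i = ((c.dart i).1, l) := fun i => Prod.ext rfl (hl i)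
  let c' : M.dual.Cycle :=
    { n := c.n
      dart := fun i => (c.dart i).1
      next := fun i => by
        obtain ⟨k, hk⟩ := c.next i
        refine ⟨k, ?_⟩
        have h := congrArg Prod.fst hk
        change (((annulus Γ).φ ^ k) ((annulus Γ).α (c.dart i))).1 = _ at h
        rw [annulus_φ_zpow] at h
        exact h
      simple := fun i j h => by
        refine c.simple i j ?_
        obtain ⟨k, hk⟩ := h
        refine ⟨k, ?_⟩
        change ((annulus Γ).φ ^ k) (c.dart i) = _
        rw [annulus_φ_zpow, hdart j, hl i]
        exact Prod.ext hk rfl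
      reduced := fun i j h => by
        refine c.reduced i j (Prod.ext h ?_)
        rw [hl j]
        exact hl' i }
  have hc'0 : (Cycle.dualCurve c').base = c'.dart 0 := rfl
  have hc'w : (Cycle.dualCurve c').word = c'.word faceRot := rfl
  refine ⟨c', fun d => ?_, ?_, ?_⟩
  · constructor
    · rintro ⟨i, rfl⟩
      exact ⟨i, hdart i⟩
    · rintro ⟨i, hi⟩
      exact ⟨i, congrArg Prod.fst hi⟩
  · rw [hc'0, hc'w, c'.hol_word faceRot M.act_faceRot rfl]
    refine Finset.sum_eq_zero fun i _ => ?_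
    have h1 := M.potential_zpow (M.dualVoltage Γ.chain) (R := faceRot) (s := fun _ => 0)
      (fun d => by rw [hol_dualVoltage_faceRot Γ.chain_α, add_zero]) (c'.next i).choose
      (M.α (c'.dart i))
    have h2 := hl' i
    rw [annulus_α, hl i] at h2
    rw [hol_mul, hol_dualVoltage_flip, act_flip]
    change _ + Γ.chain (c.dart i).1 = 0
    simp only at h2
    omega
  · rw [hc'0, hc'w, c'.hol_word faceRot M.act_faceRot rfl]
    -- The flip contributes `F`, the turn inside the next face an increment of `t`. The terms are
    -- regrouped so that the second difference telescopes.
    have hterm : ∀ i, M.hol (primalVoltage C.F)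
        (faceRot ^ (c'.next i).choose * CombMap.flip) (c'.dart i) =
        (t (M.φ (c.dart i).1) - t (M.α (c.dart i).1)) +
          (t (c.dart (i + 1)).1 - t (c.dart i).1) := by
      intro i
      have h1 := M.potential_zpow (primalVoltage C.F) (R := faceRot) (s := t)
        (fun d => by rw [act_faceRot, hol_faceRot]; simp [ht]) (c'.next i).choose
        (M.α (c'.dart i))
      have h2 : M.act (faceRot ^ (c'.next i).choose) (M.α (c'.dart i)) = c'.dart (i + 1) := by
        rw [map_zpow, act_faceRot]
        exact (c'.next i).choose_spec
      rw [h2] at h1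
      rw [hol_mul, act_flip, hol_flip, primalVoltage_false, ht]
      change t (c.dart (i + 1)).1 = _ + t (M.α (c.dart i).1) at h1
      change M.hol _ _ (M.α (c'.dart i)) + (t (M.φ (c.dart i).1) - t (c.dart i).1) = _
      linarith
    rw [Finset.sum_congr rfl fun i _ => hterm i, Finset.sum_add_distrib]
    refine add_eq_left.2 ?_
    rw [Finset.sum_sub_distrib, sub_eq_zero]
    exact Equiv.sum_comp (Equiv.addRight 1) fun i => t (c.dart i).1

/-- Closed curves with the same intersection numbers are homotopic. -/
theorem Crossing.homotopic (C : Crossing Γ) (hM : M.IsToroidal) {γ γ' : M.ClosedCurve}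
    (h1 : M.hol (M.dualVoltage Γ.chain) γ.word γ.base =
      M.hol (M.dualVoltage Γ.chain) γ'.word γ'.base)
    (h2 : M.hol (primalVoltage C.F) γ.word γ.base = M.hol (primalVoltage C.F) γ'.word γ'.base) :
    γ.Homotopic γ' := by
  obtain ⟨g, hg⟩ := hM.connected γ.base γ'.base
  have hgi : M.act g⁻¹ γ'.base = γ.base := by rw [map_inv, Equiv.Perm.inv_eq_iff_eq, hg]
  have hwi : M.act γ'.word⁻¹ γ'.base = γ'.base := by
    rw [map_inv, Equiv.Perm.inv_eq_iff_eq, γ'.closed]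
  have hhol : ∀ v : Bool → D → ℤ, M.hol v (g * γ.word * g⁻¹ * γ'.word⁻¹) γ'.base =
      M.hol v γ.word γ.base - M.hol v γ'.word γ'.base := by
    intro v
    rw [hol_mul, hol_mul, hol_mul, hwi, hgi, γ.closed, M.hol_inv v γ'.word, hwi, M.hol_inv v g, hgi]
    ring
  refine ⟨g, hg, (annulus_mem_nullLoops_iff hM C ?_).2 ⟨?_, ?_⟩⟩
  · simp only [map_mul, Equiv.Perm.mul_apply, hwi, hgi, γ.closed, hg]
  · rw [hhol, h1, sub_self]
  · rw [hhol, h2, sub_self]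

theorem Crossing.not_contractible (C : Crossing Γ) (hM : M.IsToroidal) {γ : M.ClosedCurve}
    (h : M.hol (primalVoltage C.F) γ.word γ.base ≠ 0) : ¬ γ.Contractible := fun hγ =>
  h ((annulus_mem_nullLoops_iff hM C γ.closed).1 hγ).2

end AnnulusStrip

end CombMap

namespace CombMap

theorem Cycle.sum_dart {E : Type*} {N : CombMap E} (c : N.Cycle) {B : Finset E}
    (hB : ∀ e, e ∈ B ↔ c.HasDart e) (f : E → ℤ) : ∑ i, f (c.dart i) = ∑ e ∈ B, f e :=
  Finset.sum_bij (fun i _ => c.dart i) (fun i _ => (hB _).2 (c.hasDart_dart i))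
    (fun _ _ _ _ h => c.dart_injective h)
    (fun e he => by
      obtain ⟨i, hi⟩ := (hB e).1 he
      exact ⟨i, Finset.mem_univ i, hi⟩) fun _ _ => rfl

/-! ### The tambourine as the image of a thin strip. -/

section Tambourine

variable {D : Type*} {M : CombMap D} {Γ : M.Cycle}

theorem level_eq_one {U V : Set (D × ℤ)} (hU : ∀ x : D × ℤ, x.2 ≤ 0 → x ∈ U)
    (hV : ∀ x ∈ V, x.2 ≤ 1) {x : D × ℤ} (hx : x ∈ V \ U) : x.2 = 1 := by
  have h1 := hV x hx.1
  have h2 : ¬ x.2 ≤ 0 := fun h => hx.2 (hU x h)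
  omega

theorem mk_one_mem {U V : Set (D × ℤ)} (hU : ∀ x : D × ℤ, x.2 ≤ 0 → x ∈ U)
    (hV : ∀ x ∈ V, x.2 ≤ 1) {x : D × ℤ} (hx : x ∈ V \ U) : (x.1, 1) ∈ V \ U := by
  rw [← level_eq_one hU hV hx]
  exact hx

/-- The value of the cocycle on the boundary of a region between two levels. -/
theorem Crossing.sum_lift_bd (C : Crossing Γ) [Finite D] {W : Set (D × ℤ)}
    (hφ : ∀ e, (annulus Γ).φ e ∈ W ↔ e ∈ W)
    (hW : ∀ x : D × ℤ, x.2 ≤ 0 → x ∈ W) (hW' : ∀ x ∈ W, x.2 ≤ 1)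
    {c : (annulus Γ).Cycle} (hc : ∀ d, c.HasDart d ↔ d ∈ (annulus Γ).bd W) :
    ∑ i, C.lift (c.dart i) = 1 := by
  classical
  let B : Finset (D × ℤ) := Finset.univ.image c.dart
  have hB : ∀ e, e ∈ B ↔ c.HasDart e := fun e => by simp [B, Cycle.HasDart]
  -- The lift of `Γ` at level `0`, on which the cocycle sums to `1`. Only finitely many darts lie
  -- between it and the boundary of `W`.
  let A : Finset (D × ℤ) := Finset.univ.image fun i => (Γ.dart i, 0)
  have hA : ∀ e, e ∈ A ↔ e ∈ (annulus Γ).bd (below D 0) := fun e => by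
    rw [mem_bd_below]
    simp only [A, Finset.mem_image, Finset.mem_univ, true_and, Cycle.HasDart]
    exact ⟨fun ⟨i, hi⟩ => by rw [← hi]; exact ⟨⟨i, rfl⟩, rfl⟩,
      fun ⟨⟨i, hi⟩, h⟩ => ⟨i, Prod.ext hi h.symm⟩⟩
  rw [c.sum_dart hB, ← sum_bd_eq (fun e => by rw [annulus_φ]; rfl) hφ hW
    ((Set.finite_univ.prod (Set.finite_singleton 1)).subset fun x hx =>
      ⟨trivial, level_eq_one (U := below D 0) (fun _ h => h) hW' hx⟩)
    C.lift_α C.lift_mem hA fun e => (hB e).trans (hc e),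
    Finset.sum_image fun i _ j _ h => Γ.dart_injective (congrArg Prod.fst h), ← C.hol_F]
  exact (Γ.hol_word_primal C.F).symm

/-- Both boundaries and the dual cycle have crossing number `0` with `Γ` and cocycle value `1`,
exactly as `Γ` has. As the strip lies in level `1`, its faces and inside edges are faithfully
represented in the torus. -/
theorem exists_tambourine (hM : M.IsToroidal) (C : Crossing Γ) {U V : Set (D × ℤ)}
    (hT : (annulus Γ).Thin U V) (hU : ∀ x : D × ℤ, x.2 ≤ 0 → x ∈ U) (hV : ∀ x ∈ V, x.2 ≤ 1) :
    ∃ Γ₁ Γ₂ : M.Cycle, Γ₁.curve.Homotopic Γ.curve ∧ Γ₂.curve.Homotopic Γ.curve ∧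
      IsTambourine Γ₁ Γ₂ := by
  classical
  have := hM.finite
  have hN := annulus_planar hM C
  have hone : ∀ {x : D × ℤ}, x ∈ V \ U → x.2 = 1 := level_eq_one hU hV
  have hmk : ∀ {x : D × ℤ}, x ∈ V \ U → (x.1, 1) ∈ V \ U := mk_one_mem hU hV
  have hU1 : ∀ x ∈ U, x.2 ≤ 1 := fun x hx => hV x (hT.sub hx)
  have hV0 : ∀ x : D × ℤ, x.2 ≤ 0 → x ∈ V := fun x hx => hT.sub (hU x hx)
  obtain ⟨t, ht⟩ := C.F_mem
  obtain ⟨c₁, hc₁⟩ := hN.exists_cycle_bd hT.φU hT.connU hT.connU' hT.neU hT.neU' hT.finU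
  obtain ⟨c₂, hc₂⟩ := hN.exists_cycle_bd hT.φV hT.connV hT.connV' hT.neV' hT.neV hT.finV
  obtain ⟨c₃, hc₃⟩ := hT.exists_dual_cycle hN
  obtain ⟨Γ₁, hΓ₁, hδ₁, hF₁⟩ := exists_cycle_of_annulus C hT.φU hU hU1
    (fun _ _ _ => level_eq_of_mixedU hT hU hV) hc₁
  obtain ⟨Γ₂, hΓ₂, hδ₂, hF₂⟩ := exists_cycle_of_annulus C hT.φV hV0 hV
    (fun _ _ _ => level_eq_of_mixedV hT hU hV) hc₂
  have hc₃' : ∀ i, (annulus Γ).α (c₃.dart i) ∈ (annulus Γ).crossDarts U V := fun i =>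
    (hc₃ _).1 (c₃.hasDart_dart i)
  obtain ⟨Δ, hΔ, hδ₃, hF₃⟩ := exists_dual_cycle_of_annulus C ht (c := c₃) (l := 1)
    (fun i => hone (by have := (hc₃' i).2.1; rwa [(annulus Γ).α_invol] at this))
    (fun i => hone (hc₃' i).1)
  rw [C.sum_lift_bd hT.φU hU hU1 hc₁] at hF₁
  rw [C.sum_lift_bd hT.φV hV0 hV hc₂] at hF₂
  have hF₃' : M.hol (primalVoltage C.F) (Cycle.dualCurve Δ).word (Cycle.dualCurve Δ).base = 1 := by
    rw [hF₃, ← C.sum_lift_bd hT.φU hU hU1 hc₁,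
      c₁.sum_dart (B := Finset.univ.image c₁.dart) (fun e => by simp [Cycle.HasDart]) C.lift,
      ← hT.sum_eq (t := fun x => t x.1) (Y := Finset.univ.image c₃.dart) C.lift_α
        (fun e => by rw [annulus_φ]; exact ht e.1)
        (fun e => by rw [← hc₃]; simp [Cycle.HasDart])
        (fun e => by rw [← hc₁]; simp [Cycle.HasDart]),
      ← c₃.sum_dart (fun e => by simp [Cycle.HasDart])
        fun e => t ((annulus Γ).φ e).1 - t ((annulus Γ).α e).1]
    simp only [annulus_φ, annulus_α]
  have hδ₀ := Γ.hol_chain_curve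
  have hα1 : ∀ {d}, (d, 1) ∈ V \ U → (annulus Γ).α (d, 1) ∈ V \ U →
      Γ.chain d = 0 ∧ (M.α d, 1) ∈ V \ U := by
    intro d _ h
    have h1 : Γ.chain d + 1 = 1 := hone h
    exact ⟨by omega, hmk h⟩
  have hα2 : ∀ {d}, (d, 1) ∈ V \ U → (annulus Γ).α (d, 1) ∈ V \ U →
      (annulus Γ).α (M.α d, 1) = (d, 1) := by
    intro d h h'
    rw [annulus_α, M.α_invol, Γ.chain_α, (hα1 h h').1]
    rfl
  -- An inside edge has crossing number `0` with `Γ`, so a boundary dart over it would have to be at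
  -- level `1`, where both its sides are in the strip.
  have hnd : ∀ {d}, (d, 1) ∈ V \ U → (annulus Γ).α (d, 1) ∈ V \ U →
      ¬ Γ₁.HasDart d ∧ ¬ Γ₂.HasDart d := by
    intro d h h'
    have h0 := (hα1 h h').1
    have hlev : ∀ n, n ≤ 1 → (annulus Γ).α (d, n) ∉ U → n = 1 := by
      intro n hn hn'
      by_contra hne
      refine hn' (hU _ ?_)
      change Γ.chain d + n ≤ 0
      omega
    constructor
    · rw [hΓ₁]
      rintro ⟨n, hn⟩
      rw [hlev n (hU1 _ hn.1) hn.2] at hn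
      exact h.2 hn.1
    · rw [hΓ₂]
      rintro ⟨n, hn⟩
      rw [hlev n (hV _ hn.1) fun hc => hn.2 (hT.sub hc)] at hn
      exact hn.2 h'.1
  have hne : ∀ {d}, (d, 1) ∈ V \ U → (annulus Γ).α (d, 1) ∈ V \ U →
      ¬ Γ₁.HasEdge d ∧ ¬ Γ₂.HasEdge d := by
    intro d h h'
    have h1 := hnd h h'
    have h2 := hnd (hα1 h h').2 (by rw [hα2 h h']; exact h)
    exact ⟨not_or.2 ⟨h1.1, h2.1⟩, not_or.2 ⟨h1.2, h2.2⟩⟩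
  have hcases : ∀ {d}, (d, 1) ∈ V \ U → (annulus Γ).α (d, 1) ∈ V \ U ∨ Γ₁.HasDart (M.α d) ∨
      Γ₂.HasDart d := by
    intro d h
    rcases hT.α_cases h with h1 | h1 | h1
    · exact .inl h1
    · exact .inr (.inl ((hΓ₁ _).2 ⟨_, h1.1⟩))
    · exact .inr (.inr ((hΓ₂ _).2 ⟨_, h1.1⟩))
  have hside₁ : ∀ {d}, Γ₁.HasDart (M.α d) → (d, 1) ∈ V \ U := by
    intro d h
    obtain ⟨n, hn⟩ := (hΓ₁ _).1 h
    have h1 : (annulus Γ).α (M.α d, n) ∈ V \ U := by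
      refine ⟨?_, hn.2⟩
      by_contra hc
      exact hT.disj _ (mixed_of_mem_bd hT.φU hn).1 (mixed_of_mem_bd hT.φV ⟨hT.sub hn.1, hc⟩).1
    have h2 := hmk h1
    rwa [annulus_α, M.α_invol] at h2
  have hside₂ : ∀ {d}, Γ₂.HasDart d → (d, 1) ∈ V \ U := by
    intro d h
    obtain ⟨n, hn⟩ := (hΓ₂ _).1 h
    refine hmk (x := (d, n)) ⟨hn.1, fun hc => ?_⟩
    exact hT.disj _ (mixed_of_mem_bd hT.φU ⟨hc, fun h => hn.2 (hT.sub h)⟩).1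
      (mixed_of_mem_bd hT.φV hn).1
  let T : Set M.Face := {f | ∃ d, M.leftFace d = f ∧ (d, 1) ∈ V \ U}
  have hmemT : ∀ d, M.leftFace d ∈ T ↔ (d, 1) ∈ V \ U := by
    refine fun d => ⟨?_, fun h => ⟨d, rfl, h⟩⟩
    rintro ⟨d', hd', h⟩
    obtain ⟨k, hk⟩ : M.φ.SameCycle d' d := Quotient.exact hd'
    refine (hT.mem_diff_iff (x := (d', 1)) ⟨k, ?_⟩).2 h
    rw [annulus_φ_zpow, hk]
  have hInside : ∀ d, Inside Γ₁ Γ₂ T d ↔ (d, 1) ∈ V \ U ∧ (annulus Γ).α (d, 1) ∈ V \ U := by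
    intro d
    constructor
    · rintro ⟨h1, -, h3, h4⟩
      have h5 := (hmemT d).1 h1
      rcases hcases h5 with h6 | h6 | h6
      · exact ⟨h5, h6⟩
      · exact absurd (.inr h6) h3
      · exact absurd (.inl h6) h4
    · rintro ⟨h1, h2⟩
      exact ⟨(hmemT d).2 h1, (hmemT _).2 (hα1 h1 h2).2, (hne h1 h2).1, (hne h1 h2).2⟩
  have hΔedge : ∀ d, Δ.HasEdge d ↔ Inside Γ₁ Γ₂ T d := by
    intro d
    rw [hInside]
    have hdart : ∀ d, Δ.HasDart d → (d, 1) ∈ V \ U ∧ (annulus Γ).α (d, 1) ∈ V \ U := by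
      intro d h
      have h1 := (hc₃ _).1 ((hΔ d).1 h)
      have h2 := h1.2.1
      rw [(annulus Γ).α_invol] at h2
      exact ⟨h2, h1.1⟩
    constructor
    · rintro (h | h)
      · exact hdart d h
      · obtain ⟨h1, h2⟩ := hdart _ h
        change (M.α d, 1) ∈ V \ U at h1
        change (annulus Γ).α (M.α d, 1) ∈ V \ U at h2
        have h3 := hα2 h1 h2
        have h4 := (hα1 h1 h2).2
        rw [M.α_invol] at h3 h4
        exact ⟨h4, by rw [h3]; exact h1⟩
    · rintro ⟨h1, h2⟩
      have h4 : (annulus Γ).α (d, 1) = (M.α d, 1) := by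
        rw [annulus_α, (hα1 h1 h2).1]
        rfl
      rcases hT.mem_crossDarts_or h1 h2 with h3 | h3
      · right
        refine (hΔ (M.α d)).2 ((hc₃ _).2 ?_)
        rw [← h4, (annulus Γ).α_invol]
        exact h3
      · exact .inl ((hΔ d).2 ((hc₃ _).2 h3))
  have hstep : ∀ i, Inside Γ₁ Γ₂ T (Δ.dart i) ∧
      M.leftFace (M.α (Δ.dart i)) = M.leftFace (Δ.dart (i + 1)) := fun i =>
    ⟨(hΔedge _).1 (.inl (Δ.hasDart_dart i)), Quotient.sound (Δ.next i)⟩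
  -- The dual cycle crosses only inside edges and visits every face of `T`, so following it connects
  -- `T`.
  have hwalk : ∀ i (k : ℕ), Relation.ReflTransGen
      (fun f g => ∃ d, Inside Γ₁ Γ₂ T d ∧ M.leftFace d = f ∧ M.leftFace (M.α d) = g)
      (M.leftFace (Δ.dart i)) (M.leftFace (Δ.dart (i + Fin.ofNat (Δ.n + 1) k))) := by
    intro i k
    induction k with
    | zero => simpa using Relation.ReflTransGen.refl
    | succ k ih =>
      refine ih.tail ⟨_, (hstep _).1, rfl, ?_⟩
      rw [(hstep _).2, add_assoc]
      congr 3
      ext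
      simp [Fin.val_add]
  have hface : ∀ f ∈ T, ∃ i, M.leftFace (Δ.dart i) = f := by
    rintro _ ⟨d, rfl, hd⟩
    obtain ⟨x, hx, hdx⟩ := hT.exists_α_mem_crossDarts hN hd
    have hx1 := hone ((hT.mem_diff_iff hdx).2 hd)
    obtain ⟨i, hi⟩ := (hΔ x.1).2 ((hc₃ _).2 (by rw [← hx1]; exact hx))
    refine ⟨i, Quotient.sound ?_⟩
    obtain ⟨k, hk⟩ := hdx.symm
    rw [annulus_φ_zpow] at hk
    exact ⟨k, by rw [hi]; exact congrArg Prod.fst hk⟩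
  have hne1 : (1 : ℤ) ≠ 0 := one_ne_zero
  refine ⟨Γ₁, Γ₂, C.homotopic hM (hδ₁.trans hδ₀.symm) (hF₁.trans C.hol_F.symm),
    C.homotopic hM (hδ₂.trans hδ₀.symm) (hF₂.trans C.hol_F.symm),
    C.not_contractible hM (by rw [hF₁]; exact hne1), C.not_contractible hM (by rw [hF₂]; exact hne1),
    C.homotopic hM (hδ₁.trans hδ₂.symm) (hF₁.trans hF₂.symm), T, ⟨?_, ?_, ?_⟩, Δ, hΔedge,
    C.not_contractible hM (by rw [hF₃']; exact hne1),
    C.homotopic hM (hδ₃.trans hδ₁.symm) (hF₃'.trans hF₁.symm),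
    C.homotopic hM (hδ₃.trans hδ₂.symm) (hF₃'.trans hF₂.symm)⟩
  · intro d hd
    rw [hmemT]
    constructor
    · intro h
      refine (hcases h).resolve_left fun h' => ?_
      exact hd.elim (hne h h').1 (hne h h').2
    · rintro (h | h)
      · exact hside₁ h
      · exact hside₂ h
  · intro d h1 h2 h
    rw [hmemT] at h ⊢
    rcases hcases h with h6 | h6 | h6
    · exact (hα1 h h6).2
    · exact absurd (.inr h6) h1
    · exact absurd (.inl h6) h2
  · intro f hf g hg
    obtain ⟨i, rfl⟩ := hface f hf
    obtain ⟨j, rfl⟩ := hface g hg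
    have := hwalk i (j - i).val
    rwa [Fin.ofNat_val_eq_self, add_sub_cancel] at this

end Tambourine

end CombMap

theorem mainTheorem4 {D : Type*} (M : CombMap D) (hM : M.IsToroidal)
    (h3 : M.WeaklyThreeConnected) (Γ : M.Cycle) (hΓ : ¬ Γ.curve.Contractible) :
    ∃ Γ₁ Γ₂ : M.Cycle, Γ₁.curve.Homotopic Γ.curve ∧ Γ₂.curve.Homotopic Γ.curve ∧
      CombMap.IsTambourine Γ₁ Γ₂ := by
  obtain ⟨ω, F, h1, h2, h4, h5, h6⟩ := hM.exists_crossing hΓ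
  let C : CombMap.Crossing Γ := ⟨ω, F, h1, h2, h4, h5, h6⟩
  obtain ⟨U, V, hT, hU, hV⟩ := CombMap.exists_thin hM C hΓ h3
  exact CombMap.exists_tambourine hM C hT hU hV
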